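/- **Theorem 4.2.** *Nonuniformly expanding maps.* Let $(M,d_M)$ be a locally compact separable bounded metric space with a finite Borel measure $m$. A nonsingular map $T:M\to M$ for which $m$ is ergodic is *nonuniformly expanding* if there are a measurable set $Y\subset M$ with $m(Y)>0$, an at most countable measurable partition $\alpha$ of $Y$ (modulo $m$-null sets) with $m(A)>0$ for $A\in\alpha$, an $m$-integrable return time $\tau:Y\to\{1,2,\dots\}$ constant on each $A\in\alpha$, and constants $\lambda>1$, $\eta\in(0,1]$, $C_0,C_1\ge1$ such that, writing $F=T^{\tau}$, for each $A\in\alpha$ and all $x,y\in A$: 1. $F$ restricts to a measure-theoretic bijection from $A$ onto $Y$; 2. $d_M(Fx,Fy)\ge\lambda d_M(x,y)$; 3. $d_M(T^\ell x,T^\ell y)\le C_0\,d_M(Fx,Fy)$ for $0\le\ell<\tau(A)$; 4. $\zeta=\frac{dm|_Y}{dm|_Y\circ F}$ satisfies $|\log\zeta(x)-\log\zeta(y)|\le C_1 d_M(Fx,Fy)^\eta$. Let $\varepsilon_0>0$ and $p>1$. A family $T_\varepsilon:M\to M$, $\varepsilon\in[0,\varepsilon_0)$, is a *uniform family of nonuniformly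 expanding maps of order $p$* if each $T_\varepsilon$ is nonuniformly expanding, with data $Y_\varepsilon,\alpha_\varepsilon,\tau_\varepsilon$ and with constants $\lambda,\eta,C_0,C_1$ independent of $\varepsilon$, and $$\sup_{\varepsilon\in[0,\varepsilon_0)}\frac1{m(Y_\varepsilon)}\int_{Y_\varepsilon}\tau_\varepsilon^{\,p}\,dm<\infty .$$ (If $\inf_\varepsilon m(Y_\varepsilon)>0$, for instance if $Y_\varepsilon$ does not depend on $\varepsilon$, this is the same as $\sup_\varepsilon\int_{Y_\varepsilon}\tau_\varepsilon^{\,p}\,dm<\infty$.) *Order function.* Let $\nu_\varepsilon$ be the $T_\varepsilon$-invariant ergodic probability measure with $\nu_\varepsilon\ll m$. Use the maximum norm on $\mathbb R^d$ and on $d\times d$ matrices, fix $x_0\in\mathbb R^d$ and $L_1,L_2,L_3\ge1$, and put $E=\{x\in\mathbb R^d:|x-x_0|\le L_1\}$. For functions $g(x,y,\varepsilon)$ let $\|g\|_{\rm Lip}=|g|_\infty+\sup_\varepsilon{\rm Lip}\,g(\cdot,\cdot,\varepsilon)$, the Lipschitz constant being with respect to $|x-x'|+d_M(y,y')$. Let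 $a:\mathbb R^d\times M\times[0,\varepsilon_0)\to\mathbb R^d$ satisfy $\|a\|_{\rm Lip}\le L_1$, let $a$ be differentiable in $x$ at the points of $E$ with derivative $D a=\partial a/\partial x$ satisfying $\|Da|_E\|_{\rm Lip}\le L_2$, and let $\sup_{x\in E,\,y\in M}|a(x,y,\varepsilon)-a(x,y,0)|\le L_3\varepsilon$ for all $\varepsilon\in[0,\varepsilon_0)$. Put $v_{\varepsilon,x}(y)=a(x,y,\varepsilon)-\int_M a(x,\cdot,\varepsilon)\,d\nu_\varepsilon$ and $$\delta_\varepsilon=\sup_{x\in E}\sup_{1\le n\le1/\varepsilon}\varepsilon\Bigl|\sum_{j=0}^{n-1}v_{\varepsilon,x}\circ T_\varepsilon^j\Bigr|+\sup_{x\in E}\sup_{1\le n\le1/\varepsilon}\varepsilon\Bigl|\sum_{j=0}^{n-1}(Dv_{\varepsilon,x})\circ T_\varepsilon^j\Bigr|$$ (all $n\ge1$ are allowed if $\varepsilon=0$; a supremum over no $n$ is $0$). *Conclusion.* If $T_\varepsilon$ is a uniform family of nonuniformly expanding maps of order $p>1$, then there is a constant $C>0$ such that for all $\varepsilon\in[0,\varepsilon_0)$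 the function $\delta_\varepsilon^{\,p+d-1}$ is $\nu_\varepsilon$-integrable and $$\int_M\delta_\varepsilon^{\,p+d-1}\,d\nu_\varepsilon\le\begin{cases}C\varepsilon^{(p-1)/2},&p>2,\\ C\varepsilon^{(p-1)^2/p},&p\in(1,2].\end{cases}$$ -/

import Mathlib

open Set MeasureTheory Filter Topology
open scoped ENNReal NNReal

namespace FastSlow

section Expanding

variable {M : Type*} [MetricSpace M] [MeasurableSpace M]

/-- The induced map `F y = T^{τ(y)} y`. -/
def inducedMap (T : M → M) (τ : M → ℕ) (y : M) : M := T^[τ y] y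

/-- `Y`, `α`, `τ` form an inducing scheme for `T` with constants `lam`, `η`, `C₀`, `C₁`: `α` is an at
most countable measurable partition of `Y` (modulo `m`-null sets), the integrable return time `τ` is
constant on the elements of `α`, and `F = T^τ` satisfies the four expansion/distortion conditions.
(The values of `τ` off the partition elements are irrelevant.) -/
structure IsInducingScheme (m : Measure M) (T : M → M) (Y : Set M) (α : Set (Set M)) (τ : M → ℕ)
    (lam η C₀ C₁ : ℝ) : Prop where
  measurableSet_base : MeasurableSet Y
  base_pos : 0 < m Y
  countable : α.Countable
  measurableSet_elem : ∀ A ∈ α, MeasurableSet A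
  elem_subset : ∀ A ∈ α, A ⊆ Y
  elem_pos : ∀ A ∈ α, 0 < m A
  disjoint : α.PairwiseDisjoint id
  cover : m (Y \ ⋃₀ α) = 0
  one_le_time : ∀ A ∈ α, ∀ x ∈ A, 1 ≤ τ x
  time_const : ∀ A ∈ α, ∀ x ∈ A, ∀ y ∈ A, τ x = τ y
  time_integrable : IntegrableOn (fun x => (τ x : ℝ)) Y m
  /-- (1) `F` restricts to a measure-theoretic bijection from `A` onto `Y` (nonsingularity in both
  directions is part of the existence of the density in (4)). -/
  mapsTo : ∀ A ∈ α, MapsTo (inducedMap T τ) A Y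
  injOn : ∀ A ∈ α, InjOn (inducedMap T τ) A
  onto : ∀ A ∈ α, m (Y \ inducedMap T τ '' A) = 0
  /-- (2) expansion -/
  expand : ∀ A ∈ α, ∀ x ∈ A, ∀ y ∈ A,
    lam * dist x y ≤ dist (inducedMap T τ x) (inducedMap T τ y)
  /-- (3) control of the intermediate iterates -/
  intermediate : ∀ A ∈ α, ∀ x ∈ A, ∀ y ∈ A, ∀ l < τ x,
    dist (T^[l] x) (T^[l] y) ≤ C₀ * dist (inducedMap T τ x) (inducedMap T τ y)
  /-- (4) bounded distortion: `ζ = dm|_Y / (dm|_Y ∘ F)` is a positive density, that is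
  `m (F B) = ∫_B ζ⁻¹ dm` for measurable subsets `B` of partition elements. -/
  distortion : ∃ ζ : M → ℝ, Measurable ζ ∧ ∀ A ∈ α, (∀ x ∈ A, 0 < ζ x) ∧
    (∀ B, MeasurableSet B → B ⊆ A →
      m (inducedMap T τ '' B) = ∫⁻ x in B, ENNReal.ofReal (ζ x)⁻¹ ∂m) ∧
    ∀ x ∈ A, ∀ y ∈ A, |Real.log (ζ x) - Real.log (ζ y)| ≤
      C₁ * dist (inducedMap T τ x) (inducedMap T τ y) ^ η

/-- `T_ε`, `ε ∈ [0, ε₀)`, is a uniform family of nonuniformly expanding maps of order `p`: each `T_ε`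
is nonsingular, `m` is ergodic for it, and it has an inducing scheme `(Y_ε, α_ε, τ_ε)`, with constants
`lam`, `η`, `C₀`, `C₁` not depending on `ε` and return times bounded in `L^p` uniformly in `ε`.
The `L^p` norm on `Y_ε` is taken for the normalised measure `m|_{Y_ε} / m(Y_ε)`. -/
def IsUniformFamily (m : Measure M) (T : ℝ → M → M) (ε₀ p : ℝ) : Prop :=
  ∃ lam η C₀ C₁ : ℝ, ∃ K : ℝ≥0, 1 < lam ∧ 0 < η ∧ η ≤ 1 ∧ 1 ≤ C₀ ∧ 1 ≤ C₁ ∧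
    ∀ ε ∈ Ico 0 ε₀, QuasiErgodic (T ε) m ∧
      ∃ (Y : Set M) (α : Set (Set M)) (τ : M → ℕ),
        IsInducingScheme m (T ε) Y α τ lam η C₀ C₁ ∧
        ⨍⁻ x in Y, (τ x : ℝ≥0∞) ^ p ∂m ≤ K

end Expanding

section Averaging

variable {M : Type*} {d : ℕ}

/-- `‖g‖_Lip = |g|_∞ + sup_ε Lip g(·,·,ε)` for `g` restricted to `x ∈ E` and `ε ∈ [0, ε₀)`, as an
extended nonnegative number. -/
noncomputable def lipNorm [MetricSpace M] {F : Type*} [NormedAddCommGroup F]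
    (E : Set (Fin d → ℝ)) (ε₀ : ℝ) (g : (Fin d → ℝ) → M → ℝ → F) : ℝ≥0∞ :=
  (⨆ ε ∈ Ico 0 ε₀, ⨆ x ∈ E, ⨆ y : M, ‖g x y ε‖ₑ) +
  ⨆ ε ∈ Ico 0 ε₀, ⨆ x ∈ E, ⨆ x' ∈ E, ⨆ y : M, ⨆ y' : M,
    ‖g x y ε - g x' y' ε‖ₑ / (edist x x' + edist y y')

/-- The Jacobian matrix of `g : ℝ^d → ℝ^d` at `x`; as a function of two indices it carries the maximum
norm. -/
noncomputable def jac (g : (Fin d → ℝ) → (Fin d → ℝ)) (x : Fin d → ℝ) : Fin d → Fin d → ℝ :=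
  fun i j => fderiv ℝ g x (Pi.single j 1) i

/-- The regularity assumptions on `a : ℝ^d × M × [0, ε₀) → ℝ^d`. Here `ℝ^d = Fin d → ℝ` has the maximum
norm and `E = {x : |x - x₀| ≤ L₁}` is `Metric.closedBall x₀ L₁`. -/
structure IsRegular [MetricSpace M] (a : (Fin d → ℝ) → M → ℝ → (Fin d → ℝ)) (x₀ : Fin d → ℝ)
    (ε₀ L₁ L₂ L₃ : ℝ) : Prop where
  lip : lipNorm univ ε₀ a ≤ ENNReal.ofReal L₁
  differentiableAt : ∀ ε ∈ Ico 0 ε₀, ∀ y, ∀ x ∈ Metric.closedBall x₀ L₁,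
    DifferentiableAt ℝ (fun x' => a x' y ε) x
  lip_deriv : lipNorm (Metric.closedBall x₀ L₁) ε₀ (fun x y ε => jac (fun x' => a x' y ε) x)
    ≤ ENNReal.ofReal L₂
  param : ∀ ε ∈ Ico 0 ε₀, ∀ x ∈ Metric.closedBall x₀ L₁, ∀ y, ‖a x y ε - a x y 0‖ ≤ L₃ * ε

variable [MeasurableSpace M]

/-- `v_{ε,x}(y) = a(x,y,ε) - ∫ a(x,·,ε) dν_ε`. -/
noncomputable def centred (a : (Fin d → ℝ) → M → ℝ → (Fin d → ℝ)) (ν : ℝ → Measure M) (ε : ℝ)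
    (x : Fin d → ℝ) (y : M) : Fin d → ℝ :=
  a x y ε - ∫ z, a x z ε ∂(ν ε)

/-- `δ_{1,ε}(y) = sup_{x ∈ E} sup_{1 ≤ n ≤ 1/ε} ε |∑_{j<n} v_{ε,x}(T_ε^j y)|`. The condition `n ≤ 1/ε`
is written `ε n ≤ 1`; all `n ≥ 1` are allowed for `ε = 0`, and the supremum is `0` if there is no such
`n`. -/
noncomputable def order₁ (a : (Fin d → ℝ) → M → ℝ → (Fin d → ℝ)) (T : ℝ → M → M)
    (ν : ℝ → Measure M) (E : Set (Fin d → ℝ)) (ε : ℝ) (y : M) : ℝ :=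
  sSup {r : ℝ | ∃ x ∈ E, ∃ n : ℕ, 1 ≤ n ∧ ε * n ≤ 1 ∧
    r = ε * ‖∑ j ∈ Finset.range n, centred a ν ε x ((T ε)^[j] y)‖}

/-- `δ_{2,ε}(y) = sup_{x ∈ E} sup_{1 ≤ n ≤ 1/ε} ε |∑_{j<n} (D v_{ε,x})(T_ε^j y)|`, `D = ∂/∂x`. -/
noncomputable def order₂ (a : (Fin d → ℝ) → M → ℝ → (Fin d → ℝ)) (T : ℝ → M → M)
    (ν : ℝ → Measure M) (E : Set (Fin d → ℝ)) (ε : ℝ) (y : M) : ℝ :=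
  sSup {r : ℝ | ∃ x ∈ E, ∃ n : ℕ, 1 ≤ n ∧ ε * n ≤ 1 ∧
    r = ε * ‖∑ j ∈ Finset.range n, jac (fun x' => centred a ν ε x' ((T ε)^[j] y)) x‖}

/-- The order function `δ_ε = δ_{1,ε} + δ_{2,ε}`. -/
noncomputable def orderFunction (a : (Fin d → ℝ) → M → ℝ → (Fin d → ℝ)) (T : ℝ → M → M)
    (ν : ℝ → Measure M) (E : Set (Fin d → ℝ)) (ε : ℝ) (y : M) : ℝ :=
  order₁ a T ν E ε y + order₂ a T ν E ε y

end Averaging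

end FastSlow

/-!
The return map `F = T^τ` to the base `Y` has full branches with log-Hölder inverse Jacobians, so its
transfer operator contracts a cone of log-Lipschitz functions (for the metric `d_M ^ η`) at a rate
that depends only on the constants of the family. This yields an invariant density bounded by such
a constant. Moreover, the sums of a centred Lipschitz observable over the excursions from `Y`, which
are unbounded but dominated by `τ`, are reverse martingale differences up to a bounded coboundary.

A maximal inequality for reverse martingales bounds the `p`-th moment of the maximal sum over `N`
excursions by a multiple of `N ^ max (p / 2) 1`. Passing from the base to `M` introduces the weight
`τ`; since `τ` is in `L^p`, Young's inequality for the product `τ S ^ (p - 1)` leaves a bound on the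
`(p - 1)`-th moment of the maximal Birkhoff sums, uniform over the observables.

For the supremum over the parameter `x`, a Lipschitz function that reaches the value `s` exceeds
`s / 2` on a ball of volume proportional to `s ^ d`. Hence the `(p - 1 + d)`-th power of the
supremum is bounded by the integral over `x` of the `(p - 1)`-th power.
-/

namespace FastSlow

section PowerInequalities

variable {p r : ℝ}

lemma rpow_sub_one_mul_self (hp : p ≠ 0) {t : ℝ} (ht : 0 ≤ t) : t ^ (p - 1) * t = t ^ p := by
  rw [← Real.rpow_add_one' ht (by simpa using hp), sub_add_cancel]

lemma rpow_tangent_le (hp : 1 < p) {a b : ℝ} (ha : 0 ≤ a) (hb : 0 ≤ b) :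
    a ^ p + p * a ^ (p - 1) * (b - a) ≤ b ^ p := by
  rcases ha.eq_or_lt with rfl | ha
  · rw [Real.zero_rpow (by linarith), Real.zero_rpow (by linarith)]
    simpa using Real.rpow_nonneg hb p
  · have bernoulli : 1 + p * (b / a - 1) ≤ (b / a) ^ p := by
      simpa using one_add_mul_self_le_rpow_one_add (s := b / a - 1)
        (by linarith [div_nonneg hb ha.le]) hp.le
    rw [Real.div_rpow hb ha.le, le_div_iff₀ (Real.rpow_pos_of_pos ha p)] at bernoulli
    calc a ^ p + p * a ^ (p - 1) * (b - a) = (1 + p * (b / a - 1)) * a ^ p := by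
          rw [← rpow_sub_one_mul_self (by linarith : p ≠ 0) ha.le]; field_simp
      _ ≤ b ^ p := bernoulli

lemma rpow_sub_one_mul_le {δ a b : ℝ} (hp : 1 < p) (hδ : 0 < δ) (ha : 0 ≤ a) (hb : 0 ≤ b) :
    a ^ (p - 1) * b ≤ δ * a ^ p + δ ^ (1 - p) * b ^ p := by
  have hp0 : p ≠ 0 := by linarith
  rcases le_total b (δ * a) with h | h
  · calc a ^ (p - 1) * b ≤ a ^ (p - 1) * (δ * a) := by gcongr
      _ = δ * a ^ p := by rw [← rpow_sub_one_mul_self hp0 ha]; ring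
      _ ≤ δ * a ^ p + δ ^ (1 - p) * b ^ p := le_add_of_nonneg_right (by positivity)
  · have hab : a ≤ δ⁻¹ * b := by rwa [inv_mul_eq_div, le_div_iff₀' hδ]
    calc a ^ (p - 1) * b ≤ (δ⁻¹ * b) ^ (p - 1) * b := by gcongr
      _ = δ ^ (1 - p) * b ^ p := by
          rw [Real.mul_rpow (inv_nonneg.2 hδ.le) hb, Real.inv_rpow hδ.le, ← Real.rpow_neg hδ.le,
            neg_sub, mul_assoc, rpow_sub_one_mul_self hp0 hb]
      _ ≤ δ * a ^ p + δ ^ (1 - p) * b ^ p := le_add_of_nonneg_left (by positivity)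

lemma abs_add_rpow_le_two_rpow_mul (hp : 0 ≤ p) (a b : ℝ) :
    |a + b| ^ p ≤ 2 ^ p * (|a| ^ p + |b| ^ p) := by
  have hmax : |a + b| ≤ 2 * max |a| |b| := by
    linarith [abs_add_le a b, le_max_left |a| |b|, le_max_right |a| |b|]
  calc |a + b| ^ p ≤ (2 * max |a| |b|) ^ p := by gcongr
    _ = 2 ^ p * max |a| |b| ^ p := Real.mul_rpow zero_le_two (le_max_of_le_left (abs_nonneg a))
    _ ≤ 2 ^ p * (|a| ^ p + |b| ^ p) := by
        gcongr
        rcases max_choice |a| |b| with h | h <;> rw [h]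
        · exact le_add_of_nonneg_right (by positivity)
        · exact le_add_of_nonneg_left (by positivity)

lemma sq_mul_add_rpow_le (hp : 2 < p) {A s x : ℝ} (hA : 1 ≤ A) (hs : 0 ≤ s) (hx : 0 ≤ x) :
    x ^ 2 * (s + x) ^ (p - 2) ≤ 2 ^ (p - 2) * (s ^ p / A ^ 2 + A ^ (p - 2) * x ^ p) := by
  have sq_mul_rpow : ∀ t : ℝ, 0 ≤ t → t ^ 2 * t ^ (p - 2) = t ^ p := fun t ht => by
    rw [← Real.rpow_two, ← Real.rpow_add' ht (by linarith), add_sub_cancel]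
  rcases le_total s (A * x) with h | h
  · calc x ^ 2 * (s + x) ^ (p - 2) ≤ x ^ 2 * (2 * (A * x)) ^ (p - 2) := by gcongr; nlinarith
      _ = 2 ^ (p - 2) * (A ^ (p - 2) * (x ^ 2 * x ^ (p - 2))) := by
          rw [Real.mul_rpow zero_le_two (by positivity), Real.mul_rpow (by linarith) hx]; ring
      _ ≤ _ := by
          rw [sq_mul_rpow x hx]
          gcongr
          exact le_add_of_nonneg_left (by positivity)
  · have hxs : x ≤ s / A := by rwa [le_div_iff₀' (by linarith)]
    calc x ^ 2 * (s + x) ^ (p - 2) ≤ (s / A) ^ 2 * (2 * s) ^ (p - 2) := by gcongr; nlinarith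
      _ = 2 ^ (p - 2) * (s ^ 2 * s ^ (p - 2) / A ^ 2) := by
          rw [Real.mul_rpow zero_le_two hs]; ring
      _ ≤ _ := by
          rw [sq_mul_rpow s hs]
          gcongr
          exact le_add_of_nonneg_right (by positivity)

/-- The odd extension of `t ↦ t ^ r` from `[0, ∞)` to `ℝ`; for `1 < p`, `p * signedPow (p - 1)` is
the derivative of `|·| ^ p`. Its value at `0` is `0 ^ r`, so that `|signedPow r t| = |t| ^ r` even
for `r = 0`. -/
noncomputable def signedPow (r t : ℝ) : ℝ := if 0 ≤ t then t ^ r else -(-t) ^ r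

lemma signedPow_of_nonneg {t : ℝ} (ht : 0 ≤ t) : signedPow r t = t ^ r := if_pos ht

lemma signedPow_of_neg {t : ℝ} (ht : t < 0) : signedPow r t = -(-t) ^ r := if_neg ht.not_ge

lemma signedPow_neg (hr : r ≠ 0) (t : ℝ) : signedPow r (-t) = -signedPow r t := by
  rcases lt_trichotomy t 0 with ht | rfl | ht
  · rw [signedPow_of_neg ht, signedPow_of_nonneg (by linarith), neg_neg]
  · simp [signedPow, Real.zero_rpow hr]
  · rw [signedPow_of_nonneg ht.le, signedPow_of_neg (by linarith), neg_neg]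

lemma measurable_signedPow (r : ℝ) : Measurable (signedPow r) :=
  Measurable.ite measurableSet_Ici (by fun_prop) (by fun_prop)

lemma abs_signedPow (r t : ℝ) : |signedPow r t| = |t| ^ r := by
  rcases le_or_gt 0 t with ht | ht
  · rw [signedPow_of_nonneg ht, abs_of_nonneg ht, abs_of_nonneg (Real.rpow_nonneg ht r)]
  · rw [signedPow_of_neg ht, abs_neg, abs_of_neg ht,
      abs_of_nonneg (Real.rpow_nonneg (by linarith) r)]

lemma abs_rpow_tangent_le (hp : 1 < p) (a b : ℝ) :
    |a| ^ p + p * signedPow (p - 1) a * (b - a) ≤ |b| ^ p := by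
  wlog ha : 0 ≤ a generalizing a b
  · have h := this (-a) (-b) (by linarith)
    rw [signedPow_neg (by linarith), abs_neg, abs_neg] at h
    linarith
  · calc |a| ^ p + p * signedPow (p - 1) a * (b - a)
        ≤ |a| ^ p + p * |a| ^ (p - 1) * (|b| - |a|) := by
          rw [signedPow_of_nonneg ha, abs_of_nonneg ha]
          gcongr
          exact le_abs_self b
      _ ≤ |b| ^ p := rpow_tangent_le hp (abs_nonneg a) (abs_nonneg b)

/-- To prove a symmetric even relation for all pairs of reals it suffices to treat `0 ≤ b ≤ a` and
pairs of opposite signs. -/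
lemma forall_of_signs {P : ℝ → ℝ → Prop} (symm : ∀ a b, P a b → P b a)
    (neg : ∀ a b, P (-a) (-b) → P a b) (same : ∀ a b, 0 ≤ b → b ≤ a → P a b)
    (opposite : ∀ a b, 0 ≤ a → 0 ≤ b → P a (-b)) (a b : ℝ) : P a b := by
  wlog ha : 0 ≤ a generalizing a b
  · exact neg a b (this (-a) (-b) (by linarith))
  rcases le_total 0 b with hb | hb
  · rcases le_total b a with h | h
    · exact same a b hb h
    · exact symm b a (same b a ha h)
  · simpa using opposite a (-b) ha (by linarith)

lemma abs_signedPow_sub_le_of_le_one (hr : 0 < r) (hr1 : r ≤ 1) (a b : ℝ) :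
    |signedPow r a - signedPow r b| ≤ 2 * |a - b| ^ r := by
  refine forall_of_signs (P := fun a b => |signedPow r a - signedPow r b| ≤ 2 * |a - b| ^ r)
    (fun a b h => by rwa [abs_sub_comm, abs_sub_comm b]) (fun a b h => ?_) (fun a b hb hab => ?_)
    (fun a b ha hb => ?_) a b
  · rwa [signedPow_neg hr.ne', signedPow_neg hr.ne', neg_sub_neg, neg_sub_neg, abs_sub_comm,
      abs_sub_comm b] at h
  · have subadd := Real.rpow_add_le_add_rpow (sub_nonneg.2 hab) hb hr.le hr1
    have mono : b ^ r ≤ a ^ r := by gcongr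
    rw [sub_add_cancel] at subadd
    rw [signedPow_of_nonneg (hb.trans hab), signedPow_of_nonneg hb, abs_of_nonneg (by linarith),
      abs_of_nonneg (sub_nonneg.2 hab)]
    linarith [Real.rpow_nonneg (sub_nonneg.2 hab) r]
  · rw [signedPow_neg hr.ne', signedPow_of_nonneg ha, signedPow_of_nonneg hb, sub_neg_eq_add,
      sub_neg_eq_add, abs_of_nonneg (by positivity), abs_of_nonneg (by positivity), two_mul]
    gcongr <;> linarith

lemma abs_signedPow_sub_le_of_one_lt (hr : 1 < r) (a b : ℝ) :
    |signedPow r a - signedPow r b| ≤ r * |a - b| * max |a| |b| ^ (r - 1) := by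
  have hr0 : r ≠ 0 := by linarith
  refine forall_of_signs
    (P := fun a b => |signedPow r a - signedPow r b| ≤ r * |a - b| * max |a| |b| ^ (r - 1))
    (fun a b h => by rwa [abs_sub_comm, abs_sub_comm b, max_comm]) (fun a b h => ?_)
    (fun a b hb hab => ?_) (fun a b ha hb => ?_) a b
  · rwa [signedPow_neg hr0, signedPow_neg hr0, neg_sub_neg, neg_sub_neg, abs_sub_comm,
      abs_sub_comm b, abs_neg, abs_neg] at h
  · have ha := hb.trans hab
    have mono : b ^ r ≤ a ^ r := by gcongr
    rw [signedPow_of_nonneg ha, signedPow_of_nonneg hb, abs_of_nonneg (sub_nonneg.2 mono),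
      abs_of_nonneg (sub_nonneg.2 hab), abs_of_nonneg ha, abs_of_nonneg hb, max_eq_left hab]
    linarith [rpow_tangent_le hr ha hb]
  · have : 0 ≤ max a b := le_max_of_le_left ha
    have le_mul_max : ∀ t, 0 ≤ t → t ≤ max a b → t ^ r ≤ max a b ^ (r - 1) * t := fun t ht htM => by
      rw [← rpow_sub_one_mul_self hr0 ht]
      gcongr
    rw [signedPow_neg hr0, signedPow_of_nonneg ha, signedPow_of_nonneg hb, sub_neg_eq_add,
      sub_neg_eq_add, abs_neg, abs_of_nonneg ha, abs_of_nonneg hb, abs_of_nonneg (by positivity),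
      abs_of_nonneg (by positivity)]
    calc a ^ r + b ^ r ≤ max a b ^ (r - 1) * a + max a b ^ (r - 1) * b :=
          add_le_add (le_mul_max a ha (le_max_left a b)) (le_mul_max b hb (le_max_right a b))
      _ = 1 * (a + b) * max a b ^ (r - 1) := by ring
      _ ≤ r * (a + b) * max a b ^ (r - 1) := by gcongr

lemma abs_add_rpow_le_add_abs_signedPow_sub (hp : 1 < p) (s x : ℝ) :
    |s + x| ^ p ≤ |s| ^ p + p * (signedPow (p - 1) s * x)
      + p * (|signedPow (p - 1) (s + x) - signedPow (p - 1) s| * |x|) := by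
  have tangent := abs_rpow_tangent_le hp (s + x) s
  have h := mul_le_mul_of_nonneg_left
    (le_abs_self ((signedPow (p - 1) (s + x) - signedPow (p - 1) s) * x)) (by linarith : 0 ≤ p)
  rw [abs_mul] at h
  linarith

/-- The exponent governing the growth of `p`-th moments: for a sum of `n` reverse martingale
differences, `E|S_n|^p` is at most of order `n ^ momentExponent p`. -/
noncomputable def momentExponent (p : ℝ) : ℝ := max (p / 2) 1

lemma exists_mul_abs_signedPow_sub_le (hp : 2 < p) : ∃ C : ℝ, 0 < C ∧ ∀ n : ℝ, 1 ≤ n → ∀ s x : ℝ,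
    p * (|signedPow (p - 1) (s + x) - signedPow (p - 1) s| * |x|) ≤
      n⁻¹ * |s| ^ p + C * n ^ (p / 2 - 1) * |x| ^ p := by
  set c : ℝ := p ^ 2 * 2 ^ (p - 2) with hc
  have : 0 < p := by linarith
  have hc1 : 1 ≤ c := by
    nlinarith [Real.one_le_rpow (one_le_two : (1 : ℝ) ≤ 2) (by linarith : 0 ≤ p - 2)]
  refine ⟨c * c ^ (p / 2 - 1), by positivity, fun n hn s x => ?_⟩
  have hn0 : 0 < n := by linarith
  have lipschitz : |signedPow (p - 1) (s + x) - signedPow (p - 1) s| ≤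
      p * |x| * (|s| + |x|) ^ (p - 2) := by
    have h := abs_signedPow_sub_le_of_one_lt (by linarith : 1 < p - 1) (s + x) s
    rw [add_sub_cancel_left, show p - 1 - 1 = p - 2 by ring] at h
    refine h.trans ?_
    gcongr
    · linarith
    · exact max_le (abs_add_le s x) (by linarith [abs_nonneg x])
  -- the threshold `A = √(c n)` makes the coefficient of `|s| ^ p` exactly `n⁻¹`
  have balance := sq_mul_add_rpow_le hp (A := √(c * n)) (Real.one_le_sqrt.2 (by nlinarith))
    (abs_nonneg s) (abs_nonneg x)
  have hA : √(c * n) ^ (p - 2) = c ^ (p / 2 - 1) * n ^ (p / 2 - 1) := by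
    rw [Real.sqrt_eq_rpow, ← Real.rpow_mul (by positivity), Real.mul_rpow (by positivity) hn0.le]
    ring_nf
  rw [Real.sq_sqrt (by positivity), hA] at balance
  calc p * (|signedPow (p - 1) (s + x) - signedPow (p - 1) s| * |x|)
      ≤ p * ((p * |x| * (|s| + |x|) ^ (p - 2)) * |x|) := by gcongr
    _ = p ^ 2 * (|x| ^ 2 * (|s| + |x|) ^ (p - 2)) := by ring
    _ ≤ p ^ 2 * (2 ^ (p - 2) *
          (|s| ^ p / (c * n) + c ^ (p / 2 - 1) * n ^ (p / 2 - 1) * |x| ^ p)) := by gcongr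
    _ = c * (|s| ^ p / (c * n) + c ^ (p / 2 - 1) * n ^ (p / 2 - 1) * |x| ^ p) := by rw [hc]; ring
    _ = n⁻¹ * |s| ^ p + c * c ^ (p / 2 - 1) * n ^ (p / 2 - 1) * |x| ^ p := by field_simp

lemma exists_abs_add_rpow_le (hp : 1 < p) : ∃ C : ℝ, 0 < C ∧ ∀ n : ℝ, 1 ≤ n → ∀ s x : ℝ,
    |s + x| ^ p ≤ (1 + n⁻¹) * |s| ^ p + p * (signedPow (p - 1) s * x)
      + C * n ^ (momentExponent p - 1) * |x| ^ p := by
  rcases le_or_gt p 2 with h2 | h2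
  · refine ⟨2 * p, by linarith, fun n hn s x => ?_⟩
    have hölder := abs_signedPow_sub_le_of_le_one (by linarith) (by linarith : p - 1 ≤ 1) (s + x) s
    rw [add_sub_cancel_left] at hölder
    have remainder :
        p * (|signedPow (p - 1) (s + x) - signedPow (p - 1) s| * |x|) ≤ 2 * p * |x| ^ p := by
      calc _ ≤ p * (2 * |x| ^ (p - 1) * |x|) := by gcongr
        _ = 2 * p * |x| ^ p := by
            rw [← rpow_sub_one_mul_self (by linarith : p ≠ 0) (abs_nonneg x)]; ring
    rw [momentExponent, max_eq_right (by linarith), sub_self, Real.rpow_zero]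
    have : 0 ≤ n⁻¹ * |s| ^ p := by positivity
    linarith [abs_add_rpow_le_add_abs_signedPow_sub hp s x]
  · obtain ⟨C, hC, h⟩ := exists_mul_abs_signedPow_sub_le h2
    refine ⟨C, hC, fun n hn s x => ?_⟩
    rw [momentExponent, max_eq_left (by linarith)]
    linarith [h n hn s x, abs_add_rpow_le_add_abs_signedPow_sub hp s x]

/-- The function `(p - 1) m ^ p - p m ^ (p - 1) |s|` of the current value `s` and the running
maximum `m` is a Bellman function for Doob's maximal inequality. -/
lemma doob_bellman_step (hp : 1 < p) {s x m : ℝ} (hm : 0 ≤ m) :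
    (p - 1) * max |s + x| m ^ p - p * (max |s + x| m ^ (p - 1) * |s + x|) ≤
      (p - 1) * m ^ p - p * (m ^ (p - 1) * |s|) - p * (m ^ (p - 1) * signedPow 0 s * x) := by
  have subgradient : |s| + signedPow 0 s * x ≤ |s + x| := by
    rcases le_or_gt 0 s with h | h
    · rw [signedPow_of_nonneg h, abs_of_nonneg h, Real.rpow_zero, one_mul]
      exact le_abs_self _
    · rw [signedPow_of_neg h, abs_of_neg h, Real.rpow_zero]
      linarith [neg_abs_le (s + x)]
  have update : (p - 1) * max |s + x| m ^ p - p * (max |s + x| m ^ (p - 1) * |s + x|) ≤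
      (p - 1) * m ^ p - p * (m ^ (p - 1) * |s + x|) := by
    rcases le_total |s + x| m with h | h
    · rw [max_eq_right h]
    · have tangent := rpow_tangent_le hp hm (abs_nonneg (s + x))
      have hp0 : p ≠ 0 := by linarith
      rw [max_eq_left h, rpow_sub_one_mul_self hp0 (abs_nonneg _)]
      nlinarith [rpow_sub_one_mul_self hp0 hm]
  have h := mul_le_mul_of_nonneg_left subgradient
    (by positivity : 0 ≤ p * m ^ (p - 1))
  linarith

end PowerInequalities

section ReverseMartingale

variable {Ω : Type*} {F : Ω → Ω} {φ : Ω → ℝ} {p : ℝ}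

/-- The maximum over `k < n` of `|∑_{k ≤ j < n} φ (F^j y)|` (and `0` for `n = 0`). The partial sums
are taken from the right end because it is the reversed sequence `φ ∘ F^(n-1), …, φ ∘ F, φ` that is
a martingale difference sequence; the recursion is the one of a running maximum. -/
noncomputable def tailMax (F : Ω → Ω) (φ : Ω → ℝ) : ℕ → Ω → ℝ
  | 0 => fun _ => 0
  | n + 1 => fun y => max |birkhoffSum F φ (n + 1) y| (tailMax F φ n (F y))

lemma tailMax_nonneg (n : ℕ) (y : Ω) : 0 ≤ tailMax F φ n y := by
  cases n with
  | zero => exact le_rfl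
  | succ n => exact (abs_nonneg _).trans (le_max_left _ _)

lemma abs_birkhoffSum_iterate_le_tailMax (k n : ℕ) (y : Ω) :
    |birkhoffSum F φ n (F^[k] y)| ≤ tailMax F φ (k + n) y := by
  induction k generalizing y with
  | zero =>
    cases n with
    | zero => simp [tailMax]
    | succ n => rw [zero_add]; exact le_max_left _ _
  | succ k ih =>
    rw [Function.iterate_succ_apply, Nat.add_right_comm]
    exact (ih (F y)).trans (le_max_right _ _)

lemma abs_birkhoffSum_le_two_mul_tailMax {k n : ℕ} (hkn : k ≤ n) (y : Ω) :
    |birkhoffSum F φ k y| ≤ 2 * tailMax F φ n y := by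
  obtain ⟨l, rfl⟩ := Nat.exists_eq_add_of_le hkn
  have total : |birkhoffSum F φ (k + l) y| ≤ tailMax F φ (k + l) y := by
    have := abs_birkhoffSum_iterate_le_tailMax (F := F) (φ := φ) 0 (k + l) y
    rwa [zero_add] at this
  calc |birkhoffSum F φ k y| = |birkhoffSum F φ (k + l) y - birkhoffSum F φ l (F^[k] y)| := by
        rw [birkhoffSum_add, add_sub_cancel_right]
    _ ≤ |birkhoffSum F φ (k + l) y| + |birkhoffSum F φ l (F^[k] y)| := abs_sub _ _
    _ ≤ 2 * tailMax F φ (k + l) y := by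
        linarith [abs_birkhoffSum_iterate_le_tailMax (F := F) (φ := φ) k l y]

variable [MeasurableSpace Ω] {μ : Measure Ω}

lemma integrable_abs_add_rpow (hp : 0 ≤ p) {f g : Ω → ℝ} (hf : Measurable f) (hg : Measurable g)
    (hfp : Integrable (fun y => |f y| ^ p) μ) (hgp : Integrable (fun y => |g y| ^ p) μ) :
    Integrable (fun y => |f y + g y| ^ p) μ := by
  refine ((hfp.add hgp).const_mul (2 ^ p)).mono'
    ((hf.add hg).abs.pow_const p).aestronglyMeasurable (ae_of_all _ fun y => ?_)
  rw [Real.norm_of_nonneg (by positivity)]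
  exact abs_add_rpow_le_two_rpow_mul hp _ _

lemma integrable_mul_of_abs_le_rpow_sub_one (hp : 1 < p) {w s x : Ω → ℝ} (hw : Measurable w)
    (hx : Measurable x) (hws : ∀ y, |w y| ≤ |s y| ^ (p - 1))
    (hsp : Integrable (fun y => |s y| ^ p) μ) (hxp : Integrable (fun y => |x y| ^ p) μ) :
    Integrable (fun y => w y * x y) μ := by
  refine (hsp.add hxp).mono' (by fun_prop) (ae_of_all _ fun y => ?_)
  rw [Real.norm_eq_abs, abs_mul]
  calc |w y| * |x y| ≤ |s y| ^ (p - 1) * |x y| := by gcongr; exact hws y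
    _ ≤ |s y| ^ p + |x y| ^ p := by
        simpa using rpow_sub_one_mul_le hp one_pos (abs_nonneg (s y)) (abs_nonneg (x y))

lemma integral_comp_eq_of_measurePreserving (hF : MeasurePreserving F μ μ) {f : Ω → ℝ}
    (hf : AEStronglyMeasurable f μ) : ∫ y, f (F y) ∂μ = ∫ y, f y ∂μ := by
  rw [← integral_map hF.aemeasurable (by rwa [hF.map_eq]), hF.map_eq]

lemma measurable_birkhoffSum (hF : Measurable F) (hφ : Measurable φ) (n : ℕ) :
    Measurable (birkhoffSum F φ n) :=
  Finset.measurable_fun_sum _ fun k _ => hφ.comp (hF.iterate k)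

lemma measurable_tailMax (hF : Measurable F) (hφ : Measurable φ) (n : ℕ) :
    Measurable (tailMax F φ n) := by
  induction n with
  | zero => exact measurable_const
  | succ n ih => exact (measurable_birkhoffSum hF hφ (n + 1)).abs.max (ih.comp hF)

lemma integrable_abs_birkhoffSum_rpow (hp : 0 < p) (hF : MeasurePreserving F μ μ)
    (hφ : Measurable φ) (hφp : Integrable (fun y => |φ y| ^ p) μ) (n : ℕ) :
    Integrable (fun y => |birkhoffSum F φ n y| ^ p) μ := by
  induction n with
  | zero => simp [Real.zero_rpow hp.ne']
  | succ n ih =>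
    simp_rw [birkhoffSum_succ']
    exact integrable_abs_add_rpow hp.le hφ
      ((measurable_birkhoffSum hF.measurable hφ n).comp hF.measurable) hφp
      (hF.integrable_comp_of_integrable ih)

lemma integrable_tailMax_rpow (hp : 0 < p) (hF : MeasurePreserving F μ μ) (hφ : Measurable φ)
    (hφp : Integrable (fun y => |φ y| ^ p) μ) (n : ℕ) :
    Integrable (fun y => tailMax F φ n y ^ p) μ := by
  induction n with
  | zero => simp [tailMax, Real.zero_rpow hp.ne']
  | succ n ih =>
    refine ((integrable_abs_birkhoffSum_rpow hp hF hφ hφp (n + 1)).add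
      (hF.integrable_comp_of_integrable ih)).mono'
      ((measurable_tailMax hF.measurable hφ (n + 1)).pow_const p).aestronglyMeasurable
      (ae_of_all _ fun y => ?_)
    have hS : 0 ≤ |birkhoffSum F φ (n + 1) y| ^ p := by positivity
    have hM : 0 ≤ tailMax F φ n (F y) ^ p := Real.rpow_nonneg (tailMax_nonneg _ _) p
    rw [Real.norm_of_nonneg (Real.rpow_nonneg (tailMax_nonneg _ _) p)]
    simp only [tailMax, Pi.add_apply, Function.comp_apply]
    rcases max_choice |birkhoffSum F φ (n + 1) y| (tailMax F φ n (F y)) with h | h <;> rw [h]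
    · exact le_add_of_nonneg_right hM
    · exact le_add_of_nonneg_left hS

/-- `φ` is a reverse martingale difference for the measure-preserving map `F`: it has zero
conditional expectation given `F`, in the form that it is orthogonal to all functions of `F`. -/
structure IsReverseMartingaleDiff (μ : Measure Ω) (F : Ω → Ω) (φ : Ω → ℝ) : Prop where
  measurePreserving : MeasurePreserving F μ μ
  measurable : Measurable φ
  orthogonal : ∀ w : Ω → ℝ, Measurable w → Integrable (fun y => w (F y) * φ y) μ →
    ∫ y, w (F y) * φ y ∂μ = 0

namespace IsReverseMartingaleDiff

lemma integral_abs_birkhoffSum_succ_rpow_le (h : IsReverseMartingaleDiff μ F φ) (hp : 1 < p)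
    (hφp : Integrable (fun y => |φ y| ^ p) μ) {a b : ℝ}
    (hab : ∀ s x : ℝ, |s + x| ^ p ≤ a * |s| ^ p + p * (signedPow (p - 1) s * x) + b * |x| ^ p)
    (n : ℕ) :
    ∫ y, |birkhoffSum F φ (n + 1) y| ^ p ∂μ ≤
      a * ∫ y, |birkhoffSum F φ n y| ^ p ∂μ + b * ∫ y, |φ y| ^ p ∂μ := by
  have hF := h.measurePreserving
  have hp0 : 0 < p := by linarith
  set s : Ω → ℝ := birkhoffSum F φ n
  have hs : Measurable s := measurable_birkhoffSum hF.measurable h.measurable n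
  have hsp : Integrable (fun y => |s y| ^ p) μ :=
    integrable_abs_birkhoffSum_rpow hp0 hF h.measurable hφp n
  have hsFp : Integrable (fun y => |s (F y)| ^ p) μ := hF.integrable_comp_of_integrable hsp
  have hw : Measurable fun z => signedPow (p - 1) (s z) := (measurable_signedPow _).comp hs
  have hwφ : Integrable (fun y => signedPow (p - 1) (s (F y)) * φ y) μ :=
    integrable_mul_of_abs_le_rpow_sub_one hp (hw.comp hF.measurable) h.measurable
      (fun y => (abs_signedPow _ _).le) hsFp hφp
  have hsum : Integrable
      (fun y => a * |s (F y)| ^ p + p * (signedPow (p - 1) (s (F y)) * φ y)) μ :=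
    (hsFp.const_mul a).add (hwφ.const_mul p)
  have invariant : ∫ y, |s (F y)| ^ p ∂μ = ∫ y, |s y| ^ p ∂μ :=
    integral_comp_eq_of_measurePreserving hF hsp.1
  calc ∫ y, |birkhoffSum F φ (n + 1) y| ^ p ∂μ
      ≤ ∫ y, (a * |s (F y)| ^ p + p * (signedPow (p - 1) (s (F y)) * φ y) + b * |φ y| ^ p) ∂μ := by
        refine integral_mono (integrable_abs_birkhoffSum_rpow hp0 hF h.measurable hφp (n + 1))
          (hsum.add (hφp.const_mul b)) fun y => ?_
        simp only [birkhoffSum_succ', add_comm (φ y)]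
        exact hab _ _
    _ = a * ∫ y, |s y| ^ p ∂μ + b * ∫ y, |φ y| ^ p ∂μ := by
        rw [integral_add hsum (hφp.const_mul b),
          integral_add (hsFp.const_mul a) (hwφ.const_mul p), integral_const_mul,
          integral_const_mul, integral_const_mul, h.orthogonal _ hw hwφ, invariant, mul_zero,
          add_zero]

lemma integral_abs_birkhoffSum_rpow_le (h : IsReverseMartingaleDiff μ F φ) (hp : 1 < p)
    (hφp : Integrable (fun y => |φ y| ^ p) μ) {a b : ℝ} (ha : 1 ≤ a) (hb : 0 ≤ b)
    (hab : ∀ s x : ℝ, |s + x| ^ p ≤ a * |s| ^ p + p * (signedPow (p - 1) s * x) + b * |x| ^ p)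
    (n : ℕ) :
    ∫ y, |birkhoffSum F φ n y| ^ p ∂μ ≤ a ^ n * (n * (b * ∫ y, |φ y| ^ p ∂μ)) := by
  set I := ∫ y, |φ y| ^ p ∂μ
  have hI : 0 ≤ I := integral_nonneg fun y => by positivity
  induction n with
  | zero => simp [Real.zero_rpow (by linarith : p ≠ 0)]
  | succ n ih =>
    calc ∫ y, |birkhoffSum F φ (n + 1) y| ^ p ∂μ
        ≤ a * ∫ y, |birkhoffSum F φ n y| ^ p ∂μ + b * I :=
          h.integral_abs_birkhoffSum_succ_rpow_le hp hφp hab n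
      _ ≤ a * (a ^ n * (n * (b * I))) + a ^ (n + 1) * (b * I) := by
          have := le_mul_of_one_le_left (mul_nonneg hb hI) (one_le_pow₀ ha (n := n + 1))
          gcongr
      _ = a ^ (n + 1) * (↑(n + 1) * (b * I)) := by push_cast; ring

lemma integral_doob_bellman_nonpos (h : IsReverseMartingaleDiff μ F φ) (hp : 1 < p)
    (hφp : Integrable (fun y => |φ y| ^ p) μ)
    (hMS : ∀ n, Integrable (fun y => tailMax F φ n y ^ (p - 1) * |birkhoffSum F φ n y|) μ)
    (n : ℕ) :
    ∫ y, ((p - 1) * tailMax F φ n y ^ p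
      - p * (tailMax F φ n y ^ (p - 1) * |birkhoffSum F φ n y|)) ∂μ ≤ 0 := by
  have hF := h.measurePreserving
  have hp0 : 0 < p := by linarith
  have hM : ∀ n, Measurable (tailMax F φ n) := measurable_tailMax hF.measurable h.measurable
  have hMp := integrable_tailMax_rpow hp0 hF h.measurable hφp
  set W : ℕ → Ω → ℝ := fun n z => (p - 1) * tailMax F φ n z ^ p
    - p * (tailMax F φ n z ^ (p - 1) * |birkhoffSum F φ n z|)
  have hW : ∀ n, Integrable (W n) μ := fun n => ((hMp n).const_mul _).sub ((hMS n).const_mul _)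
  induction n with
  | zero => simp [tailMax, Real.zero_rpow hp0.ne']
  | succ n ih =>
    set w : Ω → ℝ := fun z => tailMax F φ n z ^ (p - 1) * signedPow 0 (birkhoffSum F φ n z)
    have hw : Measurable w := ((hM n).pow_const _).mul
      ((measurable_signedPow 0).comp (measurable_birkhoffSum hF.measurable h.measurable n))
    have hMF : Integrable (fun y => |tailMax F φ n (F y)| ^ p) μ := by
      simp only [abs_of_nonneg (tailMax_nonneg _ _)]
      exact hF.integrable_comp_of_integrable (hMp n)
    have hwφ : Integrable (fun y => w (F y) * φ y) μ := by
      refine integrable_mul_of_abs_le_rpow_sub_one hp (hw.comp hF.measurable) h.measurable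
        (s := fun y => tailMax F φ n (F y)) (fun y => ?_) hMF hφp
      simp only [w, abs_mul, abs_signedPow, Real.rpow_zero, mul_one,
        Real.abs_rpow_of_nonneg (tailMax_nonneg n (F y)), le_refl]
    have hWF : Integrable (fun y => W n (F y)) μ := hF.integrable_comp_of_integrable (hW n)
    calc ∫ y, W (n + 1) y ∂μ ≤ ∫ y, (W n (F y) - p * (w (F y) * φ y)) ∂μ := by
          refine integral_mono (hW (n + 1)) (hWF.sub (hwφ.const_mul p)) fun y => ?_
          simp only [W, tailMax, birkhoffSum_succ', add_comm (φ y)]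
          exact doob_bellman_step hp (tailMax_nonneg n (F y))
      _ = ∫ y, W n y ∂μ := by
          rw [integral_sub hWF (hwφ.const_mul p), integral_const_mul, h.orthogonal w hw hwφ,
            mul_zero, sub_zero, integral_comp_eq_of_measurePreserving hF (hW n).1]
      _ ≤ 0 := ih

theorem integral_tailMax_rpow_le (h : IsReverseMartingaleDiff μ F φ) (hp : 1 < p)
    (hφp : Integrable (fun y => |φ y| ^ p) μ) (n : ℕ) :
    ∫ y, tailMax F φ n y ^ p ∂μ ≤
      (2 * p / (p - 1)) ^ p * ∫ y, |birkhoffSum F φ n y| ^ p ∂μ := by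
  have hF := h.measurePreserving
  have hp0 : 0 < p := by linarith
  have hp1 : 0 < p - 1 := by linarith
  have hMp := integrable_tailMax_rpow hp0 hF h.measurable hφp
  have hSp := integrable_abs_birkhoffSum_rpow hp0 hF h.measurable hφp
  have hMS : ∀ n, Integrable (fun y => tailMax F φ n y ^ (p - 1) * |birkhoffSum F φ n y|) μ :=
    fun n => integrable_mul_of_abs_le_rpow_sub_one hp
      ((measurable_tailMax hF.measurable h.measurable n).pow_const _)
      (measurable_birkhoffSum hF.measurable h.measurable n).abs
      (fun y => (Real.abs_rpow_of_nonneg (tailMax_nonneg n y)).le)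
      (by simpa only [abs_of_nonneg (tailMax_nonneg _ _)] using hMp n)
      (by simpa only [abs_abs] using hSp n)
  set IM := ∫ y, tailMax F φ n y ^ p ∂μ
  set IS := ∫ y, |birkhoffSum F φ n y| ^ p ∂μ
  set δ : ℝ := (p - 1) / (2 * p) with hδ
  have hδ0 : 0 < δ := by positivity
  have doob : (p - 1) * IM ≤ p * ∫ y, tailMax F φ n y ^ (p - 1) * |birkhoffSum F φ n y| ∂μ := by
    have h := h.integral_doob_bellman_nonpos hp hφp hMS n
    rw [integral_sub ((hMp n).const_mul _) ((hMS n).const_mul _), integral_const_mul,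
      integral_const_mul] at h
    linarith
  have young : ∫ y, tailMax F φ n y ^ (p - 1) * |birkhoffSum F φ n y| ∂μ ≤
      δ * IM + δ ^ (1 - p) * IS := by
    rw [← integral_const_mul, ← integral_const_mul,
      ← integral_add ((hMp n).const_mul _) ((hSp n).const_mul _)]
    exact integral_mono (hMS n) (((hMp n).const_mul _).add ((hSp n).const_mul _))
      fun y => rpow_sub_one_mul_le hp hδ0 (tailMax_nonneg _ _) (abs_nonneg _)
  have absorb : (p - 1) / 2 * IM ≤ p * δ ^ (1 - p) * IS := by
    have : p * (δ * IM) = (p - 1) / 2 * IM := by rw [hδ]; field_simp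
    nlinarith
  have hconst : (2 * p / (p - 1)) ^ p = 2 / (p - 1) * (p * δ ^ (1 - p)) := by
    rw [← inv_div, ← hδ, Real.inv_rpow hδ0.le, Real.rpow_sub hδ0, Real.rpow_one]
    simp only [hδ]
    field_simp
  calc IM = 2 / (p - 1) * ((p - 1) / 2 * IM) := by field_simp
    _ ≤ 2 / (p - 1) * (p * δ ^ (1 - p) * IS) := by gcongr
    _ = (2 * p / (p - 1)) ^ p * IS := by rw [hconst]; ring

end IsReverseMartingaleDiff

lemma exists_integral_birkhoffSum_rpow_le (hp : 1 < p) : ∃ C : ℝ, 0 < C ∧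
    ∀ {Ω : Type*} [MeasurableSpace Ω] {μ : Measure Ω} {F : Ω → Ω} {φ : Ω → ℝ},
      IsReverseMartingaleDiff μ F φ → Integrable (fun y => |φ y| ^ p) μ → ∀ N : ℕ, 1 ≤ N →
      ∫ y, |birkhoffSum F φ N y| ^ p ∂μ ≤ C * N ^ momentExponent p * ∫ y, |φ y| ^ p ∂μ := by
  obtain ⟨C, hC, hstep⟩ := exists_abs_add_rpow_le hp
  refine ⟨3 * C, by positivity, fun {Ω} _ {μ F φ} h hφp N hN => ?_⟩
  have hN1 : (1 : ℝ) ≤ N := by exact_mod_cast hN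
  have hexp : (1 + (N : ℝ)⁻¹) ^ N ≤ 3 := by
    calc (1 + (N : ℝ)⁻¹) ^ N ≤ (Real.exp (N : ℝ)⁻¹) ^ N := by
          gcongr
          rw [add_comm]
          exact Real.add_one_le_exp _
      _ = Real.exp 1 := by rw [← Real.exp_nat_mul, mul_inv_cancel₀ (by positivity)]
      _ ≤ 3 := by linarith [Real.exp_one_lt_d9]
  have : 0 ≤ ∫ y, |φ y| ^ p ∂μ := integral_nonneg fun y => by positivity
  calc ∫ y, |birkhoffSum F φ N y| ^ p ∂μ
      ≤ (1 + (N : ℝ)⁻¹) ^ N * (N * (C * N ^ (momentExponent p - 1) * ∫ y, |φ y| ^ p ∂μ)) :=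
        h.integral_abs_birkhoffSum_rpow_le hp hφp (le_add_of_nonneg_right (by positivity))
          (by positivity) (hstep N hN1) N
    _ ≤ 3 * (N * (C * N ^ (momentExponent p - 1) * ∫ y, |φ y| ^ p ∂μ)) := by gcongr
    _ = 3 * C * N ^ momentExponent p * ∫ y, |φ y| ^ p ∂μ := by
        rw [Real.rpow_sub_one (by positivity)]; field_simp

theorem exists_integral_tailMax_rpow_le (hp : 1 < p) : ∃ C : ℝ, 0 < C ∧
    ∀ {Ω : Type*} [MeasurableSpace Ω] {μ : Measure Ω} {F : Ω → Ω} {φ : Ω → ℝ},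
      IsReverseMartingaleDiff μ F φ → Integrable (fun y => |φ y| ^ p) μ → ∀ N : ℕ, 1 ≤ N →
      ∫ y, tailMax F φ N y ^ p ∂μ ≤ C * N ^ momentExponent p * ∫ y, |φ y| ^ p ∂μ := by
  obtain ⟨C, hC, hmoment⟩ := exists_integral_birkhoffSum_rpow_le hp
  have : 0 < p - 1 := by linarith
  refine ⟨(2 * p / (p - 1)) ^ p * C, by positivity, fun {Ω} _ {μ F φ} h hφp N hN => ?_⟩
  rw [mul_assoc, mul_assoc, ← mul_assoc C]
  refine (h.integral_tailMax_rpow_le hp hφp N).trans ?_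
  gcongr
  exact hmoment h hφp N hN

end ReverseMartingale

section FullBranch

variable {M : Type*} {ι : Type*}

/-- The transfer operator `u ↦ ∑ᵢ gᵢ · (u ∘ sᵢ)` of a system with inverse branches `sᵢ` and
weights `gᵢ`. -/
noncomputable def transfer (s : ι → M → M) (g : ι → M → ℝ) (u : M → ℝ) (y : M) : ℝ :=
  ∑' i, g i y * u (s i y)

variable [MeasurableSpace M]

/-- A full-branch map `F` with inverse branches `sᵢ` defined on a set `Z` of full measure, inverse
Jacobians `gᵢ` with bounded distortion, and a bounded gauge `ρ` contracted by the branches. The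
branches are arbitrary off `Z`, where the weights vanish. -/
structure IsFullBranch (μ : Measure M) (F : M → M) (Z : Set M) (s : ι → M → M) (g : ι → M → ℝ)
    (ρ : M → M → ℝ) (θ C₁ R : ℝ) : Prop where
  measurableSet : MeasurableSet Z
  ae_mem : ∀ᵐ y ∂μ, y ∈ Z
  measurable_map : Measurable F
  measurable_branch : ∀ i, Measurable (s i)
  measurable_weight : ∀ i, Measurable (g i)
  branch_mem : ∀ i, ∀ y ∈ Z, s i y ∈ Z
  map_branch : ∀ i, ∀ y ∈ Z, F (s i y) = y
  weight_nonneg : ∀ i y, 0 ≤ g i y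
  weight_eq_zero : ∀ i, ∀ y ∉ Z, g i y = 0
  sum_eq : Measure.sum (fun i => (μ.withDensity fun y => ENNReal.ofReal (g i y)).map (s i)) = μ
  gauge_nonneg : ∀ y y', 0 ≤ ρ y y'
  gauge_symm : ∀ y y', ρ y y' = ρ y' y
  gauge_le : ∀ y y', ρ y y' ≤ R
  gauge_branch : ∀ i, ∀ y ∈ Z, ∀ y' ∈ Z, ρ (s i y) (s i y') ≤ θ * ρ y y'
  weight_le : ∀ i, ∀ y ∈ Z, ∀ y' ∈ Z, g i y ≤ g i y' * Real.exp (C₁ * ρ y y')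
  contraction_nonneg : 0 ≤ θ
  contraction_lt_one : θ < 1
  distortion_pos : 0 < C₁

/-- Nonnegative functions whose logarithm is `b`-Lipschitz on `Z` with respect to `ρ`; they form
the cone on which the transfer operator contracts. -/
structure IsLogLip (Z : Set M) (ρ : M → M → ℝ) (b : ℝ) (u : M → ℝ) : Prop where
  measurable : Measurable u
  nonneg : ∀ y ∈ Z, 0 ≤ u y
  le_mul_exp : ∀ y ∈ Z, ∀ y' ∈ Z, u y ≤ u y' * Real.exp (b * ρ y y')

/-- Measurable functions that are bounded on `Z`. -/
def IsBddMeas (Z : Set M) (u : M → ℝ) : Prop :=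
  Measurable u ∧ ∃ B, ∀ y ∈ Z, |u y| ≤ B

/-- The log-Lipschitz constant of the cone preserved by the transfer operator. -/
noncomputable def coneConst (θ C₁ : ℝ) : ℝ := 2 * C₁ / (1 - θ)

/-- The gap of the contraction of the transfer operator. -/
noncomputable def gapConst (θ C₁ R : ℝ) : ℝ := (1 - θ) / 2 * Real.exp (-(coneConst θ C₁ * R))

lemma mul_exp_sub_le {v c t k : ℝ} (ht : 0 ≤ t) (hk0 : 0 ≤ k) (hk : k < 1) (hv : 0 ≤ v)
    (hc : c ≤ k * v) : v * Real.exp t - c ≤ (v - c) * Real.exp (t / (1 - k)) := by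
  have hk1 : 0 < 1 - k := by linarith
  have hE : 1 ≤ Real.exp (t / (1 - k)) := Real.one_le_exp (by positivity)
  have hconvex : Real.exp t ≤ k + (1 - k) * Real.exp (t / (1 - k)) := by
    simpa [mul_div_cancel₀ t hk1.ne'] using convexOn_exp.2 (mem_univ (0 : ℝ))
      (mem_univ (t / (1 - k))) hk0 hk1.le (by ring)
  nlinarith [mul_le_mul_of_nonneg_left hconvex hv]

variable {μ : Measure M} {F : M → M} {Z : Set M} {s : ι → M → M} {g : ι → M → ℝ}
  {ρ : M → M → ℝ} {θ C₁ R b : ℝ} {u w : M → ℝ}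

lemma IsBddMeas.add (hu : IsBddMeas Z u) (hw : IsBddMeas Z w) : IsBddMeas Z (u + w) := by
  obtain ⟨hum, B, hB⟩ := hu
  obtain ⟨hwm, B', hB'⟩ := hw
  exact ⟨hum.add hwm, B + B', fun y hy => (abs_add_le _ _).trans (add_le_add (hB y hy) (hB' y hy))⟩

lemma IsBddMeas.sub (hu : IsBddMeas Z u) (hw : IsBddMeas Z w) : IsBddMeas Z (u - w) := by
  obtain ⟨hum, B, hB⟩ := hu
  obtain ⟨hwm, B', hB'⟩ := hw
  exact ⟨hum.sub hwm, B + B', fun y hy => (abs_sub _ _).trans (add_le_add (hB y hy) (hB' y hy))⟩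

lemma isBddMeas_const (c : ℝ) : IsBddMeas Z (fun _ => c) :=
  ⟨measurable_const, |c|, fun _ _ => le_rfl⟩

lemma isLogLip_const (hρ : ∀ y y', 0 ≤ ρ y y') {c : ℝ} (hb : 0 ≤ b) (hc : 0 ≤ c) :
    IsLogLip Z ρ b (fun _ => c) :=
  ⟨measurable_const, fun _ _ => hc, fun y _ y' _ =>
    le_mul_of_one_le_right hc (Real.one_le_exp (mul_nonneg hb (hρ y y')))⟩

lemma IsLogLip.mono (hu : IsLogLip Z ρ b u) (hρ : ∀ y y', 0 ≤ ρ y y') {b' : ℝ} (hbb : b ≤ b') :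
    IsLogLip Z ρ b' u := by
  refine ⟨hu.measurable, hu.nonneg, fun y hy y' hy' => (hu.le_mul_exp y hy y' hy').trans ?_⟩
  have := hu.nonneg y' hy'
  have := hρ y y'
  gcongr

lemma isLogLip_of_tendsto {v : ℕ → M → ℝ} (hv : ∀ n, IsLogLip Z ρ b (v n)) (hu : Measurable u)
    (hlim : ∀ y ∈ Z, Tendsto (fun n => v n y) atTop (𝓝 (u y))) : IsLogLip Z ρ b u where
  measurable := hu
  nonneg y hy := ge_of_tendsto' (hlim y hy) fun n => (hv n).nonneg y hy
  le_mul_exp y hy y' hy' := le_of_tendsto_of_tendsto' (hlim y hy) ((hlim y' hy').mul_const _)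
    fun n => (hv n).le_mul_exp y hy y' hy'

namespace IsFullBranch

section Measure

variable (h : IsFullBranch μ F Z s g ρ θ C₁ R)
include h

lemma coneConst_pos : 0 < coneConst θ C₁ :=
  div_pos (mul_pos two_pos h.distortion_pos) (by linarith [h.contraction_lt_one])

lemma add_coneConst_mul : C₁ + coneConst θ C₁ * θ = coneConst θ C₁ * ((1 + θ) / 2) := by
  have : 1 - θ ≠ 0 := by linarith [h.contraction_lt_one]
  unfold coneConst
  field_simp
  ring

lemma add_coneConst_mul_le : C₁ + coneConst θ C₁ * θ ≤ coneConst θ C₁ := by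
  rw [h.add_coneConst_mul]
  exact mul_le_of_le_one_right h.coneConst_pos.le (by linarith [h.contraction_lt_one])

lemma gapConst_pos : 0 < gapConst θ C₁ R :=
  mul_pos (by linarith [h.contraction_lt_one]) (Real.exp_pos _)

lemma isLogLip_weight (i : ι) : IsLogLip Z ρ C₁ (g i) :=
  ⟨h.measurable_weight i, fun y _ => h.weight_nonneg i y, h.weight_le i⟩

lemma isLogLip_weight_mul (hb : 0 ≤ b) (hu : IsLogLip Z ρ b u) (i : ι) :
    IsLogLip Z ρ (C₁ + b * θ) (fun y => g i y * u (s i y)) where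
  measurable := (h.measurable_weight i).mul (hu.measurable.comp (h.measurable_branch i))
  nonneg y hy := mul_nonneg (h.weight_nonneg i y) (hu.nonneg _ (h.branch_mem i y hy))
  le_mul_exp y hy y' hy' := by
    have hus : u (s i y) ≤ u (s i y') * Real.exp (b * θ * ρ y y') := by
      refine (hu.le_mul_exp _ (h.branch_mem i y hy) _ (h.branch_mem i y' hy')).trans ?_
      have := hu.nonneg _ (h.branch_mem i y' hy')
      rw [mul_assoc b]
      gcongr
      exact h.gauge_branch i y hy y' hy'
    calc g i y * u (s i y)
        ≤ (g i y' * Real.exp (C₁ * ρ y y')) * (u (s i y') * Real.exp (b * θ * ρ y y')) :=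
          mul_le_mul (h.weight_le i y hy y' hy') hus (hu.nonneg _ (h.branch_mem i y hy))
            (mul_nonneg (h.weight_nonneg i y') (Real.exp_pos _).le)
      _ = g i y' * u (s i y') * Real.exp ((C₁ + b * θ) * ρ y y') := by
          rw [add_mul, Real.exp_add]; ring

lemma le_exp_mul (hb : 0 ≤ b) (hu : IsLogLip Z ρ b u) {y z : M} (hy : y ∈ Z) (hz : z ∈ Z) :
    u y ≤ Real.exp (b * R) * u z := by
  have := hu.nonneg z hz
  calc u y ≤ u z * Real.exp (b * ρ y z) := hu.le_mul_exp y hy z hz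
    _ ≤ u z * Real.exp (b * R) := by gcongr; exact h.gauge_le y z
    _ = Real.exp (b * R) * u z := mul_comm _ _

lemma lintegral_eq_tsum {f : M → ℝ≥0∞} (hf : Measurable f) :
    ∫⁻ y, f y ∂μ = ∑' i, ∫⁻ y, ENNReal.ofReal (g i y) * f (s i y) ∂μ := by
  conv_lhs => rw [← h.sum_eq, lintegral_sum_measure]
  congr 1 with i
  rw [lintegral_map hf (h.measurable_branch i)]
  exact lintegral_withDensity_eq_lintegral_mul _ (h.measurable_weight i).ennreal_ofReal
    (hf.comp (h.measurable_branch i))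

lemma integral_map_branch {f : M → ℝ} (hfm : Measurable f) (i : ι) :
    ∫ y, f y ∂((μ.withDensity fun y => ENNReal.ofReal (g i y)).map (s i))
      = ∫ y, g i y * f (s i y) ∂μ := by
  rw [integral_map (h.measurable_branch i).aemeasurable hfm.aestronglyMeasurable,
    integral_withDensity_eq_integral_toReal_smul (h.measurable_weight i).ennreal_ofReal
      (ae_of_all _ fun _ => ENNReal.ofReal_lt_top)]
  simp only [ENNReal.toReal_ofReal (h.weight_nonneg i _), smul_eq_mul]

lemma integrable_weight_mul {f : M → ℝ} (hfm : Measurable f) (hf : Integrable f μ) (i : ι) :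
    Integrable (fun y => g i y * f (s i y)) μ := by
  rw [← h.sum_eq] at hf
  have hfi := hf.mono_measure (Measure.le_sum _ i)
  rw [integrable_map_measure hfm.aestronglyMeasurable (h.measurable_branch i).aemeasurable,
    integrable_withDensity_iff_integrable_smul' (h.measurable_weight i).ennreal_ofReal
      (ae_of_all _ fun _ => ENNReal.ofReal_lt_top)] at hfi
  simpa only [ENNReal.toReal_ofReal (h.weight_nonneg i _), smul_eq_mul, Function.comp_apply]
    using hfi

lemma hasSum_integral_weight_mul {f : M → ℝ} (hfm : Measurable f) (hf : Integrable f μ) :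
    HasSum (fun i => ∫ y, g i y * f (s i y) ∂μ) (∫ y, f y ∂μ) := by
  have hsum := hasSum_integral_measure (h.sum_eq.symm ▸ hf)
  rw [h.sum_eq] at hsum
  simpa only [h.integral_map_branch hfm] using hsum

lemma measurable_transfer [Countable ι] (hu : Measurable u) : Measurable (transfer s g u) :=
  Measurable.tsum fun i => (h.measurable_weight i).mul (hu.comp (h.measurable_branch i))

lemma integral_transfer [Countable ι] {f : M → ℝ} (hfm : Measurable f) (hf : Integrable f μ) :
    ∫ y, transfer s g f y ∂μ = ∫ y, f y ∂μ := by
  have hnorm : ∀ i y, ‖g i y * f (s i y)‖ = g i y * ‖f (s i y)‖ := fun i y => by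
    rw [norm_mul, Real.norm_of_nonneg (h.weight_nonneg i y)]
  have hsum := (h.hasSum_integral_weight_mul hfm.norm hf.norm).summable
  simp only [← hnorm] at hsum
  exact (hasSum_integral_of_summable_integral_norm (h.integrable_weight_mul hfm hf) hsum).unique
    (h.hasSum_integral_weight_mul hfm hf)

lemma transfer_comp_mul (w f : M → ℝ) {y : M} (hy : y ∈ Z) :
    transfer s g (fun x => w (F x) * f x) y = w y * transfer s g f y := by
  simp only [transfer, h.map_branch _ y hy, mul_left_comm _ (w y), tsum_mul_left]

end Measure

section Cone

variable [IsProbabilityMeasure μ] (h : IsFullBranch μ F Z s g ρ θ C₁ R)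
include h

lemma nonempty : Z.Nonempty := h.ae_mem.exists

lemma gauge_bound_nonneg : 0 ≤ R := by
  obtain ⟨y, -⟩ := h.nonempty
  exact (h.gauge_nonneg y y).trans (h.gauge_le y y)

lemma gapConst_lt_one : gapConst θ C₁ R < 1 := by
  have hexp : Real.exp (-(coneConst θ C₁ * R)) ≤ 1 :=
    Real.exp_le_one_iff.2 (neg_nonpos.2 (mul_nonneg h.coneConst_pos.le h.gauge_bound_nonneg))
  calc gapConst θ C₁ R ≤ (1 - θ) / 2 :=
        mul_le_of_le_one_right (by linarith [h.contraction_lt_one]) hexp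
    _ < 1 := by linarith [h.contraction_nonneg]

lemma integrable_of_isBddMeas (hu : IsBddMeas Z u) : Integrable u μ := by
  obtain ⟨hum, B, hB⟩ := hu
  exact Integrable.of_bound hum.aestronglyMeasurable B (h.ae_mem.mono hB)

lemma isBddMeas_of_isLogLip (hb : 0 ≤ b) (hu : IsLogLip Z ρ b u) : IsBddMeas Z u := by
  obtain ⟨z, hz⟩ := h.nonempty
  refine ⟨hu.measurable, Real.exp (b * R) * u z, fun y hy => ?_⟩
  rw [abs_of_nonneg (hu.nonneg y hy)]
  exact h.le_exp_mul hb hu hy hz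

lemma integrable_of_isLogLip (hb : 0 ≤ b) (hu : IsLogLip Z ρ b u) : Integrable u μ :=
  h.integrable_of_isBddMeas (h.isBddMeas_of_isLogLip hb hu)

lemma le_exp_mul_integral (hb : 0 ≤ b) (hu : IsLogLip Z ρ b u) {y : M} (hy : y ∈ Z) :
    u y ≤ Real.exp (b * R) * ∫ z, u z ∂μ := by
  have hmono : ∫ _, u y ∂μ ≤ ∫ z, Real.exp (b * R) * u z ∂μ :=
    integral_mono_ae (integrable_const _) ((h.integrable_of_isLogLip hb hu).const_mul _)
      (h.ae_mem.mono fun z hz => h.le_exp_mul hb hu hy hz)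
  simpa only [integral_const, probReal_univ, one_smul, integral_const_mul] using hmono

lemma exp_neg_mul_integral_le (hb : 0 ≤ b) (hu : IsLogLip Z ρ b u) {y : M} (hy : y ∈ Z) :
    Real.exp (-(b * R)) * ∫ z, u z ∂μ ≤ u y := by
  have hmono : ∫ z, u z ∂μ ≤ ∫ _, Real.exp (b * R) * u y ∂μ :=
    integral_mono_ae (h.integrable_of_isLogLip hb hu) (integrable_const _)
      (h.ae_mem.mono fun z hz => h.le_exp_mul hb hu hz hy)
  rw [Real.exp_neg, inv_mul_le_iff₀ (Real.exp_pos _)]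
  simpa only [integral_const, probReal_univ, one_smul] using hmono

lemma weight_le_integral (i : ι) {y : M} (hy : y ∈ Z) :
    g i y ≤ Real.exp (C₁ * R) * ∫ z, g i z ∂μ :=
  h.le_exp_mul_integral h.distortion_pos.le (h.isLogLip_weight i) hy

lemma summable_integral_weight : Summable fun i => ∫ z, g i z ∂μ := by
  simpa only [mul_one] using
    (h.hasSum_integral_weight_mul measurable_const (integrable_const (1 : ℝ))).summable

lemma abs_weight_mul_le {B : ℝ} (hB : ∀ y ∈ Z, |u y| ≤ B) (i : ι) {y : M} (hy : y ∈ Z) :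
    |g i y * u (s i y)| ≤ Real.exp (C₁ * R) * (∫ z, g i z ∂μ) * B := by
  have hg := h.weight_le_integral i hy
  rw [abs_mul, abs_of_nonneg (h.weight_nonneg i y)]
  exact mul_le_mul hg (hB _ (h.branch_mem i y hy)) (abs_nonneg _) ((h.weight_nonneg i y).trans hg)

lemma summable_weight_mul (hu : IsBddMeas Z u) (y : M) : Summable fun i => g i y * u (s i y) := by
  by_cases hy : y ∈ Z
  · obtain ⟨-, B, hB⟩ := hu
    exact Summable.of_norm_bounded
      ((h.summable_integral_weight.mul_left (Real.exp (C₁ * R))).mul_right B)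
      fun i => h.abs_weight_mul_le hB i hy
  · simp only [h.weight_eq_zero _ y hy, zero_mul, summable_zero]

lemma transfer_add (hu : IsBddMeas Z u) (hw : IsBddMeas Z w) :
    transfer s g (u + w) = transfer s g u + transfer s g w := by
  ext y
  simp only [transfer, Pi.add_apply, mul_add]
  exact (h.summable_weight_mul hu y).tsum_add (h.summable_weight_mul hw y)

lemma transfer_sub (hu : IsBddMeas Z u) (hw : IsBddMeas Z w) :
    transfer s g (u - w) = transfer s g u - transfer s g w := by
  ext y
  simp only [transfer, Pi.sub_apply, mul_sub]
  exact (h.summable_weight_mul hu y).tsum_sub (h.summable_weight_mul hw y)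

lemma transfer_tsum {v : ℕ → M → ℝ} {a : ℕ → ℝ} (ha : Summable a)
    (hv : ∀ n, ∀ y ∈ Z, |v n y| ≤ a n) {y : M} (hy : y ∈ Z) :
    transfer s g (fun x => ∑' n, v n x) y = ∑' n, transfer s g (v n) y := by
  have hg : Summable fun i => g i y := by
    simpa only [mul_one] using h.summable_weight_mul (isBddMeas_const (Z := Z) 1) y
  have ha0 : ∀ n, 0 ≤ a n := fun n => (abs_nonneg _).trans (hv n y hy)
  have hprod : Summable fun q : ℕ × ι => g q.2 y * v q.1 (s q.2 y) := by
    refine Summable.of_norm_bounded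
      (ha.mul_of_nonneg hg ha0 fun i => h.weight_nonneg i y) fun q => ?_
    rw [Real.norm_eq_abs, abs_mul, abs_of_nonneg (h.weight_nonneg _ _), mul_comm]
    exact mul_le_mul_of_nonneg_right (hv _ _ (h.branch_mem _ y hy)) (h.weight_nonneg _ _)
  simp only [transfer, ← tsum_mul_left]
  exact Summable.tsum_comm hprod

variable [Countable ι]

lemma isBddMeas_transfer (hu : IsBddMeas Z u) : IsBddMeas Z (transfer s g u) := by
  obtain ⟨hum, B, hB⟩ := hu
  refine ⟨h.measurable_transfer hum, ∑' i, Real.exp (C₁ * R) * (∫ z, g i z ∂μ) * B,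
    fun y hy => ?_⟩
  rw [← Real.norm_eq_abs]
  exact tsum_of_norm_bounded ((h.summable_integral_weight.mul_left _).mul_right B).hasSum
    fun i => h.abs_weight_mul_le hB i hy

lemma isBddMeas_iterate (hu : IsBddMeas Z u) (n : ℕ) : IsBddMeas Z ((transfer s g)^[n] u) := by
  induction n with
  | zero => exact hu
  | succ n ih =>
    rw [Function.iterate_succ_apply']
    exact h.isBddMeas_transfer ih

lemma iterate_transfer_sub (hu : IsBddMeas Z u) (hw : IsBddMeas Z w) (n : ℕ) :
    (transfer s g)^[n] (u - w) = (transfer s g)^[n] u - (transfer s g)^[n] w := by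
  induction n with
  | zero => rfl
  | succ n ih =>
    simp only [Function.iterate_succ_apply', ih]
    exact h.transfer_sub (h.isBddMeas_iterate hu n) (h.isBddMeas_iterate hw n)

lemma integral_iterate_transfer (hu : IsBddMeas Z u) (n : ℕ) :
    ∫ y, (transfer s g)^[n] u y ∂μ = ∫ y, u y ∂μ := by
  induction n with
  | zero => rfl
  | succ n ih =>
    have hn := h.isBddMeas_iterate hu n
    rw [Function.iterate_succ_apply', h.integral_transfer hn.1 (h.integrable_of_isBddMeas hn), ih]

lemma isLogLip_transfer (hb : 0 ≤ b) (hu : IsLogLip Z ρ b u) :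
    IsLogLip Z ρ (C₁ + b * θ) (transfer s g u) := by
  have hbdd := h.isBddMeas_of_isLogLip hb hu
  refine ⟨h.measurable_transfer hu.measurable,
    fun y hy => tsum_nonneg fun i => (h.isLogLip_weight_mul hb hu i).nonneg y hy,
    fun y hy y' hy' => ?_⟩
  rw [transfer, transfer, ← tsum_mul_right]
  exact (h.summable_weight_mul hbdd y).tsum_le_tsum
    (fun i => (h.isLogLip_weight_mul hb hu i).le_mul_exp y hy y' hy')
    ((h.summable_weight_mul hbdd y').mul_right _)

lemma isLogLip_transfer_coneConst (hu : IsLogLip Z ρ (coneConst θ C₁) u) :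
    IsLogLip Z ρ (coneConst θ C₁) (transfer s g u) :=
  (h.isLogLip_transfer h.coneConst_pos.le hu).mono h.gauge_nonneg h.add_coneConst_mul_le

lemma isLogLip_iterate (hu : IsLogLip Z ρ (coneConst θ C₁) u) (n : ℕ) :
    IsLogLip Z ρ (coneConst θ C₁) ((transfer s g)^[n] u) := by
  induction n with
  | zero => exact hu
  | succ n ih =>
    rw [Function.iterate_succ_apply']
    exact h.isLogLip_transfer_coneConst ih

lemma gapConst_mul_integral_le (hu : IsLogLip Z ρ (coneConst θ C₁) u) {y : M} (hy : y ∈ Z) :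
    gapConst θ C₁ R * ∫ z, u z ∂μ ≤ (1 - θ) / 2 * transfer s g u y := by
  have hθ : 0 ≤ 1 - θ := by linarith [h.contraction_lt_one]
  rw [gapConst, mul_assoc, ← h.integral_transfer hu.measurable
    (h.integrable_of_isLogLip h.coneConst_pos.le hu)]
  gcongr
  exact h.exp_neg_mul_integral_le h.coneConst_pos.le (h.isLogLip_transfer_coneConst hu) hy

-- The transfer operator maps the cone into a strictly smaller one: there is room for a constant.
lemma isLogLip_transfer_sub (hu : IsLogLip Z ρ (coneConst θ C₁) u) :
    IsLogLip Z ρ (coneConst θ C₁)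
      (transfer s g u - fun _ => gapConst θ C₁ R * ∫ z, u z ∂μ) := by
  have hL := h.isLogLip_transfer h.coneConst_pos.le hu
  rw [h.add_coneConst_mul] at hL
  have hθ := h.contraction_lt_one
  have hθ0 := h.contraction_nonneg
  have hgap := fun y hy => h.gapConst_mul_integral_le hu (y := y) hy
  set c := gapConst θ C₁ R * ∫ z, u z ∂μ
  refine ⟨hL.measurable.sub measurable_const, fun y hy => ?_, fun y hy y' hy' => ?_⟩
  · refine sub_nonneg.2 ((hgap y hy).trans ?_)
    exact mul_le_of_le_one_left (hL.nonneg y hy) (by linarith)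
  · have ht : 0 ≤ coneConst θ C₁ * ((1 + θ) / 2) * ρ y y' :=
      mul_nonneg (mul_nonneg h.coneConst_pos.le (by linarith)) (h.gauge_nonneg _ _)
    have hexponent : coneConst θ C₁ * ((1 + θ) / 2) * ρ y y' / (1 - (1 - θ) / 2)
        = coneConst θ C₁ * ρ y y' := by
      have : 1 + θ ≠ 0 := by linarith
      rw [show 1 - (1 - θ) / 2 = (1 + θ) / 2 by ring]
      field_simp
    have hconvex := mul_exp_sub_le ht (by linarith) (by linarith) (hL.nonneg y' hy') (hgap y' hy')
    rw [hexponent] at hconvex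
    exact (sub_le_sub_right (hL.le_mul_exp y hy y' hy') c).trans hconvex

lemma integral_transfer_sub (hu : IsBddMeas Z u) :
    ∫ y, (transfer s g u - fun _ => gapConst θ C₁ R * ∫ z, u z ∂μ : M → ℝ) y ∂μ
      = (1 - gapConst θ C₁ R) * ∫ z, u z ∂μ := by
  simp only [Pi.sub_apply]
  rw [integral_sub (h.integrable_of_isBddMeas (h.isBddMeas_transfer hu)) (integrable_const _),
    h.integral_transfer hu.1 (h.integrable_of_isBddMeas hu), integral_const, probReal_univ,
    one_smul, sub_mul, one_mul]

theorem abs_iterate_transfer_sub_le (n : ℕ) (hu : IsLogLip Z ρ (coneConst θ C₁) u)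
    (hw : IsLogLip Z ρ (coneConst θ C₁) w) (huw : ∫ z, u z ∂μ = ∫ z, w z ∂μ) {y : M}
    (hy : y ∈ Z) :
    |(transfer s g)^[n] u y - (transfer s g)^[n] w y| ≤
      Real.exp (coneConst θ C₁ * R) * (1 - gapConst θ C₁ R) ^ n * ∫ z, u z ∂μ := by
  induction n generalizing u w with
  | zero =>
    have hu_le := h.le_exp_mul_integral h.coneConst_pos.le hu hy
    have hw_le := h.le_exp_mul_integral h.coneConst_pos.le hw hy
    rw [← huw] at hw_le
    rw [Function.iterate_zero, pow_zero, mul_one, id_eq, id_eq]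
    exact abs_sub_le_of_nonneg_of_le (hu.nonneg y hy) hu_le (hw.nonneg y hy) hw_le
  | succ n ih =>
    have hub := h.isBddMeas_of_isLogLip h.coneConst_pos.le hu
    have hwb := h.isBddMeas_of_isLogLip h.coneConst_pos.le hw
    have hn := ih (h.isLogLip_transfer_sub hu) (h.isLogLip_transfer_sub hw)
      (by rw [h.integral_transfer_sub hub, h.integral_transfer_sub hwb, huw])
    rw [h.integral_transfer_sub hub,
      h.iterate_transfer_sub (h.isBddMeas_transfer hub) (isBddMeas_const _),
      h.iterate_transfer_sub (h.isBddMeas_transfer hwb) (isBddMeas_const _), huw,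
      Pi.sub_apply, Pi.sub_apply, sub_sub_sub_cancel_right] at hn
    rw [Function.iterate_succ_apply, Function.iterate_succ_apply, huw]
    exact hn.trans_eq (by ring)

-- The solution of `X - L X = U` is the Neumann series.
lemma exists_sub_transfer_eq {U : M → ℝ} (hU : IsBddMeas Z U) {K r : ℝ} (hr0 : 0 ≤ r)
    (hr1 : r < 1) (hK : ∀ n, ∀ y ∈ Z, |(transfer s g)^[n] U y| ≤ K * r ^ n) :
    ∃ X : M → ℝ, Measurable X ∧ (∀ y ∈ Z, |X y| ≤ K / (1 - r)) ∧
      (∀ y ∈ Z, X y - transfer s g X y = U y) ∧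
      ∀ y ∈ Z, HasSum (fun n => (transfer s g)^[n] U y) (X y) := by
  have hgeo : HasSum (fun n => K * r ^ n) (K / (1 - r)) :=
    (hasSum_geometric_of_lt_one hr0 hr1).mul_left K
  have hsum : ∀ y ∈ Z, Summable fun n => (transfer s g)^[n] U y := fun y hy =>
    Summable.of_norm_bounded hgeo.summable fun n => hK n y hy
  refine ⟨fun y => ∑' n, (transfer s g)^[n] U y,
    Measurable.tsum fun n => (h.isBddMeas_iterate hU n).1,
    fun y hy => ?_, fun y hy => ?_, fun y hy => (hsum y hy).hasSum⟩
  · rw [← Real.norm_eq_abs]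
    exact tsum_of_norm_bounded hgeo fun n => hK n y hy
  rw [h.transfer_tsum hgeo.summable hK hy]
  simp only [← Function.iterate_succ_apply' (transfer s g)]
  rw [(hsum y hy).tsum_eq_zero_add, add_sub_cancel_right, Function.iterate_zero, id_eq]

end Cone

end IsFullBranch

end FullBranch

section InvariantDensity

variable {M : Type*} {ι : Type*} [MeasurableSpace M] {μ : Measure M} {F : M → M} {Z : Set M}
  {s : ι → M → M} {g : ι → M → ℝ} {ρ : M → M → ℝ} {θ C₁ R : ℝ} {d : M → ℝ}

/-- A probability density fixed by the transfer operator and lying in the cone that the operator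
preserves. -/
structure IsInvariantDensity (μ : Measure M) (Z : Set M) (s : ι → M → M) (g : ι → M → ℝ)
    (ρ : M → M → ℝ) (θ C₁ : ℝ) (d : M → ℝ) : Prop where
  isLogLip : IsLogLip Z ρ (coneConst θ C₁) d
  integral_eq_one : ∫ y, d y ∂μ = 1
  transfer_eq : ∀ y ∈ Z, transfer s g d y = d y

/-- A full-branch map whose weights sum to one, so that the reference measure is invariant. -/
structure IsNormalizedFullBranch (μ : Measure M) (F : M → M) (Z : Set M) (s : ι → M → M)
    (g : ι → M → ℝ) (ρ : M → M → ℝ) (θ C₁ R : ℝ) : Prop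
    extends IsFullBranch μ F Z s g ρ θ C₁ R where
  sum_weight : ∀ y ∈ Z, ∑' i, g i y = 1

/-- The inverse Jacobians with respect to the measure of density `d`, when `gᵢ` are those with
respect to the reference measure. -/
noncomputable def normalizedWeight (s : ι → M → M) (g : ι → M → ℝ) (d : M → ℝ) (i : ι) (y : M) :
    ℝ :=
  g i y * d (s i y) / d y

lemma isBddMeas_one : IsBddMeas Z (1 : M → ℝ) :=
  isBddMeas_const 1

namespace IsFullBranch

lemma isLogLip_one (h : IsFullBranch μ F Z s g ρ θ C₁ R) : IsLogLip Z ρ (coneConst θ C₁) 1 :=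
  isLogLip_const h.gauge_nonneg h.coneConst_pos.le zero_le_one

lemma measurable_normalizedWeight (h : IsFullBranch μ F Z s g ρ θ C₁ R) (hd : Measurable d)
    (i : ι) : Measurable (normalizedWeight s g d i) :=
  ((h.measurable_weight i).mul (hd.comp (h.measurable_branch i))).div hd

section Existence

variable [IsProbabilityMeasure μ] [Countable ι] (h : IsFullBranch μ F Z s g ρ θ C₁ R)
include h

lemma abs_iterate_transfer_one_sub_le (n : ℕ) {y : M} (hy : y ∈ Z) :
    |(transfer s g)^[n] (transfer s g 1 - 1) y| ≤
      Real.exp (coneConst θ C₁ * R) * (1 - gapConst θ C₁ R) ^ n := by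
  have hone : IsBddMeas Z (1 : M → ℝ) := isBddMeas_one
  have hint := h.integral_transfer hone.1 (h.integrable_of_isBddMeas hone)
  have hn := h.abs_iterate_transfer_sub_le n (h.isLogLip_transfer_coneConst h.isLogLip_one)
    h.isLogLip_one hint hy
  rw [hint] at hn
  rw [h.iterate_transfer_sub (h.isBddMeas_transfer hone) hone, Pi.sub_apply]
  simpa only [Pi.one_apply, integral_const, probReal_univ, smul_eq_mul, mul_one] using hn

lemma sum_iterate_transfer_one_sub (n : ℕ) (y : M) :
    ∑ k ∈ Finset.range n, (transfer s g)^[k] (transfer s g 1 - 1) y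
      = (transfer s g)^[n] 1 y - 1 := by
  have hone : IsBddMeas Z (1 : M → ℝ) := isBddMeas_one
  simp only [h.iterate_transfer_sub (h.isBddMeas_transfer hone) hone,
    ← Function.iterate_succ_apply (transfer s g), Pi.sub_apply]
  exact Finset.sum_range_sub (fun k => (transfer s g)^[k] 1 y) n

lemma exists_tendsto_iterate_transfer_one :
    ∃ d : M → ℝ, Measurable d ∧ (∀ y ∈ Z, transfer s g d y = d y) ∧
      ∀ y ∈ Z, Tendsto (fun n => (transfer s g)^[n] 1 y) atTop (𝓝 (d y)) := by
  have hone : IsBddMeas Z (1 : M → ℝ) := isBddMeas_one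
  obtain ⟨X, hXm, hXb, hX, hXs⟩ := h.exists_sub_transfer_eq ((h.isBddMeas_transfer hone).sub hone)
    (by linarith [h.gapConst_lt_one]) (by linarith [h.gapConst_pos])
    fun n y hy => h.abs_iterate_transfer_one_sub_le n hy
  refine ⟨1 + X, hXm.const_add 1, fun y hy => ?_, fun y hy => ?_⟩
  · have hXy := hX y hy
    rw [h.transfer_add hone ⟨hXm, _, hXb⟩]
    simp only [Pi.sub_apply, Pi.add_apply, Pi.one_apply] at hXy ⊢
    linarith
  · refine ((hXs y hy).tendsto_sum_nat.const_add 1).congr fun n => ?_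
    rw [h.sum_iterate_transfer_one_sub, add_sub_cancel]

theorem exists_isInvariantDensity : ∃ d : M → ℝ, IsInvariantDensity μ Z s g ρ θ C₁ d := by
  obtain ⟨d, hdm, hd, hlim⟩ := h.exists_tendsto_iterate_transfer_one
  have hlog := h.isLogLip_iterate h.isLogLip_one
  have hint : ∀ n, ∫ y, (transfer s g)^[n] 1 y ∂μ = 1 := fun n => by
    rw [h.integral_iterate_transfer isBddMeas_one]
    simp only [Pi.one_apply, integral_const, probReal_univ, smul_eq_mul, mul_one]
  refine ⟨d, isLogLip_of_tendsto hlog hdm hlim, ?_, hd⟩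
  refine tendsto_nhds_unique (f := fun n : ℕ => ∫ y, (transfer s g)^[n] 1 y ∂μ) (l := atTop) ?_
    (tendsto_const_nhds.congr fun n => (hint n).symm)
  refine tendsto_integral_of_dominated_convergence (fun _ => Real.exp (coneConst θ C₁ * R))
    (fun n => (hlog n).measurable.aestronglyMeasurable) (integrable_const _)
    (fun n => h.ae_mem.mono fun y hy => ?_) (h.ae_mem.mono hlim)
  rw [Real.norm_of_nonneg ((hlog n).nonneg y hy)]
  simpa only [hint, mul_one] using h.le_exp_mul_integral h.coneConst_pos.le (hlog n) hy

end Existence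

section Normalization

variable [IsProbabilityMeasure μ] (h : IsFullBranch μ F Z s g ρ θ C₁ R)
  (hd : IsInvariantDensity μ Z s g ρ θ C₁ d)
include h hd

lemma density_pos {y : M} (hy : y ∈ Z) : 0 < d y := by
  have hle := h.exp_neg_mul_integral_le h.coneConst_pos.le hd.isLogLip hy
  rw [hd.integral_eq_one, mul_one] at hle
  exact (Real.exp_pos _).trans_le hle

lemma isProbabilityMeasure_withDensity :
    IsProbabilityMeasure (μ.withDensity fun y => ENNReal.ofReal (d y)) := by
  constructor
  rw [withDensity_apply _ MeasurableSet.univ, Measure.restrict_univ,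
    ← ofReal_integral_eq_lintegral_ofReal
      (h.integrable_of_isLogLip h.coneConst_pos.le hd.isLogLip)
      (h.ae_mem.mono hd.isLogLip.nonneg), hd.integral_eq_one, ENNReal.ofReal_one]

lemma withDensity_le :
    μ.withDensity (fun y => ENNReal.ofReal (d y)) ≤
      ENNReal.ofReal (Real.exp (coneConst θ C₁ * R)) • μ := by
  rw [← withDensity_const]
  refine withDensity_mono (h.ae_mem.mono fun y hy => ENNReal.ofReal_le_ofReal ?_)
  simpa only [hd.integral_eq_one, mul_one] using
    h.le_exp_mul_integral h.coneConst_pos.le hd.isLogLip hy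

lemma ofReal_mul_normalizedWeight (i : ι) {y : M} (hy : y ∈ Z) :
    ENNReal.ofReal (d y) * ENNReal.ofReal (normalizedWeight s g d i y)
      = ENNReal.ofReal (g i y) * ENNReal.ofReal (d (s i y)) := by
  rw [← ENNReal.ofReal_mul (h.density_pos hd hy).le, ← ENNReal.ofReal_mul (h.weight_nonneg i y),
    normalizedWeight, mul_div_cancel₀ _ (h.density_pos hd hy).ne']

lemma sum_map_withDensity_normalizedWeight :
    Measure.sum (fun i => ((μ.withDensity fun y => ENNReal.ofReal (d y)).withDensity
      fun y => ENNReal.ofReal (normalizedWeight s g d i y)).map (s i))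
      = μ.withDensity fun y => ENNReal.ofReal (d y) := by
  have hdm := hd.isLogLip.measurable.ennreal_ofReal
  ext B hB
  have hBm : Measurable (B.indicator (fun y => ENNReal.ofReal (d y))) := hdm.indicator hB
  rw [Measure.sum_apply _ hB, withDensity_apply _ hB, ← lintegral_indicator hB,
    h.lintegral_eq_tsum hBm]
  congr 1 with i
  have hsB := h.measurable_branch i hB
  have hq := (h.measurable_normalizedWeight hd.isLogLip.measurable i).ennreal_ofReal
  rw [Measure.map_apply (h.measurable_branch i) hB, withDensity_apply _ hsB,
    restrict_withDensity hsB, lintegral_withDensity_eq_lintegral_mul _ hdm hq,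
    ← lintegral_indicator hsB]
  refine lintegral_congr_ae (h.ae_mem.mono fun y hy => ?_)
  by_cases hyB : s i y ∈ B
  · simp only [indicator, mem_preimage, hyB, if_true, Pi.mul_apply,
      h.ofReal_mul_normalizedWeight hd i hy]
  · simp only [indicator, mem_preimage, hyB, if_false, mul_zero]

lemma normalizedWeight_nonneg (i : ι) (y : M) : 0 ≤ normalizedWeight s g d i y := by
  by_cases hy : y ∈ Z
  · exact div_nonneg (mul_nonneg (h.weight_nonneg i y)
      (h.density_pos hd (h.branch_mem i y hy)).le) (h.density_pos hd hy).le
  · rw [normalizedWeight, h.weight_eq_zero i y hy, zero_mul, zero_div]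

lemma normalizedWeight_le (i : ι) {y y' : M} (hy : y ∈ Z) (hy' : y' ∈ Z) :
    normalizedWeight s g d i y ≤
      normalizedWeight s g d i y' * Real.exp (2 * coneConst θ C₁ * ρ y y') := by
  have hnum := (h.isLogLip_weight_mul h.coneConst_pos.le hd.isLogLip i).mono h.gauge_nonneg
    h.add_coneConst_mul_le
  have hden := hd.isLogLip.le_mul_exp y' hy' y hy
  rw [h.gauge_symm] at hden
  have hpos := h.density_pos hd hy
  have hpos' := h.density_pos hd hy'
  rw [normalizedWeight, normalizedWeight, div_mul_eq_mul_div, div_le_div_iff₀ hpos hpos',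
    mul_assoc 2, two_mul, Real.exp_add]
  calc g i y * d (s i y) * d y'
      ≤ g i y' * d (s i y') * Real.exp (coneConst θ C₁ * ρ y y')
          * (d y * Real.exp (coneConst θ C₁ * ρ y y')) :=
        mul_le_mul (hnum.le_mul_exp y hy y' hy') hden hpos'.le
          (mul_nonneg (hnum.nonneg y' hy') (Real.exp_pos _).le)
    _ = _ := by ring

theorem isNormalizedFullBranch_withDensity :
    IsNormalizedFullBranch (μ.withDensity fun y => ENNReal.ofReal (d y)) F Z s
      (normalizedWeight s g d) ρ θ (2 * coneConst θ C₁) R where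
  __ := h
  ae_mem := (withDensity_absolutelyContinuous _ _).ae_le h.ae_mem
  measurable_weight := h.measurable_normalizedWeight hd.isLogLip.measurable
  weight_nonneg := h.normalizedWeight_nonneg hd
  weight_eq_zero i y hy := by rw [normalizedWeight, h.weight_eq_zero i y hy, zero_mul, zero_div]
  sum_eq := h.sum_map_withDensity_normalizedWeight hd
  weight_le i y hy y' hy' := h.normalizedWeight_le hd i hy hy'
  distortion_pos := mul_pos two_pos h.coneConst_pos
  sum_weight y hy := by
    simp only [normalizedWeight, tsum_div_const]
    exact (div_eq_one_iff_eq (h.density_pos hd hy).ne').2 (hd.transfer_eq y hy)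

end Normalization

end IsFullBranch

theorem IsFullBranch.exists_isNormalizedFullBranch [IsProbabilityMeasure μ] [Countable ι]
    (h : IsFullBranch μ F Z s g ρ θ C₁ R) :
    ∃ (σ : Measure M) (q : ι → M → ℝ), IsProbabilityMeasure σ ∧
      σ ≤ ENNReal.ofReal (Real.exp (coneConst θ C₁ * R)) • μ ∧
      IsNormalizedFullBranch σ F Z s q ρ θ (2 * coneConst θ C₁) R := by
  obtain ⟨d, hd⟩ := h.exists_isInvariantDensity
  exact ⟨_, _, h.isProbabilityMeasure_withDensity hd, h.withDensity_le hd,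
    h.isNormalizedFullBranch_withDensity hd⟩

end InvariantDensity

section Coboundary

variable {M : Type*} {ι : Type*} [MeasurableSpace M] {μ : Measure M} {F : M → M} {Z : Set M}
  {s : ι → M → M} {g : ι → M → ℝ} {ρ : M → M → ℝ} {θ C₁ R H : ℝ} {U V : M → ℝ} {t : ι → ℝ}

/-- Possibly unbounded observables, bounded by `tᵢ` and `tᵢ`-Lipschitz on the `i`-th branch, where
the constants `tᵢ` are integrable against the weights. -/
structure IsBranchLip (μ : Measure M) (Z : Set M) (s : ι → M → M) (g : ι → M → ℝ)
    (ρ : M → M → ℝ) (t : ι → ℝ) (V : M → ℝ) : Prop where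
  measurable : Measurable V
  abs_le : ∀ i, ∀ y ∈ Z, |V (s i y)| ≤ t i
  abs_sub_le : ∀ i, ∀ y ∈ Z, ∀ y' ∈ Z, |V (s i y) - V (s i y')| ≤ t i * ρ y y'
  summable : Summable fun i => (∫ z, g i z ∂μ) * t i

/-- The factor in the bound for the coboundary part of an observable. -/
noncomputable def coboundaryConst (θ C₁ R : ℝ) : ℝ :=
  Real.exp (coneConst θ C₁ * R) * (1 + (coneConst θ C₁)⁻¹) *
    (Real.exp (C₁ * R) * (1 + C₁ * Real.exp (C₁ * R))) / gapConst θ C₁ R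

namespace IsFullBranch

section BranchLip

variable [IsProbabilityMeasure μ] (h : IsFullBranch μ F Z s g ρ θ C₁ R)
  (hV : IsBranchLip μ Z s g ρ t V)
include h

lemma abs_weight_sub_le (i : ι) {y y' : M} (hy : y ∈ Z) (hy' : y' ∈ Z) :
    |g i y - g i y'| ≤
      Real.exp (C₁ * R) * (∫ z, g i z ∂μ) * (C₁ * Real.exp (C₁ * R) * ρ y y') := by
  wlog hle : g i y' ≤ g i y generalizing y y'
  · rw [abs_sub_comm, h.gauge_symm]
    exact this hy' hy (le_of_not_ge hle)
  have hC := h.distortion_pos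
  have hρ := h.gauge_nonneg y y'
  set x := C₁ * ρ y y'
  have : 0 ≤ x := mul_nonneg hC.le hρ
  have hexp : Real.exp x - 1 ≤ x * Real.exp x := by
    have hmul := mul_le_mul_of_nonneg_left (Real.one_sub_le_exp_neg x) (Real.exp_pos x).le
    rw [← Real.exp_add, add_neg_cancel, Real.exp_zero] at hmul
    linarith
  rw [abs_of_nonneg (sub_nonneg.2 hle)]
  calc g i y - g i y' ≤ g i y' * (Real.exp x - 1) := by linarith [h.weight_le i y hy y' hy']
    _ ≤ g i y' * (x * Real.exp (C₁ * R)) := by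
        have := h.weight_nonneg i y'
        have hxR : x ≤ C₁ * R := mul_le_mul_of_nonneg_left (h.gauge_le y y') hC.le
        gcongr
        exact hexp.trans (by gcongr)
    _ ≤ Real.exp (C₁ * R) * (∫ z, g i z ∂μ) * (x * Real.exp (C₁ * R)) := by
        gcongr
        exact h.weight_le_integral i hy'
    _ = _ := by ring

include hV

lemma abs_weight_mul_branch_le (i : ι) {y : M} (hy : y ∈ Z) :
    |g i y * V (s i y)| ≤ Real.exp (C₁ * R) * ((∫ z, g i z ∂μ) * t i) := by
  have hg := h.weight_le_integral i hy
  rw [abs_mul, abs_of_nonneg (h.weight_nonneg i y), ← mul_assoc]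
  exact mul_le_mul hg (hV.abs_le i y hy) (abs_nonneg _) ((h.weight_nonneg i y).trans hg)

lemma summable_weight_mul_branch {y : M} (hy : y ∈ Z) : Summable fun i => g i y * V (s i y) :=
  Summable.of_norm_bounded (hV.summable.mul_left _) fun i => h.abs_weight_mul_branch_le hV i hy

lemma abs_transfer_branch_le {y : M} (hy : y ∈ Z) :
    |transfer s g V y| ≤ Real.exp (C₁ * R) * ∑' i, (∫ z, g i z ∂μ) * t i := by
  rw [← Real.norm_eq_abs]
  exact tsum_of_norm_bounded (hV.summable.hasSum.mul_left _)
    fun i => h.abs_weight_mul_branch_le hV i hy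

lemma abs_weight_mul_branch_sub_le (i : ι) {y y' : M} (hy : y ∈ Z) (hy' : y' ∈ Z) :
    |g i y * V (s i y) - g i y' * V (s i y')| ≤
      Real.exp (C₁ * R) * (1 + C₁ * Real.exp (C₁ * R)) * ρ y y' * ((∫ z, g i z ∂μ) * t i) := by
  have hg := h.weight_le_integral i hy
  have hdist := h.abs_weight_sub_le i hy hy'
  have hosc : |g i y * (V (s i y) - V (s i y'))| ≤
      Real.exp (C₁ * R) * (∫ z, g i z ∂μ) * (t i * ρ y y') := by
    rw [abs_mul, abs_of_nonneg (h.weight_nonneg i y)]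
    exact mul_le_mul hg (hV.abs_sub_le i y hy y' hy') (abs_nonneg _)
      ((h.weight_nonneg i y).trans hg)
  have hwt : |(g i y - g i y') * V (s i y')| ≤
      Real.exp (C₁ * R) * (∫ z, g i z ∂μ) * (C₁ * Real.exp (C₁ * R) * ρ y y') * t i := by
    rw [abs_mul]
    exact mul_le_mul hdist (hV.abs_le i y' hy') (abs_nonneg _) ((abs_nonneg _).trans hdist)
  calc |g i y * V (s i y) - g i y' * V (s i y')|
      = |g i y * (V (s i y) - V (s i y')) + (g i y - g i y') * V (s i y')| := by ring_nf
    _ ≤ _ := (abs_add_le _ _).trans (add_le_add hosc hwt)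
    _ = _ := by ring

lemma transfer_branch_sub_le {y y' : M} (hy : y ∈ Z) (hy' : y' ∈ Z) :
    transfer s g V y - transfer s g V y' ≤
      Real.exp (C₁ * R) * (1 + C₁ * Real.exp (C₁ * R)) * ρ y y' *
        ∑' i, (∫ z, g i z ∂μ) * t i := by
  rw [transfer, transfer,
    ← (h.summable_weight_mul_branch hV hy).tsum_sub (h.summable_weight_mul_branch hV hy')]
  refine (Real.le_norm_self _).trans ?_
  exact tsum_of_norm_bounded (hV.summable.hasSum.mul_left _)
    fun i => h.abs_weight_mul_branch_sub_le hV i hy hy'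

end BranchLip

section MemoryLoss

variable (h : IsFullBranch μ F Z s g ρ θ C₁ R)
include h

lemma isLogLip_add_const (hU : Measurable U) (hUb : ∀ y ∈ Z, |U y| ≤ H)
    (hUl : ∀ y ∈ Z, ∀ y' ∈ Z, U y - U y' ≤ H * ρ y y') :
    IsLogLip Z ρ (coneConst θ C₁) (U + fun _ => (1 + (coneConst θ C₁)⁻¹) * H) := by
  have hb := h.coneConst_pos
  set b := coneConst θ C₁
  have hlow : ∀ y ∈ Z, b⁻¹ * H ≤ U y + (1 + b⁻¹) * H := fun y hy => by
    linarith [(abs_le.1 (hUb y hy)).1]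
  have hlow0 : ∀ y ∈ Z, 0 ≤ U y + (1 + b⁻¹) * H := fun y hy =>
    (mul_nonneg (inv_nonneg.2 hb.le) ((abs_nonneg _).trans (hUb y hy))).trans (hlow y hy)
  refine ⟨hU.add measurable_const, hlow0, fun y hy y' hy' => ?_⟩
  have hρ := h.gauge_nonneg y y'
  simp only [Pi.add_apply]
  calc U y + (1 + b⁻¹) * H ≤ U y' + (1 + b⁻¹) * H + (b⁻¹ * H) * (b * ρ y y') := by
        rw [show b⁻¹ * H * (b * ρ y y') = H * ρ y y' by field_simp]
        linarith [hUl y hy y' hy']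
    _ ≤ (U y' + (1 + b⁻¹) * H) * (b * ρ y y' + 1) := by
        have := mul_le_mul_of_nonneg_right (hlow y' hy') (mul_nonneg hb.le hρ)
        linarith
    _ ≤ (U y' + (1 + b⁻¹) * H) * Real.exp (b * ρ y y') :=
        mul_le_mul_of_nonneg_left (Real.add_one_le_exp _) (hlow0 y' hy')

lemma abs_iterate_transfer_le [IsProbabilityMeasure μ] [Countable ι] (hU : Measurable U)
    (hUb : ∀ y ∈ Z, |U y| ≤ H) (hUl : ∀ y ∈ Z, ∀ y' ∈ Z, U y - U y' ≤ H * ρ y y')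
    (hU0 : ∫ y, U y ∂μ = 0) (n : ℕ) {y : M} (hy : y ∈ Z) :
    |(transfer s g)^[n] U y| ≤ Real.exp (coneConst θ C₁ * R) * (1 + (coneConst θ C₁)⁻¹) * H
      * (1 - gapConst θ C₁ R) ^ n := by
  have hb := h.coneConst_pos
  have hH : 0 ≤ H := (abs_nonneg _).trans (hUb y hy)
  set c : ℝ := (1 + (coneConst θ C₁)⁻¹) * H with hc
  have hUbd : IsBddMeas Z U := ⟨hU, H, hUb⟩
  have hcb : IsBddMeas Z (fun _ : M => c) := isBddMeas_const c
  have hcl : IsLogLip Z ρ (coneConst θ C₁) (fun _ => c) :=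
    isLogLip_const h.gauge_nonneg hb.le (by positivity)
  have hint : ∫ z, (U + fun _ => c : M → ℝ) z ∂μ = c := by
    simp only [Pi.add_apply]
    rw [integral_add (h.integrable_of_isBddMeas hUbd) (integrable_const _), hU0, integral_const,
      probReal_univ, one_smul, zero_add]
  have hn := h.abs_iterate_transfer_sub_le n (h.isLogLip_add_const hU hUb hUl) hcl
    (by rw [hint, integral_const, probReal_univ, one_smul]) hy
  rw [hint] at hn
  rw [← add_sub_cancel_right U (fun _ => c), h.iterate_transfer_sub (hUbd.add hcb) hcb]
  exact hn.trans_eq (by rw [hc]; ring)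

end MemoryLoss

variable [Countable ι]

lemma isReverseMartingaleDiff (h : IsFullBranch μ F Z s g ρ θ C₁ R)
    (hF : MeasurePreserving F μ μ) {φ : M → ℝ} (hφ : Measurable φ)
    (hφ0 : ∀ y ∈ Z, transfer s g φ y = 0) : IsReverseMartingaleDiff μ F φ where
  measurePreserving := hF
  measurable := hφ
  orthogonal w hw hi := by
    rw [← h.integral_transfer (f := fun y => w (F y) * φ y)
      ((hw.comp h.measurable_map).mul hφ) hi, ← integral_zero M ℝ (μ := μ)]
    refine integral_congr_ae (h.ae_mem.mono fun y hy => ?_)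
    change transfer s g (fun x => w (F x) * φ x) y = 0
    rw [h.transfer_comp_mul w φ hy, hφ0 y hy, mul_zero]

variable [IsProbabilityMeasure μ]

-- The function `X` sums the transfer images of `V`, hence solves `X - L X = L V`.
theorem exists_sub_transfer_eq_transfer (h : IsFullBranch μ F Z s g ρ θ C₁ R)
    (hV : IsBranchLip μ Z s g ρ t V) (hVi : Integrable V μ) (hV0 : ∫ y, V y ∂μ = 0) :
    ∃ X : M → ℝ, Measurable X ∧
      (∀ y ∈ Z, |X y| ≤ coboundaryConst θ C₁ R * ∑' i, (∫ z, g i z ∂μ) * t i) ∧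
      ∀ y ∈ Z, X y - transfer s g X y = transfer s g V y := by
  set Q := ∑' i, (∫ z, g i z ∂μ) * t i
  set E := Real.exp (C₁ * R)
  have hC := h.distortion_pos
  have hE : 0 < E := Real.exp_pos _
  have hUb : ∀ y ∈ Z, |transfer s g V y| ≤ E * (1 + C₁ * E) * Q := fun y hy => by
    have hQ : 0 ≤ E * Q := (abs_nonneg _).trans (h.abs_transfer_branch_le hV hy)
    calc |transfer s g V y| ≤ E * Q := h.abs_transfer_branch_le hV hy
      _ ≤ E * Q * (1 + C₁ * E) := le_mul_of_one_le_right hQ (by linarith [mul_pos hC hE])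
      _ = E * (1 + C₁ * E) * Q := by ring
  have hUl : ∀ y ∈ Z, ∀ y' ∈ Z, transfer s g V y - transfer s g V y' ≤
      E * (1 + C₁ * E) * Q * ρ y y' := fun y hy y' hy' =>
    (h.transfer_branch_sub_le hV hy hy').trans_eq (by ring)
  have hUm := h.measurable_transfer hV.measurable
  have hU0 := (h.integral_transfer hV.measurable hVi).trans hV0
  obtain ⟨X, hXm, hXb, hX, -⟩ := h.exists_sub_transfer_eq ⟨hUm, _, hUb⟩
    (by linarith [h.gapConst_lt_one]) (by linarith [h.gapConst_pos])
    fun n y hy => h.abs_iterate_transfer_le hUm hUb hUl hU0 n hy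
  refine ⟨X, hXm, fun y hy => (hXb y hy).trans_eq ?_, hX⟩
  rw [coboundaryConst, sub_sub_cancel]
  ring

end IsFullBranch

namespace IsNormalizedFullBranch

variable [IsProbabilityMeasure μ] [Countable ι] (h : IsNormalizedFullBranch μ F Z s g ρ θ C₁ R)
include h

theorem measurePreserving : MeasurePreserving F μ μ := by
  refine ⟨h.measurable_map, ?_⟩
  ext B hB
  have hFB : Measurable ((F ⁻¹' B).indicator (1 : M → ℝ≥0∞)) :=
    measurable_one.indicator (h.measurable_map hB)
  have hterm : ∀ i, AEMeasurable
      (fun y => ENNReal.ofReal (g i y) * (F ⁻¹' B).indicator (1 : M → ℝ≥0∞) (s i y)) μ :=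
    fun i => ((h.measurable_weight i).ennreal_ofReal.mul
      (hFB.comp (h.measurable_branch i))).aemeasurable
  rw [Measure.map_apply h.measurable_map hB, ← lintegral_indicator_one (h.measurable_map hB),
    ← lintegral_indicator_one hB, h.lintegral_eq_tsum hFB, ← lintegral_tsum hterm]
  refine lintegral_congr_ae (h.ae_mem.mono fun y hy => ?_)
  have hsum : ∑' i, ENNReal.ofReal (g i y) = 1 := by
    have hsummable := h.summable_weight_mul (isBddMeas_one (Z := Z)) y
    simp only [Pi.one_apply, mul_one] at hsummable
    rw [← ENNReal.ofReal_tsum_of_nonneg (fun i => h.weight_nonneg i y) hsummable,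
      h.sum_weight y hy, ENNReal.ofReal_one]
  have hcomp : ∀ i, (F ⁻¹' B).indicator (1 : M → ℝ≥0∞) (s i y) = B.indicator 1 y := fun i => by
    conv_rhs => rw [← h.map_branch i y hy]
    exact indicator_comp_right (g := (1 : M → ℝ≥0∞)) F
  simp only [hcomp, ENNReal.tsum_mul_right, hsum, one_mul]

theorem exists_coboundary (hV : IsBranchLip μ Z s g ρ t V) (hVi : Integrable V μ)
    (hV0 : ∫ y, V y ∂μ = 0) :
    ∃ χ : M → ℝ, Measurable χ ∧
      (∀ y ∈ Z, |χ y| ≤ coboundaryConst θ C₁ R * ∑' i, (∫ z, g i z ∂μ) * t i) ∧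
      IsReverseMartingaleDiff μ F fun y => V y + χ y - χ (F y) := by
  obtain ⟨χ, hχm, hχb, hχ⟩ := h.exists_sub_transfer_eq_transfer hV hVi hV0
  refine ⟨χ, hχm, hχb, h.isReverseMartingaleDiff h.measurePreserving
    ((hV.measurable.add hχm).sub (hχm.comp h.measurable_map)) fun y hy => ?_⟩
  have hsumV := h.summable_weight_mul_branch hV hy
  have hsumχ := h.summable_weight_mul ⟨hχm, _, hχb⟩ y
  have hsum1 := h.summable_weight_mul (isBddMeas_const (Z := Z) (χ y)) y
  have hterm : transfer s g (fun y => V y + χ y - χ (F y)) y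
      = transfer s g V y + transfer s g χ y - ∑' i, g i y * χ y := by
    simp only [transfer, h.map_branch _ y hy, mul_sub, mul_add]
    rw [(hsumV.add hsumχ).tsum_sub hsum1, hsumV.tsum_add hsumχ]
  rw [hterm, tsum_mul_right, h.sum_weight y hy, ← hχ y hy]
  ring

end IsNormalizedFullBranch

end Coboundary

section Scheme

lemma standardBorelSpace_of_measurableEquiv {X X' : Type*} [MeasurableSpace X]
    [MeasurableSpace X'] [StandardBorelSpace X'] (e : X ≃ᵐ X') : StandardBorelSpace X := by
  let := upgradeStandardBorel X'
  refine ⟨TopologicalSpace.induced e inferInstance, ?_, e.toEquiv.polishSpace_induced⟩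
  refine @BorelSpace.mk X (TopologicalSpace.induced e inferInstance) _ ?_
  refine Eq.trans ?_ borel_comap.symm
  rw [← BorelSpace.measurable_eq (α := X')]
  exact e.measurableEmbedding.comap_eq.symm

lemma standardBorelSpace_of_sigmaCompact (M : Type*) [MetricSpace M] [SigmaCompactSpace M]
    [MeasurableSpace M] [BorelSpace M] : StandardBorelSpace M := by
  borelize (UniformSpace.Completion M)
  let e : M → UniformSpace.Completion M := (↑)
  have he : Topology.IsEmbedding e := UniformSpace.Completion.coe_isometry.isEmbedding
  have hrange : MeasurableSet (range e) := by
    rw [← image_univ, ← iUnion_compactCovering, image_iUnion]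
    exact MeasurableSet.iUnion fun n =>
      ((isCompact_compactCovering M n).image he.continuous).measurableSet
  have := hrange.standardBorel
  exact standardBorelSpace_of_measurableEquiv (he.measurableEmbedding hrange).equivRange

variable {M : Type*} [MeasurableSpace M] {m : Measure M}

section InverseJacobian

variable {F : M → M} {A B N : Set M} {ζ : M → ℝ}

/-- The inverse Jacobian `ζ = dm / d(m ∘ F)` of an injective branch `F : A → M`. -/
structure IsInverseJacobian (m : Measure M) (F : M → M) (A : Set M) (ζ : M → ℝ) : Prop where
  measurable : Measurable ζ
  pos : ∀ x ∈ A, 0 < ζ x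
  measure_image : ∀ B, MeasurableSet B → B ⊆ A →
    m (F '' B) = ∫⁻ x in B, ENNReal.ofReal (ζ x)⁻¹ ∂m

namespace IsInverseJacobian

variable (hζ : IsInverseJacobian m F A ζ)
include hζ

lemma measure_image_eq_zero (hB : MeasurableSet B) (hBA : B ⊆ A) (hB0 : m B = 0) :
    m (F '' B) = 0 := by
  rw [hζ.measure_image B hB hBA]
  exact setLIntegral_measure_zero _ _ hB0

lemma measure_eq_zero_of_image (hB : MeasurableSet B) (hBA : B ⊆ A) (hFB : m (F '' B) = 0) :
    m B = 0 := by
  rw [hζ.measure_image B hB hBA,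
    setLIntegral_eq_zero_iff hB (f := fun x => ENNReal.ofReal (ζ x)⁻¹)
      hζ.measurable.inv.ennreal_ofReal] at hFB
  refine measure_eq_zero_iff_ae_notMem.2 (hFB.mono fun x hx hxB => ?_)
  exact (inv_pos.2 (hζ.pos x (hBA hxB))).not_ge (ENNReal.ofReal_eq_zero.1 (hx hxB))

lemma map_withDensity (hF : Measurable F) (hA : MeasurableSet A) :
    ((m.restrict A).withDensity fun x => ENNReal.ofReal (ζ x)⁻¹).map F = m.restrict (F '' A) := by
  ext B hB
  rw [Measure.map_apply hF hB, withDensity_apply _ (hF hB), Measure.restrict_restrict (hF hB),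
    ← hζ.measure_image _ ((hF hB).inter hA) inter_subset_right, Measure.restrict_apply hB,
    inter_comm B, ← image_inter_preimage, inter_comm]

lemma lintegral_image (hF : Measurable F) (hA : MeasurableSet A) {f : M → ℝ≥0∞}
    (hf : Measurable f) :
    ∫⁻ y in F '' A, f y ∂m = ∫⁻ x in A, ENNReal.ofReal (ζ x)⁻¹ * f (F x) ∂m := by
  rw [← hζ.map_withDensity hF hA, lintegral_map hf hF]
  exact lintegral_withDensity_eq_lintegral_mul _ hζ.measurable.inv.ennreal_ofReal (hf.comp hF)

/-- The density `1_Z · (ζ ∘ s)` is the Jacobian of the inverse branch `s`. -/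
lemma map_withDensity_comp (hF : Measurable F) (hA : MeasurableSet A) (hinj : InjOn F A)
    {Z : Set M} {s : M → M} (hZ : MeasurableSet Z) (hZA : m (F '' A \ Z) = 0) (hs : Measurable s)
    (hsA : ∀ y ∈ Z, s y ∈ A) (hFs : ∀ y ∈ Z, F (s y) = y) :
    ((m.restrict (F '' A)).withDensity fun y => ENNReal.ofReal (Z.indicator (ζ ∘ s) y)).map s
      = m.restrict A := by
  ext B hB
  have hdensity : Measurable fun y => ENNReal.ofReal (Z.indicator (ζ ∘ s) y) :=
    ((hζ.measurable.comp hs).indicator hZ).ennreal_ofReal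
  have hmem : ∀ᵐ x ∂m.restrict A, F x ∈ Z := by
    rw [ae_restrict_iff' hA, ae_iff]
    refine hζ.measure_eq_zero_of_image (B := {x | ¬(x ∈ A → F x ∈ Z)}) ?_ (fun x hx => ?_)
      (measure_mono_null ?_ hZA)
    · simp only [Classical.not_imp]
      exact hA.inter (hF hZ).compl
    · exact (Classical.not_imp.1 hx).1
    · rintro _ ⟨x, hx, rfl⟩
      exact ⟨mem_image_of_mem F (Classical.not_imp.1 hx).1, (Classical.not_imp.1 hx).2⟩
  rw [Measure.map_apply hs hB, withDensity_apply _ (hs hB), ← lintegral_indicator (hs hB),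
    hζ.lintegral_image hF hA (hdensity.indicator (hs hB)), ← lintegral_indicator_one hB]
  refine lintegral_congr_ae ?_
  filter_upwards [hmem, ae_restrict_mem hA] with x hxZ hxA
  have hsx : s (F x) = x := hinj (hsA _ hxZ) hxA (hFs _ hxZ)
  by_cases hxB : x ∈ B
  · rw [indicator_of_mem (by rwa [mem_preimage, hsx]), indicator_of_mem hxZ,
      indicator_of_mem hxB, Function.comp_apply, hsx,
      ← ENNReal.ofReal_mul (inv_pos.2 (hζ.pos x hxA)).le, inv_mul_cancel₀ (hζ.pos x hxA).ne',
      ENNReal.ofReal_one, Pi.one_apply]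
  · rw [indicator_of_notMem (by rwa [mem_preimage, hsx]), indicator_of_notMem hxB, mul_zero]

end IsInverseJacobian

end InverseJacobian

variable {T : M → M} {Y : Set M} {α : Set (Set M)} {τ τ' : M → ℕ} {lam η C₀ C₁ : ℝ}

lemma measurable_inducedMap (hT : Measurable T) (hτ : Measurable τ) :
    Measurable (inducedMap T τ) :=
  (measurable_from_prod_countable_right fun n => hT.iterate n :
    Measurable fun q : ℕ × M => T^[q.1] q.2).comp (hτ.prodMk measurable_id)

/-- The normalised measure `m|_Y / m(Y)` on the base of an inducing scheme. -/
noncomputable def baseMeasure (m : Measure M) (Y : Set M) : Measure M :=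
  (m Y)⁻¹ • m.restrict Y

/-- The decreasing sequence of subsets of `Y` whose intersection is stable under the inverse
branches of `F`: at each step one keeps the points with a preimage in every element of `α`. -/
def branchCore (F : M → M) (Y : Set M) (α : Set (Set M)) : ℕ → Set M
  | 0 => Y
  | n + 1 => branchCore F Y α n ∩ ⋂ A ∈ α, F '' (A ∩ branchCore F Y α n)

/-- Inverse branches `s A` of `F`, one for each `A ∈ α`, on a set `Z` of full measure in `Y`
that they map to itself. -/
structure IsInverseBranches (m : Measure M) (F : M → M) (Y : Set M) (α : Set (Set M)) (Z : Set M)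
    (s : α → M → M) : Prop where
  measurableSet : MeasurableSet Z
  null : m (Y \ Z) = 0
  measurable : ∀ A, Measurable (s A)
  mem : ∀ A, ∀ y ∈ Z, s A y ∈ A.1
  mem_domain : ∀ A, ∀ y ∈ Z, s A y ∈ Z
  map : ∀ A, ∀ y ∈ Z, F (s A y) = y

variable [MetricSpace M]

namespace IsInducingScheme

lemma ae_mem_sUnion (hs : IsInducingScheme m T Y α τ lam η C₀ C₁) :
    ∀ᵐ x ∂(m.restrict Y), x ∈ ⋃₀ α :=
  (ae_restrict_iff' hs.measurableSet_base).2 (ae_le_set.2 hs.cover)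

lemma restrict_sUnion (hs : IsInducingScheme m T Y α τ lam η C₀ C₁) :
    m.restrict (⋃₀ α) = m.restrict Y :=
  Measure.restrict_congr_set <|
    (sUnion_subset hs.elem_subset).eventuallyLE.antisymm (ae_le_set.2 hs.cover)

lemma exists_isInverseJacobian (hs : IsInducingScheme m T Y α τ lam η C₀ C₁) :
    ∃ ζ : M → ℝ, ∀ A ∈ α, IsInverseJacobian m (inducedMap T τ) A ζ ∧
      ∀ x ∈ A, ∀ y ∈ A, |Real.log (ζ x) - Real.log (ζ y)| ≤
        C₁ * dist (inducedMap T τ x) (inducedMap T τ y) ^ η := by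
  obtain ⟨ζ, hζ, hd⟩ := hs.distortion
  exact ⟨ζ, fun A hA => ⟨⟨hζ, (hd A hA).1, (hd A hA).2.1⟩, (hd A hA).2.2⟩⟩

lemma restrict_image (hs : IsInducingScheme m T Y α τ lam η C₀ C₁) {A : Set M} (hA : A ∈ α) :
    m.restrict (inducedMap T τ '' A) = m.restrict Y :=
  Measure.restrict_congr_set <|
    (hs.mapsTo A hA).image_subset.eventuallyLE.antisymm (ae_le_set.2 (hs.onto A hA))

lemma congr (hs : IsInducingScheme m T Y α τ lam η C₀ C₁) (h : ∀ A ∈ α, EqOn τ' τ A) :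
    IsInducingScheme m T Y α τ' lam η C₀ C₁ := by
  have hF : ∀ A ∈ α, EqOn (inducedMap T τ') (inducedMap T τ) A := fun A hA x hx => by
    rw [inducedMap, inducedMap, h A hA hx]
  refine { hs with
    one_le_time := fun A hA x hx => (hs.one_le_time A hA x hx).trans_eq (h A hA hx).symm
    time_const := fun A hA x hx y hy => by
      rw [h A hA hx, h A hA hy, hs.time_const A hA x hx y hy]
    time_integrable := ?_
    mapsTo := fun A hA => (hs.mapsTo A hA).congr (hF A hA).symm
    injOn := fun A hA => (hs.injOn A hA).congr (hF A hA).symm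
    onto := fun A hA => by rw [(hF A hA).image_eq]; exact hs.onto A hA
    expand := fun A hA x hx y hy => by
      rw [hF A hA hx, hF A hA hy]; exact hs.expand A hA x hx y hy
    intermediate := fun A hA x hx y hy l hl => by
      rw [hF A hA hx, hF A hA hy]
      exact hs.intermediate A hA x hx y hy l (hl.trans_eq (h A hA hx))
    distortion := ?_ }
  · refine Integrable.congr hs.time_integrable (hs.ae_mem_sUnion.mono fun x hx => ?_)
    obtain ⟨A, hA, hxA⟩ := hx
    simp only [h A hA hxA]
  · obtain ⟨ζ, hζ, hd⟩ := hs.distortion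
    refine ⟨ζ, hζ, fun A hA => ⟨(hd A hA).1, fun B hB hBA => ?_, fun x hx y hy => ?_⟩⟩
    · rw [((hF A hA).mono hBA).image_eq, (hd A hA).2.1 B hB hBA]
    · rw [hF A hA hx, hF A hA hy]
      exact (hd A hA).2.2 x hx y hy

lemma exists_measurable_time (hs : IsInducingScheme m T Y α τ lam η C₀ C₁) :
    ∃ τ' : M → ℕ, Measurable τ' ∧ (∀ x, 1 ≤ τ' x) ∧ ∀ A ∈ α, EqOn τ' τ A := by
  have : Countable α := hs.countable.to_subtype
  have : Nonempty α := by
    refine (nonempty_iff_ne_empty.2 fun h => hs.base_pos.ne' ?_).to_subtype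
    simpa only [h, sUnion_empty, sdiff_empty] using hs.cover
  have hne : ∀ A : α, (A : Set M).Nonempty := fun A =>
    nonempty_of_measure_ne_zero (hs.elem_pos A A.2).ne'
  choose x hx using hne
  obtain ⟨σ, hσ, hσα⟩ := exists_measurable_piecewise (fun A : α => (A : Set M))
    (fun A => hs.measurableSet_elem A A.2) (fun A _ => τ (x A)) (fun _ => measurable_const)
    fun A B hAB z hz => absurd hz.2 <|
      (hs.disjoint A.2 B.2 (Subtype.coe_injective.ne hAB)).notMem_of_mem_left hz.1
  refine ⟨fun z => max 1 (σ z), measurable_const.max hσ, fun z => le_max_left _ _,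
    fun A hA z hz => ?_⟩
  have hz' : σ z = τ z := (hσα ⟨A, hA⟩ hz).trans (hs.time_const A hA _ (hx ⟨A, hA⟩) z hz)
  simp only [hz', sup_eq_right, hs.one_le_time A hA z hz]

section Branches

variable [StandardBorelSpace M] [BorelSpace M] (hs : IsInducingScheme m T Y α τ lam η C₀ C₁)
  (hT : Measurable T) (hτ : Measurable τ)
include hs hT hτ

lemma measurableSet_image {A B : Set M} (hA : A ∈ α) (hB : MeasurableSet B) (hBA : B ⊆ A) :
    MeasurableSet (inducedMap T τ '' B) :=
  hB.image_of_measurable_injOn (measurable_inducedMap hT hτ) ((hs.injOn A hA).mono hBA)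

lemma measurableSet_branchCore (n : ℕ) :
    MeasurableSet (branchCore (inducedMap T τ) Y α n) := by
  induction n with
  | zero => exact hs.measurableSet_base
  | succ n ih =>
    exact ih.inter (MeasurableSet.biInter hs.countable fun A hA =>
      hs.measurableSet_image hT hτ hA ((hs.measurableSet_elem A hA).inter ih) inter_subset_left)

lemma measure_diff_branchCore (n : ℕ) : m (Y \ branchCore (inducedMap T τ) Y α n) = 0 := by
  obtain ⟨ζ, hζ⟩ := hs.exists_isInverseJacobian
  induction n with
  | zero => simp only [branchCore, sdiff_self, measure_empty]
  | succ n ih =>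
    set W := branchCore (inducedMap T τ) Y α n
    have hW : MeasurableSet W := hs.measurableSet_branchCore hT hτ n
    rw [branchCore, sdiff_inter, measure_union_null_iff]
    refine ⟨ih, ?_⟩
    simp only [sdiff_iInter]
    refine (measure_biUnion_null_iff hs.countable).2 fun A hA => ?_
    have hsub : Y \ inducedMap T τ '' (A ∩ W) ⊆
        (Y \ inducedMap T τ '' A) ∪ inducedMap T τ '' (A \ W) := by
      rintro y ⟨hyY, hy⟩
      refine or_iff_not_imp_left.2 fun h => ?_
      obtain ⟨x, hx, rfl⟩ := not_not.1 (mt (mem_sdiff_of_mem hyY) h)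
      exact ⟨x, ⟨hx, fun hxW => hy ⟨x, ⟨hx, hxW⟩, rfl⟩⟩, rfl⟩
    exact measure_mono_null hsub <| measure_union_null (hs.onto A hA) <|
      (hζ A hA).1.measure_image_eq_zero ((hs.measurableSet_elem A hA).diff hW) sdiff_subset
        (measure_mono_null (sdiff_subset_sdiff_left (hs.elem_subset A hA)) ih)

omit [StandardBorelSpace M] [BorelSpace M] hT hτ in
lemma exists_preimage_mem_iInter_branchCore {A : Set M} (hA : A ∈ α) {y : M}
    (hy : y ∈ ⋂ n, branchCore (inducedMap T τ) Y α n) :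
    ∃ x ∈ A, x ∈ ⋂ n, branchCore (inducedMap T τ) Y α n ∧ inducedMap T τ x = y := by
  have hpre : ∀ n, y ∈ inducedMap T τ '' (A ∩ branchCore (inducedMap T τ) Y α n) := fun n =>
    mem_iInter₂.1 (mem_iInter.1 hy (n + 1)).2 A hA
  choose x hx hxy using hpre
  refine ⟨x 0, (hx 0).1, mem_iInter.2 fun n => ?_, hxy 0⟩
  rw [hs.injOn A hA (hx 0).1 (hx n).1 ((hxy 0).trans (hxy n).symm)]
  exact (hx n).2

lemma measurable_branch {Z A : Set M} {x : M → M} (hA : A ∈ α) (hZ : MeasurableSet Z)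
    (hxA : ∀ y ∈ Z, x y ∈ A) (hFx : ∀ y ∈ Z, inducedMap T τ (x y) = y) [DecidablePred (· ∈ Z)] :
    Measurable (Z.piecewise x id) := by
  intro B hB
  have hpre : x ⁻¹' B ∩ Z = inducedMap T τ '' (A ∩ B) ∩ Z := by
    ext y
    refine and_congr_left fun hy => ⟨fun hxB => ⟨x y, ⟨hxA y hy, hxB⟩, hFx y hy⟩, ?_⟩
    rintro ⟨z, ⟨hzA, hzB⟩, hzy⟩
    rwa [mem_preimage, hs.injOn A hA (hxA y hy) hzA ((hFx y hy).trans hzy.symm)]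
  rw [piecewise_preimage, Set.ite, hpre]
  exact ((hs.measurableSet_image hT hτ hA ((hs.measurableSet_elem A hA).inter hB)
    inter_subset_left).inter hZ).union (hB.diff hZ)

theorem exists_isInverseBranches :
    ∃ (Z : Set M) (s : α → M → M), IsInverseBranches m (inducedMap T τ) Y α Z s := by
  classical
  set Z := ⋂ n, branchCore (inducedMap T τ) Y α n
  have hZ : MeasurableSet Z := MeasurableSet.iInter fun n => hs.measurableSet_branchCore hT hτ n
  have hpre : ∀ A : α, ∀ y ∈ Z, ∃ x ∈ A.1, x ∈ Z ∧ inducedMap T τ x = y := fun A y hy =>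
    hs.exists_preimage_mem_iInter_branchCore A.2 hy
  choose! x hxA hxZ hFx using hpre
  have hxs : ∀ A, ∀ y ∈ Z, Z.piecewise (x A) id y = x A y := fun A y hy =>
    piecewise_eq_of_mem _ _ _ hy
  refine ⟨Z, fun A => Z.piecewise (x A) id, hZ, ?_,
    fun A => hs.measurable_branch hT hτ A.2 hZ (hxA A) (hFx A),
    fun A y hy => by rw [hxs A y hy]; exact hxA A y hy,
    fun A y hy => by rw [hxs A y hy]; exact hxZ A y hy,
    fun A y hy => by rw [hxs A y hy]; exact hFx A y hy⟩
  rw [sdiff_iInter, measure_iUnion_null_iff]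
  exact hs.measure_diff_branchCore hT hτ

end Branches

section FullBranch

variable {Z : Set M} {s : α → M → M} {ζ : M → ℝ}
  (hs : IsInducingScheme m T Y α τ lam η C₀ C₁) (hT : Measurable T) (hτ : Measurable τ)
  (hb : IsInverseBranches m (inducedMap T τ) Y α Z s)
include hs hb

lemma sum_map_withDensity_branch (hT : Measurable T) (hτ : Measurable τ)
    (hζ : ∀ A ∈ α, IsInverseJacobian m (inducedMap T τ) A ζ) :
    Measure.sum (fun A : α => ((baseMeasure m Y).withDensity fun y =>
      ENNReal.ofReal (Z.indicator (ζ ∘ s A) y)).map (s A)) = baseMeasure m Y := by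
  have : Countable α := hs.countable.to_subtype
  have hA : ∀ A : α, ((baseMeasure m Y).withDensity fun y =>
      ENNReal.ofReal (Z.indicator (ζ ∘ s A) y)).map (s A) = (m Y)⁻¹ • m.restrict A.1 := fun A => by
    have hnull : m (inducedMap T τ '' A \ Z) = 0 :=
      measure_mono_null (sdiff_subset_sdiff_left (hs.mapsTo A A.2).image_subset) hb.null
    rw [baseMeasure, withDensity_smul_measure, Measure.map_smul, ← hs.restrict_image A.2,
      (hζ A A.2).map_withDensity_comp (measurable_inducedMap hT hτ) (hs.measurableSet_elem A A.2)
        (hs.injOn A A.2) hb.measurableSet hnull (hb.measurable A) (hb.mem A) (hb.map A)]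
  have hdisj : Pairwise (Function.onFun Disjoint fun A : α => A.1) := fun A B hAB =>
    hs.disjoint A.2 B.2 (Subtype.coe_injective.ne hAB)
  ext B hB
  simp only [hA, Measure.sum_apply _ hB, Measure.smul_apply, smul_eq_mul, ENNReal.tsum_mul_left]
  rw [baseMeasure, ← hs.restrict_sUnion, sUnion_eq_iUnion,
    Measure.restrict_iUnion hdisj fun A => hs.measurableSet_elem A A.2, Measure.smul_apply,
    Measure.sum_apply _ hB, smul_eq_mul]

lemma dist_branch_rpow_le (hlam : 0 < lam) (hη : 0 < η) (A : α) {y y' : M} (hy : y ∈ Z)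
    (hy' : y' ∈ Z) : dist (s A y) (s A y') ^ η ≤ lam ^ (-η) * dist y y' ^ η := by
  have hexp := hs.expand A A.2 _ (hb.mem A y hy) _ (hb.mem A y' hy')
  rw [hb.map A y hy, hb.map A y' hy'] at hexp
  rw [Real.rpow_neg hlam.le, inv_mul_eq_div, le_div_iff₀ (by positivity), mul_comm,
    ← Real.mul_rpow hlam.le dist_nonneg]
  exact Real.rpow_le_rpow (by positivity) hexp hη.le

theorem isFullBranch (hT : Measurable T) (hτ : Measurable τ) (hlam : 1 < lam) (hη : 0 < η)
    (hC₁ : 0 < C₁) {D : ℝ} (hD : ∀ x y : M, dist x y ≤ D)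
    (hζ : ∀ A ∈ α, IsInverseJacobian m (inducedMap T τ) A ζ ∧
      ∀ x ∈ A, ∀ y ∈ A, |Real.log (ζ x) - Real.log (ζ y)| ≤
        C₁ * dist (inducedMap T τ x) (inducedMap T τ y) ^ η) :
    IsFullBranch (baseMeasure m Y) (inducedMap T τ) Z s (fun A => Z.indicator (ζ ∘ s A))
      (fun x y => dist x y ^ η) (lam ^ (-η)) C₁ (D ^ η) where
  measurableSet := hb.measurableSet
  ae_mem := Measure.smul_absolutelyContinuous.ae_le <|
    (ae_restrict_iff' hs.measurableSet_base).2 (ae_le_set.2 hb.null)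
  measurable_map := measurable_inducedMap hT hτ
  measurable_branch := hb.measurable
  measurable_weight A := ((hζ A A.2).1.measurable.comp (hb.measurable A)).indicator hb.measurableSet
  branch_mem := hb.mem_domain
  map_branch := hb.map
  weight_nonneg A := indicator_nonneg fun y hy => ((hζ A A.2).1.pos _ (hb.mem A y hy)).le
  weight_eq_zero A y hy := indicator_of_notMem hy _
  sum_eq := hs.sum_map_withDensity_branch hb hT hτ fun A hA => (hζ A hA).1
  gauge_nonneg y y' := by positivity
  gauge_symm y y' := by simp only [dist_comm]
  gauge_le y y' := Real.rpow_le_rpow dist_nonneg (hD y y') hη.le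
  gauge_branch A y hy y' hy' := hs.dist_branch_rpow_le hb (by linarith) hη A hy hy'
  weight_le A y hy y' hy' := by
    have hlog := (hζ A A.2).2 _ (hb.mem A y hy) _ (hb.mem A y' hy')
    rw [hb.map A y hy, hb.map A y' hy'] at hlog
    rw [indicator_of_mem hy, indicator_of_mem hy', Function.comp_apply, Function.comp_apply,
      ← Real.exp_log ((hζ A A.2).1.pos _ (hb.mem A y hy)),
      ← Real.exp_log ((hζ A A.2).1.pos _ (hb.mem A y' hy')), ← Real.exp_add, Real.exp_le_exp]
    linarith [le_abs_self (Real.log (ζ (s A y)) - Real.log (ζ (s A y')))]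
  contraction_nonneg := by positivity
  contraction_lt_one := Real.rpow_lt_one_of_one_lt_of_neg hlam (by linarith)
  distortion_pos := hC₁

end FullBranch

end IsInducingScheme

end Scheme

section Tower

lemma norm_birkhoffSum_le {M F : Type*} [SeminormedAddCommGroup F] {T : M → M} {v : M → F} {H : ℝ}
    (hH : ∀ y, ‖v y‖ ≤ H) (n : ℕ) (y : M) : ‖birkhoffSum T v n y‖ ≤ H * n := by
  refine (norm_sum_le _ _).trans ?_
  refine (Finset.sum_le_card_nsmul _ _ H fun k _ => hH _).trans_eq ?_
  rw [Finset.card_range, nsmul_eq_mul, mul_comm]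

variable {M : Type*} [MeasurableSpace M] {m σ ν ω : Measure M} {T : M → M} {τ : M → ℕ}

/-- The projection to `M` of the tower measure over `σ` with roof function `τ`. -/
noncomputable def towerMeasure (σ : Measure M) (T : M → M) (τ : M → ℕ) : Measure M :=
  Measure.sum fun l : ℕ => (σ.restrict {y | l < τ y}).map T^[l]

lemma lintegral_towerMeasure (hT : Measurable T) (hτ : Measurable τ) {f : M → ℝ≥0∞}
    (hf : Measurable f) : ∫⁻ y, f y ∂(towerMeasure σ T τ)
      = ∫⁻ y, ∑ l ∈ Finset.range (τ y), f (T^[l] y) ∂σ := by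
  have hlevel : ∀ l : ℕ, MeasurableSet {y | l < τ y} := fun l => hτ (measurableSet_Ioi (a := l))
  have hmap : ∀ l : ℕ, ∫⁻ y, f y ∂((σ.restrict {y | l < τ y}).map T^[l])
      = ∫⁻ y, {y | l < τ y}.indicator (fun y => f (T^[l] y)) y ∂σ := fun l => by
    rw [lintegral_map hf (hT.iterate l), lintegral_indicator (hlevel l)]
  simp only [towerMeasure, lintegral_sum_measure, hmap]
  rw [← lintegral_tsum (f := fun l y => {y | l < τ y}.indicator (fun y => f (T^[l] y)) y) fun l =>
    ((hf.comp (hT.iterate l)).indicator (hlevel l)).aemeasurable]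
  refine lintegral_congr fun y => ?_
  rw [tsum_eq_sum (s := Finset.range (τ y)) fun l hl =>
    indicator_of_notMem (s := {y | l < τ y}) (fun h => hl (Finset.mem_range.2 h)) _]
  exact Finset.sum_congr rfl fun l hl =>
    indicator_of_mem (s := {y | l < τ y}) (Finset.mem_range.1 hl) _

lemma towerMeasure_univ (hT : Measurable T) (hτ : Measurable τ) :
    towerMeasure σ T τ univ = ∫⁻ y, τ y ∂σ := by
  rw [← lintegral_one, lintegral_towerMeasure hT hτ measurable_const]
  simp only [Finset.sum_const, Finset.card_range, nsmul_eq_mul, mul_one]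

lemma measurePreserving_towerMeasure (hT : Measurable T) (hτ : Measurable τ)
    (hF : MeasurePreserving (inducedMap T τ) σ σ) [IsFiniteMeasure σ] :
    MeasurePreserving T (towerMeasure σ T τ) (towerMeasure σ T τ) := by
  refine ⟨hT, ?_⟩
  ext B hB
  set f : M → ℝ≥0∞ := B.indicator 1
  have hf : Measurable f := measurable_one.indicator hB
  have hFf : Measurable fun y => f (inducedMap T τ y) := hf.comp hF.measurable
  -- going up one floor replaces the term at the base by the term at the return to the base
  have hshift : ∀ y, ∑ l ∈ Finset.range (τ y), f (T (T^[l] y)) + f y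
      = ∑ l ∈ Finset.range (τ y), f (T^[l] y) + f (inducedMap T τ y) := fun y => by
    rw [inducedMap, ← Finset.sum_range_succ (fun l => f (T^[l] y)), Finset.sum_range_succ']
    simp only [Function.iterate_succ_apply', Function.iterate_zero, id_eq]
  have hint := lintegral_congr (μ := σ) hshift
  rw [lintegral_add_right _ hf, lintegral_add_right _ hFf, hF.lintegral_comp hf] at hint
  have hf_ne : ∫⁻ y, f y ∂σ ≠ ∞ := by
    rw [lintegral_indicator_one hB]
    exact measure_ne_top _ _
  rw [← lintegral_indicator_one hB, ← lintegral_indicator_one hB, lintegral_map hf hT,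
    lintegral_towerMeasure hT hτ hf,
    lintegral_towerMeasure hT hτ (f := fun y => f (T y)) (hf.comp hT)]
  exact (ENNReal.add_left_inj hf_ne).1 hint

lemma towerMeasure_absolutelyContinuous (hT : Measure.QuasiMeasurePreserving T m m)
    (hσ : σ ≪ m) : towerMeasure σ T τ ≪ m :=
  Measure.absolutelyContinuous_sum_left fun l =>
    ((Measure.restrict_le_self.absolutelyContinuous.trans hσ).map (hT.iterate l).measurable).trans
      (hT.iterate l).absolutelyContinuous

lemma eq_measure_univ_smul_of_quasiErgodic (hT : QuasiErgodic T m) [IsProbabilityMeasure ν]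
    [IsFiniteMeasure ω] (hν : MeasurePreserving T ν ν) (hνm : ν ≪ m)
    (hω : MeasurePreserving T ω ω) (hωm : ω ≪ m) : ω = ω univ • ν := by
  have hsum : MeasurePreserving T (ν + ω) (ν + ω) :=
    ⟨hT.measurable, by rw [Measure.map_add _ _ hT.measurable, hν.map_eq, hω.map_eq]⟩
  have herg : Ergodic T (ν + ω) :=
    ⟨hsum, ⟨fun s hs hs' => (hT.aeconst_set hs hs').anti
      (Measure.AbsolutelyContinuous.add_left hνm hωm).ae_le⟩⟩
  obtain ⟨c, hc⟩ := herg.eq_smul_of_absolutelyContinuous hν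
    (Measure.AbsolutelyContinuous.rfl.add_right ω)
  obtain ⟨c', hc'⟩ := herg.eq_smul_of_absolutelyContinuous hω
    (add_comm ν ω ▸ Measure.AbsolutelyContinuous.rfl.add_right ν)
  set ξ := ν + ω
  have hcξ : c * ξ univ = 1 := by
    rw [← smul_eq_mul, ← Measure.smul_apply, ← hc, measure_univ]
  calc ω = c' • ξ := hc'
    _ = (c' * (c * ξ univ)) • ξ := by rw [hcξ, mul_one]
    _ = (c' * ξ univ) • c • ξ := by rw [smul_smul, mul_comm c, mul_assoc]
    _ = ω univ • ν := by rw [← hc, ← smul_eq_mul c', ← Measure.smul_apply, ← hc']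

theorem towerMeasure_eq_smul (hT : QuasiErgodic T m) (hτ : Measurable τ)
    [IsProbabilityMeasure ν] [IsFiniteMeasure σ] (hν : MeasurePreserving T ν ν) (hνm : ν ≪ m)
    (hσm : σ ≪ m) (hF : MeasurePreserving (inducedMap T τ) σ σ) (hfin : ∫⁻ y, τ y ∂σ ≠ ∞) :
    towerMeasure σ T τ = (∫⁻ y, τ y ∂σ) • ν := by
  have huniv := towerMeasure_univ (σ := σ) hT.measurable hτ
  have : IsFiniteMeasure (towerMeasure σ T τ) := ⟨by rw [huniv]; exact hfin.lt_top⟩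
  rw [← huniv]
  exact eq_measure_univ_smul_of_quasiErgodic hT hν hνm
    (measurePreserving_towerMeasure hT.measurable hτ hF)
    (towerMeasure_absolutelyContinuous hT.toQuasiMeasurePreserving hσm)

lemma lintegral_le_lintegral_sum (hT : Measurable T) (hτ : Measurable τ) (hτ1 : ∀ y, 1 ≤ τ y)
    [IsProbabilityMeasure σ] (h : towerMeasure σ T τ = (∫⁻ y, τ y ∂σ) • ν) {f : M → ℝ≥0∞}
    (hf : Measurable f) :
    ∫⁻ y, f y ∂ν ≤ ∫⁻ y, ∑ l ∈ Finset.range (τ y), f (T^[l] y) ∂σ := by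
  rw [← lintegral_towerMeasure hT hτ hf, h, lintegral_smul_measure, smul_eq_mul]
  refine le_mul_of_one_le_left' ?_
  calc (1 : ℝ≥0∞) = ∫⁻ _, 1 ∂σ := by rw [lintegral_one, measure_univ]
    _ ≤ _ := lintegral_mono fun y => Nat.one_le_cast.2 (hτ1 y)

lemma measurable_inducedSum (hT : Measurable T) (hτ : Measurable τ) {v : M → ℝ}
    (hv : Measurable v) : Measurable fun y => birkhoffSum T v (τ y) y :=
  (measurable_from_prod_countable_right fun n => measurable_birkhoffSum hT hv n :
    Measurable fun q : ℕ × M => birkhoffSum T v q.1 q.2).comp (hτ.prodMk measurable_id)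

lemma integrable_natCast (hτ : Measurable τ) (hfin : ∫⁻ y, τ y ∂σ ≠ ∞) :
    Integrable (fun y => (τ y : ℝ)) σ := by
  refine ⟨(measurable_from_nat.comp hτ).aestronglyMeasurable, ?_⟩
  simpa only [HasFiniteIntegral, Real.enorm_natCast] using hfin.lt_top

lemma integrable_inducedSum (hT : Measurable T) (hτ : Measurable τ) (hfin : ∫⁻ y, τ y ∂σ ≠ ∞)
    {v : M → ℝ} (hv : Measurable v) {H : ℝ} (hH : ∀ y, |v y| ≤ H) :
    Integrable (fun y => birkhoffSum T v (τ y) y) σ :=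
  ((integrable_natCast hτ hfin).const_mul H).mono'
    (measurable_inducedSum hT hτ hv).aestronglyMeasurable
    (ae_of_all _ fun y => norm_birkhoffSum_le hH _ y)

lemma integral_towerMeasure_of_nonneg (hT : Measurable T) (hτ : Measurable τ) {v : M → ℝ}
    (hv : Measurable v) (hv0 : ∀ y, 0 ≤ v y) :
    ∫ y, v y ∂(towerMeasure σ T τ) = ∫ y, birkhoffSum T v (τ y) y ∂σ := by
  rw [integral_eq_lintegral_of_nonneg_ae (ae_of_all _ hv0) hv.aestronglyMeasurable,
    integral_eq_lintegral_of_nonneg_ae (f := fun y => birkhoffSum T v (τ y) y)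
      (ae_of_all _ fun y => Finset.sum_nonneg fun l _ => hv0 (T^[l] y))
      (measurable_inducedSum hT hτ hv).aestronglyMeasurable,
    lintegral_towerMeasure hT hτ hv.ennreal_ofReal]
  simp only [birkhoffSum, ENNReal.ofReal_sum_of_nonneg fun l _ => hv0 (T^[l] _)]

lemma integral_towerMeasure (hT : Measurable T) (hτ : Measurable τ) (hfin : ∫⁻ y, τ y ∂σ ≠ ∞)
    {v : M → ℝ} (hv : Measurable v) {H : ℝ} (hH : ∀ y, |v y| ≤ H) :
    ∫ y, v y ∂(towerMeasure σ T τ) = ∫ y, birkhoffSum T v (τ y) y ∂σ := by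
  have : IsFiniteMeasure (towerMeasure σ T τ) :=
    ⟨by rw [towerMeasure_univ hT hτ]; exact hfin.lt_top⟩
  have hvi : Integrable v (towerMeasure σ T τ) :=
    .of_bound hv.aestronglyMeasurable H (ae_of_all _ hH)
  have hshift := integral_towerMeasure_of_nonneg (σ := σ) hT hτ (hv.add_const |H|) fun y => by
    linarith [(abs_le.1 (hH y)).1, le_abs_self H]
  have hconst := integral_towerMeasure_of_nonneg (σ := σ) hT hτ (measurable_const (a := |H|))
    fun _ => abs_nonneg H
  have hsplit : ∀ y, birkhoffSum T (fun z => v z + |H|) (τ y) y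
      = birkhoffSum T v (τ y) y + birkhoffSum T (fun _ => |H|) (τ y) y := fun y =>
    Finset.sum_add_distrib
  rw [integral_add hvi (integrable_const _), integral_congr_ae (ae_of_all _ hsplit),
    integral_add (integrable_inducedSum hT hτ hfin hv hH)
      (integrable_inducedSum hT hτ hfin measurable_const fun _ => (abs_abs H).le), hconst] at hshift
  exact add_right_cancel hshift

lemma integral_inducedSum_eq_zero (hT : Measurable T) (hτ : Measurable τ)
    (h : towerMeasure σ T τ = (∫⁻ y, τ y ∂σ) • ν) (hfin : ∫⁻ y, τ y ∂σ ≠ ∞) {v : M → ℝ}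
    (hv : Measurable v) {H : ℝ} (hH : ∀ y, |v y| ≤ H) (hv0 : ∫ y, v y ∂ν = 0) :
    ∫ y, birkhoffSum T v (τ y) y ∂σ = 0 := by
  rw [← integral_towerMeasure hT hτ hfin hv hH, h, integral_smul_measure, hv0, smul_zero]

end Tower

section Path

variable {M : Type*} {T : M → M} {τ : M → ℕ}

lemma iterate_inducedMap (j : ℕ) (y : M) :
    (inducedMap T τ)^[j] y = T^[birkhoffSum (inducedMap T τ) τ j y] y := by
  induction j generalizing y with
  | zero => rw [birkhoffSum_zero, Function.iterate_zero, Function.iterate_zero]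
  | succ j ih =>
    rw [Function.iterate_succ_apply, ih, birkhoffSum_succ', add_comm, Function.iterate_add_apply,
      inducedMap]

lemma birkhoffSum_inducedSum (v : M → ℝ) (j : ℕ) (y : M) :
    birkhoffSum (inducedMap T τ) (fun z => birkhoffSum T v (τ z) z) j y
      = birkhoffSum T v (birkhoffSum (inducedMap T τ) τ j y) y := by
  induction j generalizing y with
  | zero => simp only [birkhoffSum_zero]
  | succ j ih => rw [birkhoffSum_succ', ih, birkhoffSum_succ', birkhoffSum_add, inducedMap]

lemma exists_eq_birkhoffSum_add (hτ : ∀ y, 1 ≤ τ y) (k : ℕ) (y : M) :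
    ∃ j r, r < τ ((inducedMap T τ)^[j] y) ∧ k = birkhoffSum (inducedMap T τ) τ j y + r := by
  induction k using Nat.strong_induction_on generalizing y with
  | _ k ih =>
    rcases lt_or_ge k (τ y) with h | h
    · exact ⟨0, k, h, by rw [birkhoffSum_zero, zero_add]⟩
    · obtain ⟨j, r, hr, hk⟩ := ih (k - τ y) (by have := hτ y; omega) (inducedMap T τ y)
      refine ⟨j + 1, r, by rwa [Function.iterate_succ_apply], ?_⟩
      rw [birkhoffSum_succ']
      omega

lemma add_le_birkhoffSum_succ (hτ : ∀ y, 1 ≤ τ y) (F : M → M) (j : ℕ) (y : M) :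
    τ y + j ≤ birkhoffSum F τ (j + 1) y := by
  rw [birkhoffSum_succ']
  gcongr
  calc j = ∑ _k ∈ Finset.range j, 1 := by
        rw [Finset.sum_const, Finset.card_range, smul_eq_mul, mul_one]
    _ ≤ _ := Finset.sum_le_sum fun k _ => hτ _

/-- Compare the Birkhoff sum at the floor `l` of the tower with the sum between the two neighbouring
visits to the base. -/
lemma abs_birkhoffSum_iterate_le (hτ : ∀ y, 1 ≤ τ y) {v : M → ℝ} {H : ℝ} (hH : ∀ y, |v y| ≤ H)
    {N n l : ℕ} (hn : n ≤ N) {y : M} (hl : l < τ y) {A B : ℝ}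
    (hA : ∀ j ≤ N, |birkhoffSum (inducedMap T τ) (fun z => birkhoffSum T v (τ z) z) j y| ≤ A)
    (hB : ∀ j ≤ N, (τ ((inducedMap T τ)^[j] y) : ℝ) ≤ B) :
    |birkhoffSum T v n (T^[l] y)| ≤ A + 2 * H * B := by
  have hH0 : 0 ≤ H := (abs_nonneg _).trans (hH y)
  obtain ⟨j, r, hr, hk⟩ := exists_eq_birkhoffSum_add (T := T) hτ (l + n) y
  have hj : j ≤ N := by
    rcases j with _ | j
    · exact Nat.zero_le N
    · have := add_le_birkhoffSum_succ hτ (inducedMap T τ) j y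
      omega
  have hsum : birkhoffSum T v n (T^[l] y) =
      birkhoffSum (inducedMap T τ) (fun z => birkhoffSum T v (τ z) z) j y
        + birkhoffSum T v r ((inducedMap T τ)^[j] y) - birkhoffSum T v l y := by
    rw [birkhoffSum_inducedSum, iterate_inducedMap, ← birkhoffSum_add, ← hk, birkhoffSum_add,
      add_sub_cancel_left]
  have hincomplete : ∀ {k i : ℕ}, i ≤ N → k < τ ((inducedMap T τ)^[i] y) → ∀ z,
      |birkhoffSum T v k z| ≤ H * B := fun hi hk z =>
    (norm_birkhoffSum_le (v := v) hH _ z).trans <|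
      mul_le_mul_of_nonneg_left ((Nat.cast_le.2 hk.le).trans (hB _ hi)) hH0
  have hr' := abs_le.1 (hincomplete hj hr ((inducedMap T τ)^[j] y))
  have hl' := abs_le.1 (hincomplete (i := 0) (Nat.zero_le N) hl y)
  have hj' := abs_le.1 (hA j hj)
  rw [hsum, abs_le]
  constructor <;> linarith [hr'.1, hr'.2, hl'.1, hl'.2, hj'.1, hj'.2]

lemma birkhoffSum_add_coboundary (F : M → M) (V χ : M → ℝ) (j : ℕ) (y : M) :
    birkhoffSum F (fun z => V z + χ z - χ (F z)) j y
      = birkhoffSum F V j y + χ y - χ (F^[j] y) := by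
  induction j with
  | zero => simp only [birkhoffSum_zero, zero_add, Function.iterate_zero, id_eq, sub_self]
  | succ j ih =>
    rw [birkhoffSum_succ, birkhoffSum_succ, ih, Function.iterate_succ_apply']
    ring

end Path

section MaxBirkhoff

variable {M F : Type*} [SeminormedAddCommGroup F]

/-- The maximum over `n ≤ N` of `‖∑_{j < n} v (T^j y)‖`. -/
noncomputable def maxBirkhoff (T : M → M) (v : M → F) (N : ℕ) (y : M) : ℝ :=
  (Finset.range (N + 1)).sup' Finset.nonempty_range_add_one fun n => ‖birkhoffSum T v n y‖

lemma norm_birkhoffSum_le_maxBirkhoff (T : M → M) (v : M → F) {n N : ℕ} (hn : n ≤ N) (y : M) :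
    ‖birkhoffSum T v n y‖ ≤ maxBirkhoff T v N y :=
  Finset.le_sup' (fun n => ‖birkhoffSum T v n y‖) (Finset.mem_range_succ_iff.2 hn)

lemma exists_maxBirkhoff_eq (T : M → M) (v : M → F) (N : ℕ) (y : M) :
    ∃ n ≤ N, maxBirkhoff T v N y = ‖birkhoffSum T v n y‖ := by
  obtain ⟨n, hn, hmax⟩ := Finset.exists_mem_eq_sup' (s := Finset.range (N + 1))
    Finset.nonempty_range_add_one fun n => ‖birkhoffSum T v n y‖
  exact ⟨n, Finset.mem_range_succ_iff.1 hn, hmax⟩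

lemma maxBirkhoff_nonneg (T : M → M) (v : M → F) (N : ℕ) (y : M) : 0 ≤ maxBirkhoff T v N y :=
  (norm_nonneg _).trans (norm_birkhoffSum_le_maxBirkhoff T v (Nat.zero_le N) y)

lemma measurable_maxBirkhoff [MeasurableSpace M] {T : M → M} {v : M → F} (hT : Measurable T)
    (hv : StronglyMeasurable v) (N : ℕ) : Measurable (maxBirkhoff T v N) := by
  have hsup : maxBirkhoff T v N = (Finset.range (N + 1)).sup' Finset.nonempty_range_add_one
      fun n y => ‖birkhoffSum T v n y‖ := by
    funext y
    rw [Finset.sup'_apply, maxBirkhoff]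
  rw [hsup]
  exact Finset.measurable_sup' _ fun n _ => (Finset.stronglyMeasurable_fun_sum _ fun j _ =>
    hv.comp_measurable (hT.iterate j)).norm.measurable

end MaxBirkhoff

section MomentBound

variable {M : Type*} {T : M → M} {τ : M → ℕ} {v χ : M → ℝ} {p P H X : ℝ} {N : ℕ}

/-- The induced sum of `v` over an excursion from the base, corrected by the coboundary of `χ`. -/
noncomputable def correctedSum (T : M → M) (τ : M → ℕ) (v χ : M → ℝ) (y : M) : ℝ :=
  birkhoffSum T v (τ y) y + χ y - χ (inducedMap T τ y)

/-- A bound, over the point `y` of the base, for the Birkhoff sums of length at most `N` started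
from the floors of the tower above `y`. The last term dominates the `2N + 2` longest incomplete
excursions by the `ℓ^p` norm of the first `N + 1` return times. -/
noncomputable def floorMajorant (T : M → M) (τ : M → ℕ) (v χ : M → ℝ) (p H X : ℝ) (N : ℕ) (y : M) :
    ℝ :=
  2 * tailMax (inducedMap T τ) (correctedSum T τ v χ) N y + (2 * X + 2 * H *
    birkhoffSum (inducedMap T τ) (fun z => (τ z : ℝ) ^ p) (N + 1) y ^ p⁻¹)

variable [MeasurableSpace M] {σ ν : Measure M}

lemma integrable_birkhoffSum {F : M → M} (hF : MeasurePreserving F σ σ) {f : M → ℝ}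
    (hf : Integrable f σ) (n : ℕ) : Integrable (birkhoffSum F f n) σ :=
  integrable_finsetSum _ fun j _ => (hF.iterate j).integrable_comp_of_integrable hf

lemma integral_birkhoffSum {F : M → M} (hF : MeasurePreserving F σ σ) {f : M → ℝ}
    (hf : Integrable f σ) (n : ℕ) : ∫ y, birkhoffSum F f n y ∂σ = n * ∫ y, f y ∂σ := by
  simp only [birkhoffSum]
  rw [integral_finsetSum (f := fun j y => f (F^[j] y)) _
      fun j _ => (hF.iterate j).integrable_comp_of_integrable hf,
    Finset.sum_congr rfl fun j _ =>
      integral_comp_eq_of_measurePreserving (hF.iterate j) hf.aestronglyMeasurable,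
    Finset.sum_const, Finset.card_range, nsmul_eq_mul]

/-- A tower over `(σ, T^τ)` that projects onto a multiple of `ν`, with return times in `L^p`, and an
observable `v` whose induced sums are reverse martingale differences up to the coboundary of a
bounded function `χ`. -/
structure IsMartingaleTower (T : M → M) (ν σ : Measure M) (τ : M → ℕ) (v χ : M → ℝ)
    (p P H X : ℝ) : Prop where
  measurable_map : Measurable T
  measurable_time : Measurable τ
  one_le_time : ∀ y, 1 ≤ τ y
  integrable_time_rpow : Integrable (fun y => (τ y : ℝ) ^ p) σ
  integral_time_rpow_le : ∫ y, (τ y : ℝ) ^ p ∂σ ≤ P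
  towerMeasure_eq : towerMeasure σ T τ = (∫⁻ y, τ y ∂σ) • ν
  measurable_observable : Measurable v
  abs_observable_le : ∀ y, |v y| ≤ H
  ae_abs_le : ∀ᵐ y ∂σ, |χ y| ≤ X
  isReverseMartingaleDiff : IsReverseMartingaleDiff σ (inducedMap T τ) (correctedSum T τ v χ)

namespace IsMartingaleTower

variable [IsProbabilityMeasure σ] (h : IsMartingaleTower T ν σ τ v χ p P H X)
include h

lemma observable_bound_nonneg : 0 ≤ H := by
  obtain ⟨y⟩ := nonempty_of_isProbabilityMeasure σ
  exact (abs_nonneg _).trans (h.abs_observable_le y)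

lemma coboundary_bound_nonneg : 0 ≤ X := by
  obtain ⟨y, hy⟩ := h.ae_abs_le.exists
  exact (abs_nonneg _).trans hy

omit [IsProbabilityMeasure σ] in
lemma ae_abs_iterate_le : ∀ᵐ y ∂σ, ∀ j, |χ ((inducedMap T τ)^[j] y)| ≤ X :=
  ae_all_iff.2 fun j => (h.isReverseMartingaleDiff.measurePreserving.iterate
    j).quasiMeasurePreserving.ae h.ae_abs_le

lemma ae_abs_correctedSum_rpow_le (hp : 0 ≤ p) : ∀ᵐ y ∂σ, |correctedSum T τ v χ y| ^ p ≤
    2 ^ p * (H ^ p * (τ y : ℝ) ^ p + (2 * X) ^ p) := by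
  filter_upwards [h.ae_abs_iterate_le] with y hy
  have hχ : |χ y - χ (inducedMap T τ y)| ≤ 2 * X :=
    (abs_sub _ _).trans ((add_le_add (hy 0) (hy 1)).trans_eq (two_mul X).symm)
  rw [correctedSum, add_sub_assoc, ← Real.mul_rpow h.observable_bound_nonneg (Nat.cast_nonneg _)]
  refine (abs_add_rpow_le_two_rpow_mul hp _ _).trans ?_
  gcongr
  exact norm_birkhoffSum_le (v := v) h.abs_observable_le _ y

lemma integrable_majorant_correctedSum :
    Integrable (fun y => 2 ^ p * (H ^ p * (τ y : ℝ) ^ p + (2 * X) ^ p)) σ :=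
  ((h.integrable_time_rpow.const_mul _).add (integrable_const _)).const_mul _

lemma integrable_abs_correctedSum_rpow (hp : 0 ≤ p) :
    Integrable (fun y => |correctedSum T τ v χ y| ^ p) σ := by
  refine h.integrable_majorant_correctedSum.mono'
    (h.isReverseMartingaleDiff.measurable.abs.pow_const p).aestronglyMeasurable
    ((h.ae_abs_correctedSum_rpow_le hp).mono fun y hy => ?_)
  rwa [Real.norm_of_nonneg (by positivity)]

lemma integral_abs_correctedSum_rpow_le (hp : 0 ≤ p) :
    ∫ y, |correctedSum T τ v χ y| ^ p ∂σ ≤ 2 ^ p * (H ^ p * P + (2 * X) ^ p) := by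
  have hH := h.observable_bound_nonneg
  refine (integral_mono_ae (h.integrable_abs_correctedSum_rpow hp)
    h.integrable_majorant_correctedSum (h.ae_abs_correctedSum_rpow_le hp)).trans ?_
  rw [integral_const_mul, integral_add (h.integrable_time_rpow.const_mul _) (integrable_const _),
    integral_const_mul, integral_const, probReal_univ, one_smul]
  gcongr
  exact h.integral_time_rpow_le

lemma floorMajorant_nonneg (y : M) : 0 ≤ floorMajorant T τ v χ p H X N y := by
  have := h.observable_bound_nonneg
  have := h.coboundary_bound_nonneg
  have := tailMax_nonneg (F := inducedMap T τ) (φ := correctedSum T τ v χ) N y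
  have : 0 ≤ birkhoffSum (inducedMap T τ) (fun z => (τ z : ℝ) ^ p) (N + 1) y :=
    Finset.sum_nonneg fun j _ => by positivity
  unfold floorMajorant
  positivity

omit [IsProbabilityMeasure σ] in
lemma ae_maxBirkhoff_iterate_le (hp : 0 < p) : ∀ᵐ y ∂σ, ∀ l < τ y,
    maxBirkhoff T v N (T^[l] y) ≤ floorMajorant T τ v χ p H X N y := by
  filter_upwards [h.ae_abs_iterate_le] with y hy l hl
  set F := inducedMap T τ
  have hexcursion : ∀ j ≤ N, (τ (F^[j] y) : ℝ) ≤
      birkhoffSum F (fun z => (τ z : ℝ) ^ p) (N + 1) y ^ p⁻¹ := fun j hj => by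
    rw [birkhoffSum, Real.le_rpow_inv_iff_of_pos (Nat.cast_nonneg _)
      (Finset.sum_nonneg fun j _ => by positivity) hp]
    exact Finset.single_le_sum (f := fun j => (τ (F^[j] y) : ℝ) ^ p) (fun j _ => by positivity)
      (Finset.mem_range_succ_iff.2 hj)
  have hinduced : ∀ j ≤ N, |birkhoffSum F (fun z => birkhoffSum T v (τ z) z) j y| ≤
      2 * tailMax F (correctedSum T τ v χ) N y + 2 * X := fun j hj => by
    have hmart := abs_le.1
      (abs_birkhoffSum_le_two_mul_tailMax (F := F) (φ := correctedSum T τ v χ) hj y)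
    have hcob := birkhoffSum_add_coboundary F (fun z => birkhoffSum T v (τ z) z) χ j y
    have hχj := abs_le.1 (hy j)
    have hχ0 := abs_le.1 (hy 0)
    change birkhoffSum F (correctedSum T τ v χ) j y = _ at hcob
    rw [Function.iterate_zero, id_eq] at hχ0
    exact abs_le.2 ⟨by linarith only [hmart.1, hχj.1, hχ0.2, hcob],
      by linarith only [hmart.2, hχj.2, hχ0.1, hcob]⟩
  refine Finset.sup'_le _ _ fun n hn => ?_
  refine (abs_birkhoffSum_iterate_le h.one_le_time h.abs_observable_le
    (Finset.mem_range_succ_iff.1 hn) hl hinduced hexcursion).trans_eq ?_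
  rw [floorMajorant, add_assoc]

lemma floorMajorant_rpow_le (hp : 0 < p) (y : M) : floorMajorant T τ v χ p H X N y ^ p ≤
    2 ^ p * (2 ^ p * tailMax (inducedMap T τ) (correctedSum T τ v χ) N y ^ p + 2 ^ p *
      ((2 * X) ^ p + (2 * H) ^ p *
        birkhoffSum (inducedMap T τ) (fun z => (τ z : ℝ) ^ p) (N + 1) y)) := by
  have hX := h.coboundary_bound_nonneg
  have hH := h.observable_bound_nonneg
  have hD := tailMax_nonneg (F := inducedMap T τ) (φ := correctedSum T τ v χ) N y
  have hW : 0 ≤ birkhoffSum (inducedMap T τ) (fun z => (τ z : ℝ) ^ p) (N + 1) y :=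
    Finset.sum_nonneg fun j _ => by positivity
  have hG := h.floorMajorant_nonneg (N := N) y
  rw [floorMajorant] at hG ⊢
  set D := tailMax (inducedMap T τ) (correctedSum T τ v χ) N y
  set W := birkhoffSum (inducedMap T τ) (fun z => (τ z : ℝ) ^ p) (N + 1) y
  have hinner : (2 * X + 2 * H * W ^ p⁻¹) ^ p ≤ 2 ^ p * ((2 * X) ^ p + (2 * H) ^ p * W) := by
    have hadd := abs_add_rpow_le_two_rpow_mul hp.le (2 * X) (2 * H * W ^ p⁻¹)
    rwa [abs_of_nonneg (by positivity), abs_of_nonneg (by positivity),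
      abs_of_nonneg (by positivity), Real.mul_rpow (x := 2 * H) (by positivity)
      (by positivity), Real.rpow_inv_rpow hW hp.ne']
      at hadd
  have houter := abs_add_rpow_le_two_rpow_mul hp.le (2 * D) (2 * X + 2 * H * W ^ p⁻¹)
  rw [abs_of_nonneg hG, abs_of_nonneg (by positivity), abs_of_nonneg (by positivity),
    Real.mul_rpow zero_le_two hD] at houter
  refine houter.trans ?_
  gcongr

lemma integrable_tailMax_correctedSum_rpow (hp : 0 < p) : Integrable
    (fun y => tailMax (inducedMap T τ) (correctedSum T τ v χ) N y ^ p) σ :=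
  integrable_tailMax_rpow hp h.isReverseMartingaleDiff.measurePreserving
    h.isReverseMartingaleDiff.measurable (h.integrable_abs_correctedSum_rpow hp.le) N

lemma integrable_majorant_floorMajorant (hp : 0 < p) : Integrable (fun y =>
    2 ^ p * (2 ^ p * tailMax (inducedMap T τ) (correctedSum T τ v χ) N y ^ p + 2 ^ p *
      ((2 * X) ^ p + (2 * H) ^ p *
        birkhoffSum (inducedMap T τ) (fun z => (τ z : ℝ) ^ p) (N + 1) y))) σ :=
  (((h.integrable_tailMax_correctedSum_rpow hp).const_mul _).add
    (((integrable_const _).add ((integrable_birkhoffSum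
      h.isReverseMartingaleDiff.measurePreserving h.integrable_time_rpow _).const_mul
        _)).const_mul _)).const_mul _

omit [IsProbabilityMeasure σ] in
lemma measurable_floorMajorant : Measurable (floorMajorant T τ v χ p H X N) := by
  have hF := h.isReverseMartingaleDiff.measurePreserving.measurable
  have hτ : Measurable fun z => (τ z : ℝ) ^ p :=
    (measurable_from_nat.comp h.measurable_time).pow_const p
  exact ((measurable_tailMax hF h.isReverseMartingaleDiff.measurable N).const_mul 2).add
    ((((measurable_birkhoffSum hF hτ (N + 1)).pow_const _).const_mul _).const_add _)

lemma integrable_floorMajorant_rpow (hp : 0 < p) :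
    Integrable (fun y => floorMajorant T τ v χ p H X N y ^ p) σ := by
  refine (h.integrable_majorant_floorMajorant (N := N) hp).mono'
    (h.measurable_floorMajorant.pow_const p).aestronglyMeasurable (ae_of_all _ fun y => ?_)
  rw [Real.norm_of_nonneg (Real.rpow_nonneg (h.floorMajorant_nonneg y) p)]
  exact h.floorMajorant_rpow_le hp y

lemma integral_floorMajorant_rpow_le (hp : 0 < p) :
    ∫ y, floorMajorant T τ v χ p H X N y ^ p ∂σ ≤
      2 ^ p * (2 ^ p * ∫ y, tailMax (inducedMap T τ) (correctedSum T τ v χ) N y ^ p ∂σ + 2 ^ p *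
        ((2 * X) ^ p + (2 * H) ^ p * ((N + 1 : ℕ) * P))) := by
  have hH := h.observable_bound_nonneg
  have hW : Integrable (fun y => (2 * H) ^ p *
      birkhoffSum (inducedMap T τ) (fun z => (τ z : ℝ) ^ p) (N + 1) y) σ :=
    (integrable_birkhoffSum h.isReverseMartingaleDiff.measurePreserving
      h.integrable_time_rpow (N + 1)).const_mul _
  have hXW : Integrable (fun y => 2 ^ p * ((2 * X) ^ p + (2 * H) ^ p *
      birkhoffSum (inducedMap T τ) (fun z => (τ z : ℝ) ^ p) (N + 1) y)) σ :=
    ((integrable_const _).add hW).const_mul _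
  refine (integral_mono (h.integrable_floorMajorant_rpow hp)
    (h.integrable_majorant_floorMajorant hp) (h.floorMajorant_rpow_le hp)).trans ?_
  rw [integral_const_mul,
    integral_add ((h.integrable_tailMax_correctedSum_rpow hp).const_mul _) hXW, integral_const_mul,
    integral_const_mul, integral_add (integrable_const _) hW, integral_const_mul, integral_const,
    probReal_univ, one_smul, integral_birkhoffSum
      h.isReverseMartingaleDiff.measurePreserving h.integrable_time_rpow]
  gcongr
  exact h.integral_time_rpow_le

lemma lintegral_maxBirkhoff_rpow_le_integral (hp : 1 < p) {δ : ℝ} (hδ : 0 < δ) :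
    ∫⁻ y, ENNReal.ofReal (maxBirkhoff T v N y ^ (p - 1)) ∂ν ≤
      ENNReal.ofReal (δ * ∫ y, floorMajorant T τ v χ p H X N y ^ p ∂σ + δ ^ (1 - p) * P) := by
  have hp0 : 0 < p := by linarith
  have hG0 := fun y => h.floorMajorant_nonneg (N := N) y
  set G := floorMajorant T τ v χ p H X N
  have hGi : Integrable (fun y => δ * G y ^ p) σ :=
    (h.integrable_floorMajorant_rpow hp0).const_mul δ
  have hτi : Integrable (fun y => δ ^ (1 - p) * (τ y : ℝ) ^ p) σ :=
    h.integrable_time_rpow.const_mul _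
  have hexcursion : ∀ᵐ y ∂σ, ∑ l ∈ Finset.range (τ y),
      ENNReal.ofReal (maxBirkhoff T v N (T^[l] y) ^ (p - 1)) ≤
        ENNReal.ofReal (δ * G y ^ p + δ ^ (1 - p) * (τ y : ℝ) ^ p) := by
    filter_upwards [h.ae_maxBirkhoff_iterate_le hp0] with y hy
    calc _ ≤ ∑ _l ∈ Finset.range (τ y), ENNReal.ofReal (G y ^ (p - 1)) :=
          Finset.sum_le_sum fun l hl => ENNReal.ofReal_le_ofReal <|
            Real.rpow_le_rpow (maxBirkhoff_nonneg _ _ _ _) (hy l (Finset.mem_range.1 hl))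
              (by linarith)
      _ = ENNReal.ofReal (G y ^ (p - 1) * τ y) := by
          rw [Finset.sum_const, Finset.card_range, nsmul_eq_mul, ← ENNReal.ofReal_natCast,
            ← ENNReal.ofReal_mul (Nat.cast_nonneg _), mul_comm]
      _ ≤ _ := ENNReal.ofReal_le_ofReal
          (rpow_sub_one_mul_le hp hδ (hG0 y) (Nat.cast_nonneg _))
  have hmax := measurable_maxBirkhoff h.measurable_map h.measurable_observable.stronglyMeasurable N
  refine (lintegral_le_lintegral_sum h.measurable_map h.measurable_time h.one_le_time
    h.towerMeasure_eq (hmax.pow_const _).ennreal_ofReal).trans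
    ((lintegral_mono_ae hexcursion).trans ?_)
  have hsum : Integrable (fun y => δ * G y ^ p + δ ^ (1 - p) * (τ y : ℝ) ^ p) σ := hGi.add hτi
  have hsum0 : ∀ y, 0 ≤ δ * G y ^ p + δ ^ (1 - p) * (τ y : ℝ) ^ p := fun y => by
    have := Real.rpow_nonneg (hG0 y) p
    positivity
  rw [← ofReal_integral_eq_lintegral_ofReal hsum (ae_of_all _ hsum0), integral_add hGi hτi,
    integral_const_mul, integral_const_mul]
  gcongr
  exact h.integral_time_rpow_le

end IsMartingaleTower

theorem exists_integral_floorMajorant_rpow_le (hp : 1 < p) (P H X : ℝ) : ∃ Γ : ℝ,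
    ∀ {M : Type*} [MeasurableSpace M] {T : M → M} {ν σ : Measure M} [IsProbabilityMeasure σ]
      {τ : M → ℕ} {v χ : M → ℝ}, IsMartingaleTower T ν σ τ v χ p P H X → ∀ N : ℕ, 1 ≤ N →
        ∫ y, floorMajorant T τ v χ p H X N y ^ p ∂σ ≤ Γ * N ^ momentExponent p := by
  obtain ⟨C, hC, hmax⟩ := exists_integral_tailMax_rpow_le hp
  refine ⟨2 ^ p * (2 ^ p * (C * (2 ^ p * (H ^ p * P + (2 * X) ^ p))) + 2 ^ p *
    ((2 * X) ^ p + (2 * H) ^ p * (2 * P))), fun {M _ T ν σ _ τ v χ} h N hN => ?_⟩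
  have hp0 : 0 ≤ p := by linarith
  have hX := h.coboundary_bound_nonneg
  have hH := h.observable_bound_nonneg
  have hP : 0 ≤ P := (integral_nonneg fun y => by positivity).trans h.integral_time_rpow_le
  have hN1 : (1 : ℝ) ≤ N := Nat.one_le_cast.2 hN
  have hNκ : (N : ℝ) ≤ (N : ℝ) ^ momentExponent p :=
    Real.self_le_rpow_of_one_le hN1 (le_max_right _ _)
  set n := (N : ℝ) ^ momentExponent p
  have htail : ∫ y, tailMax (inducedMap T τ) (correctedSum T τ v χ) N y ^ p ∂σ ≤
      C * (2 ^ p * (H ^ p * P + (2 * X) ^ p)) * n := by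
    refine (hmax h.isReverseMartingaleDiff (h.integrable_abs_correctedSum_rpow hp0) N hN).trans ?_
    rw [mul_right_comm]
    gcongr
    exact h.integral_abs_correctedSum_rpow_le hp0
  have hreturns : ((N + 1 : ℕ) : ℝ) * P ≤ 2 * P * n := by
    rw [mul_right_comm]
    gcongr
    push_cast
    linarith
  have hcoboundary : (2 * X) ^ p ≤ (2 * X) ^ p * n :=
    le_mul_of_one_le_right (by positivity) (hN1.trans hNκ)
  calc _ ≤ _ := h.integral_floorMajorant_rpow_le (by linarith)
    _ ≤ 2 ^ p * (2 ^ p * (C * (2 ^ p * (H ^ p * P + (2 * X) ^ p)) * n) + 2 ^ p *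
          ((2 * X) ^ p * n + (2 * H) ^ p * (2 * P * n))) := by gcongr
    _ = _ := by ring

theorem exists_lintegral_maxBirkhoff_rpow_le (hp : 1 < p) (P H X : ℝ) : ∃ C : ℝ,
    ∀ {M : Type*} [MeasurableSpace M] {T : M → M} {ν σ : Measure M} [IsProbabilityMeasure σ]
      {τ : M → ℕ} {v χ : M → ℝ}, IsMartingaleTower T ν σ τ v χ p P H X → ∀ N : ℕ, 1 ≤ N →
        ∫⁻ y, ENNReal.ofReal (maxBirkhoff T v N y ^ (p - 1)) ∂ν ≤
          ENNReal.ofReal (C * N ^ (momentExponent p / p * (p - 1))) := by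
  obtain ⟨Γ, hΓ⟩ := exists_integral_floorMajorant_rpow_le hp P H X
  refine ⟨Γ + P, fun {M _ T ν σ _ τ v χ} h N hN => ?_⟩
  have hN0 : (0 : ℝ) < N := Nat.cast_pos.2 hN
  set κ := momentExponent p
  -- the choice of `δ` for which both terms of Young's inequality have the same order in `N`
  refine (h.lintegral_maxBirkhoff_rpow_le_integral hp (δ := (N : ℝ) ^ (-(κ / p)))
    (by positivity)).trans (ENNReal.ofReal_le_ofReal ?_)
  have hexp : -(κ / p) + κ = κ / p * (p - 1) := by
    have : p ≠ 0 := by linarith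
    field_simp
    ring
  calc _ ≤ (N : ℝ) ^ (-(κ / p)) * (Γ * N ^ κ) + ((N : ℝ) ^ (-(κ / p))) ^ (1 - p) * P := by
        gcongr
        exact hΓ h N hN
    _ = Γ * ((N : ℝ) ^ (-(κ / p)) * N ^ κ) + P * ((N : ℝ) ^ (-(κ / p))) ^ (1 - p) := by ring
    _ = Γ * N ^ (κ / p * (p - 1)) + P * N ^ (κ / p * (p - 1)) := by
        rw [← Real.rpow_add hN0, ← Real.rpow_mul hN0.le, hexp, neg_mul_comm, neg_sub]
    _ = _ := (add_mul _ _ _).symm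

end MomentBound

section InducedSystem

lemma IsFullBranch.coboundaryConst_nonneg {M ι : Type*} [MeasurableSpace M] {μ : Measure M}
    {F : M → M} {Z : Set M} {s : ι → M → M} {g : ι → M → ℝ} {ρ : M → M → ℝ} {θ C₁ R : ℝ}
    (h : IsFullBranch μ F Z s g ρ θ C₁ R) :
    0 ≤ coboundaryConst θ C₁ R := by
  have := h.coneConst_pos
  have := h.gapConst_pos
  have := h.distortion_pos
  unfold coboundaryConst
  positivity

lemma IsFullBranch.hasSum_integral_weight_mul_const {M ι : Type*} [MeasurableSpace M]
    {μ : Measure M} {F : M → M} {Z : Set M} {s : ι → M → M} {g : ι → M → ℝ} {ρ : M → M → ℝ}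
    {θ C₁ R : ℝ} (h : IsFullBranch μ F Z s g ρ θ C₁ R) {f : M → ℝ} (hfm : Measurable f)
    (hf : Integrable f μ) {c : ι → ℝ} (hc : ∀ i, ∀ y ∈ Z, f (s i y) = c i) :
    HasSum (fun i => (∫ y, g i y ∂μ) * c i) (∫ y, f y ∂μ) := by
  refine (h.hasSum_integral_weight_mul hfm hf).congr_fun fun i => ?_
  rw [← integral_mul_const]
  exact integral_congr_ae (h.ae_mem.mono fun y hy => by simp only [hc i y hy])

lemma dist_le_rpow_mul_rpow {M : Type*} [PseudoMetricSpace M] {D η : ℝ}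
    (hD : ∀ x y : M, dist x y ≤ D) (hη : 0 ≤ η) (hη1 : η ≤ 1) (x y : M) :
    dist x y ≤ D ^ (1 - η) * dist x y ^ η := by
  calc dist x y = dist x y ^ ((1 - η) + η) := by rw [sub_add_cancel, Real.rpow_one]
    _ = dist x y ^ (1 - η) * dist x y ^ η :=
        Real.rpow_add_of_nonneg dist_nonneg (sub_nonneg.2 hη1) hη
    _ ≤ _ := by
        have := sub_nonneg.2 hη1
        gcongr
        exact hD x y

/-- The bound on the density, with respect to `baseMeasure`, of the invariant measure of the induced
map of an inducing scheme on a space of diameter at most `D`. -/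
noncomputable def schemeDensityConst (lam η C₁ D : ℝ) : ℝ :=
  Real.exp (coneConst (lam ^ (-η)) C₁ * D ^ η)

/-- The bound on the coboundary of an `H`-Lipschitz observable over an inducing scheme with mean
return time at most `P`, on a space of diameter at most `D`. -/
noncomputable def schemeCoboundaryConst (lam η C₀ C₁ D H P : ℝ) : ℝ :=
  coboundaryConst (lam ^ (-η)) (2 * coneConst (lam ^ (-η)) C₁) (D ^ η) *
    (H * C₀ * D ^ (1 - η) * P)

variable {M : Type*} [MeasurableSpace M] {m ν σ : Measure M} {T : M → M} {Y : Set M}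
  {α : Set (Set M)} {τ : M → ℕ} {lam η C₀ C₁ p D H P : ℝ} {K : ℝ≥0}

lemma lintegral_time_rpow_le {c : ℝ} (hc : 0 ≤ c)
    (hσ : σ ≤ ENNReal.ofReal c • baseMeasure m Y) (hK : ⨍⁻ x in Y, (τ x : ℝ≥0∞) ^ p ∂m ≤ K) :
    ∫⁻ y, (τ y : ℝ≥0∞) ^ p ∂σ ≤ ENNReal.ofReal (c * K) := by
  rw [laverage, Measure.restrict_apply_univ, ← baseMeasure] at hK
  refine (lintegral_mono' hσ le_rfl).trans ?_
  rw [lintegral_smul_measure, smul_eq_mul, ENNReal.ofReal_mul hc, ENNReal.ofReal_coe_nnreal]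
  gcongr

lemma lintegral_time_le (hp : 1 ≤ p) (hτ1 : ∀ y, 1 ≤ τ y) :
    ∫⁻ y, (τ y : ℝ≥0∞) ∂σ ≤ ∫⁻ y, (τ y : ℝ≥0∞) ^ p ∂σ :=
  lintegral_mono fun y => ENNReal.le_rpow_self_of_one_le (Nat.one_le_cast.2 (hτ1 y)) hp

lemma integrable_natCast_rpow (hτ : Measurable τ) (hp : 0 ≤ p)
    (hfin : ∫⁻ y, (τ y : ℝ≥0∞) ^ p ∂σ ≠ ∞) : Integrable (fun y => (τ y : ℝ) ^ p) σ := by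
  refine ⟨((measurable_from_nat.comp hτ).pow_const p).aestronglyMeasurable, ?_⟩
  rw [hasFiniteIntegral_iff_ofReal (ae_of_all _ fun y => by positivity)]
  simpa only [← ENNReal.ofReal_rpow_of_nonneg (Nat.cast_nonneg _) hp, ENNReal.ofReal_natCast]
    using hfin.lt_top

lemma integral_natCast_rpow_le (hτ : Measurable τ) (hp : 0 ≤ p) (hP : 0 ≤ P)
    (hle : ∫⁻ y, (τ y : ℝ≥0∞) ^ p ∂σ ≤ ENNReal.ofReal P) : ∫ y, (τ y : ℝ) ^ p ∂σ ≤ P := by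
  have hm : Measurable fun y => (τ y : ℝ) ^ p := (measurable_from_nat.comp hτ).pow_const p
  rw [integral_eq_lintegral_of_nonneg_ae (ae_of_all _ fun y => by positivity)
    hm.aestronglyMeasurable]
  refine ENNReal.toReal_le_of_le_ofReal hP ?_
  simpa only [← ENNReal.ofReal_rpow_of_nonneg (Nat.cast_nonneg _) hp, ENNReal.ofReal_natCast]
    using hle

variable [MetricSpace M]

namespace IsInducingScheme

lemma exists_time_eq (hs : IsInducingScheme m T Y α τ lam η C₀ C₁) :
    ∃ n : α → ℕ, ∀ A, ∀ y ∈ A.1, τ y = n A := by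
  have hconst : ∀ A : α, ∃ n, ∀ y ∈ A.1, τ y = n := fun A => by
    obtain ⟨x, hx⟩ := nonempty_of_measure_ne_zero (hs.elem_pos A A.2).ne'
    exact ⟨τ x, fun y hy => hs.time_const A A.2 y hy x hx⟩
  choose n hn using hconst
  exact ⟨n, hn⟩

lemma measure_base_ne_top (hs : IsInducingScheme m T Y α τ lam η C₀ C₁) : m Y ≠ ∞ := by
  refine ne_top_of_le_ne_top hs.time_integrable.lintegral_lt_top.ne ?_
  rw [← setLIntegral_one]
  refine lintegral_mono_ae (hs.ae_mem_sUnion.mono fun x hx => ?_)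
  obtain ⟨A, hA, hxA⟩ := hx
  exact ENNReal.one_le_ofReal.2 (Nat.one_le_cast.2 (hs.one_le_time A hA x hxA))

lemma isProbabilityMeasure_baseMeasure (hs : IsInducingScheme m T Y α τ lam η C₀ C₁) :
    IsProbabilityMeasure (baseMeasure m Y) := by
  constructor
  rw [baseMeasure, Measure.smul_apply, Measure.restrict_apply_univ, smul_eq_mul,
    ENNReal.inv_mul_cancel hs.base_pos.ne' hs.measure_base_ne_top]

lemma isBranchLip_inducedSum (hs : IsInducingScheme m T Y α τ lam η C₀ C₁) {Z : Set M}
    {s : α → M → M} (hb : IsInverseBranches m (inducedMap T τ) Y α Z s) (hη : 0 ≤ η) (hη1 : η ≤ 1)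
    (hC₀ : 1 ≤ C₀) (hD1 : 1 ≤ D) (hD : ∀ x y : M, dist x y ≤ D) {v : M → ℝ} (hH : ∀ y, |v y| ≤ H)
    (hL : ∀ y y', |v y - v y'| ≤ H * dist y y')
    (hV : Measurable fun y => birkhoffSum T v (τ y) y) {n : α → ℕ}
    (hn : ∀ A, ∀ y ∈ Z, τ (s A y) = n A) {q : α → M → ℝ}
    (hsum : Summable fun A => (∫ z, q A z ∂σ) * n A) :
    IsBranchLip σ Z s q (fun x y => dist x y ^ η) (fun A => H * C₀ * D ^ (1 - η) * n A)
      fun y => birkhoffSum T v (τ y) y where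
  measurable := hV
  abs_le A y hy := by
    have hH0 : 0 ≤ H := (abs_nonneg _).trans (hH y)
    refine (norm_birkhoffSum_le (v := v) hH _ _).trans ?_
    rw [hn A y hy, mul_assoc H]
    gcongr
    exact le_mul_of_one_le_right hH0
      (one_le_mul_of_one_le_of_one_le hC₀ (Real.one_le_rpow hD1 (sub_nonneg.2 hη1)))
  abs_sub_le A y hy y' hy' := by
    have hH0 : 0 ≤ H := (abs_nonneg _).trans (hH y)
    have hdist : ∀ l < n A, dist (T^[l] (s A y)) (T^[l] (s A y')) ≤ C₀ * dist y y' := by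
      have hint := hs.intermediate A A.2 _ (hb.mem A y hy) _ (hb.mem A y' hy')
      rwa [hb.map A y hy, hb.map A y' hy', hn A y hy] at hint
    have hterm : ∀ l ∈ Finset.range (n A), |v (T^[l] (s A y)) - v (T^[l] (s A y'))| ≤
        H * C₀ * D ^ (1 - η) * dist y y' ^ η := fun l hl => by
      calc _ ≤ H * dist (T^[l] (s A y)) (T^[l] (s A y')) := hL _ _
        _ ≤ H * (C₀ * (D ^ (1 - η) * dist y y' ^ η)) := by
            gcongr
            refine (hdist l (Finset.mem_range.1 hl)).trans ?_
            gcongr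
            exact dist_le_rpow_mul_rpow hD hη hη1 y y'
        _ = _ := by ring
    rw [hn A y hy, hn A y' hy', birkhoffSum, birkhoffSum, ← Finset.sum_sub_distrib]
    refine (Finset.abs_sum_le_sum_abs _ _).trans ((Finset.sum_le_sum hterm).trans_eq ?_)
    rw [Finset.sum_const, Finset.card_range, nsmul_eq_mul]
    ring
  summable := (hsum.mul_left (H * C₀ * D ^ (1 - η))).congr fun A => by ring

theorem exists_isReverseMartingaleDiff_correctedSum [BorelSpace M] [IsProbabilityMeasure σ]
    (hs : IsInducingScheme m T Y α τ lam η C₀ C₁) {Z : Set M} {s : α → M → M} {q : α → M → ℝ}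
    (hb : IsInverseBranches m (inducedMap T τ) Y α Z s)
    (hF : IsNormalizedFullBranch σ (inducedMap T τ) Z s q (fun x y => dist x y ^ η) (lam ^ (-η))
      (2 * coneConst (lam ^ (-η)) C₁) (D ^ η)) (hT : Measurable T) (hτ : Measurable τ)
    (hη : 0 ≤ η) (hη1 : η ≤ 1) (hC₀ : 1 ≤ C₀) (hD1 : 1 ≤ D) (hD : ∀ x y : M, dist x y ≤ D)
    (htower : towerMeasure σ T τ = (∫⁻ y, τ y ∂σ) • ν) (hfin : ∫⁻ y, τ y ∂σ ≠ ∞)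
    (hP : ∫ y, (τ y : ℝ) ∂σ ≤ P) {v : M → ℝ} (hH : ∀ y, |v y| ≤ H)
    (hL : ∀ y y', |v y - v y'| ≤ H * dist y y') (hv0 : ∫ y, v y ∂ν = 0) :
    ∃ χ : M → ℝ, (∀ᵐ y ∂σ, |χ y| ≤ schemeCoboundaryConst lam η C₀ C₁ D H P) ∧
      IsReverseMartingaleDiff σ (inducedMap T τ) (correctedSum T τ v χ) := by
  have : Countable α := hs.countable.to_subtype
  have hv : Measurable v := (LipschitzWith.of_dist_le' hL).continuous.measurable
  obtain ⟨n, hn⟩ := hs.exists_time_eq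
  have hsum := hF.hasSum_integral_weight_mul_const (measurable_from_nat.comp hτ)
    (integrable_natCast hτ hfin) fun A y hy => congrArg Nat.cast (hn A _ (hb.mem A y hy))
  obtain ⟨χ, -, hχ, hmart⟩ := hF.exists_coboundary
    (hs.isBranchLip_inducedSum hb hη hη1 hC₀ hD1 hD hH hL (measurable_inducedSum hT hτ hv)
      (fun A y hy => hn A _ (hb.mem A y hy)) hsum.summable)
    (integrable_inducedSum hT hτ hfin hv hH)
    (integral_inducedSum_eq_zero hT hτ htower hfin hv hH hv0)
  refine ⟨χ, hF.ae_mem.mono fun y hy => (hχ y hy).trans ?_, hmart⟩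
  have hbound : ∑' A, (∫ z, q A z ∂σ) * (H * C₀ * D ^ (1 - η) * n A) ≤
      H * C₀ * D ^ (1 - η) * P := by
    have hH0 : 0 ≤ H := (abs_nonneg _).trans (hH y)
    simp only [mul_left_comm _ (H * C₀ * D ^ (1 - η)), tsum_mul_left, hsum.tsum_eq]
    gcongr
    exact hP
  exact mul_le_mul_of_nonneg_left hbound hF.coboundaryConst_nonneg

variable [StandardBorelSpace M] [BorelSpace M]

theorem exists_isNormalizedFullBranch (hs : IsInducingScheme m T Y α τ lam η C₀ C₁)
    (hT : Measurable T) (hτ : Measurable τ) (hlam : 1 < lam) (hη : 0 < η) (hC₁ : 0 < C₁)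
    (hD : ∀ x y : M, dist x y ≤ D) :
    ∃ (Z : Set M) (s : α → M → M) (σ : Measure M) (q : α → M → ℝ),
      IsInverseBranches m (inducedMap T τ) Y α Z s ∧ IsProbabilityMeasure σ ∧
      σ ≤ ENNReal.ofReal (schemeDensityConst lam η C₁ D) • baseMeasure m Y ∧
      IsNormalizedFullBranch σ (inducedMap T τ) Z s q (fun x y => dist x y ^ η) (lam ^ (-η))
        (2 * coneConst (lam ^ (-η)) C₁) (D ^ η) := by
  have : IsProbabilityMeasure (baseMeasure m Y) := hs.isProbabilityMeasure_baseMeasure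
  have : Countable α := hs.countable.to_subtype
  obtain ⟨Z, s, hb⟩ := hs.exists_isInverseBranches hT hτ
  obtain ⟨ζ, hζ⟩ := hs.exists_isInverseJacobian
  obtain ⟨σ, q, hσ⟩ :=
    (hs.isFullBranch hb hT hτ hlam hη hC₁ hD hζ).exists_isNormalizedFullBranch
  exact ⟨Z, s, σ, q, hb, hσ⟩

/-- For `P = schemeDensityConst lam η C₁ D * K`, the bounds `P` and `schemeCoboundaryConst … H P` do
not depend on the scheme. -/
theorem exists_isMartingaleTower (hs : IsInducingScheme m T Y α τ lam η C₀ C₁)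
    (hT : QuasiErgodic T m) (hlam : 1 < lam) (hη : 0 < η) (hη1 : η ≤ 1) (hC₀ : 1 ≤ C₀)
    (hC₁ : 0 < C₁) (hD1 : 1 ≤ D) (hD : ∀ x y : M, dist x y ≤ D) (hp : 1 ≤ p)
    (hK : ⨍⁻ x in Y, (τ x : ℝ≥0∞) ^ p ∂m ≤ K) (hP : schemeDensityConst lam η C₁ D * K = P)
    [IsProbabilityMeasure ν] (hν : MeasurePreserving T ν ν) (hνm : ν ≪ m) {v : M → ℝ}
    (hH : ∀ y, |v y| ≤ H) (hL : ∀ y y', |v y - v y'| ≤ H * dist y y') (hv0 : ∫ y, v y ∂ν = 0) :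
    ∃ (σ : Measure M) (τ' : M → ℕ) (χ : M → ℝ), IsProbabilityMeasure σ ∧
      IsMartingaleTower T ν σ τ' v χ p P H (schemeCoboundaryConst lam η C₀ C₁ D H P) := by
  have : Countable α := hs.countable.to_subtype
  obtain ⟨τ', hτ, hτ1, hττ⟩ := hs.exists_measurable_time
  have hs' := hs.congr hττ
  rw [laverage_congr (g := fun x => (τ' x : ℝ≥0∞) ^ p) (hs.ae_mem_sUnion.mono fun x hx => by
    obtain ⟨A, hA, hxA⟩ := hx
    simp only [hττ A hA hxA])] at hK
  have hp0 : 0 ≤ p := zero_le_one.trans hp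
  obtain ⟨Z, s, σ, q, hb, hprob, hσ, hF⟩ :=
    hs'.exists_isNormalizedFullBranch hT.measurable hτ hlam hη hC₁ hD
  have hρ : 0 ≤ schemeDensityConst lam η C₁ D := (Real.exp_pos _).le
  have hτp := lintegral_time_rpow_le hρ hσ hK
  rw [hP] at hτp
  have hP0 : 0 ≤ P := hP ▸ mul_nonneg hρ K.2
  have hτ1p : ∫⁻ y, τ' y ∂σ ≤ ENNReal.ofReal P := (lintegral_time_le hp hτ1).trans hτp
  have hfin : ∫⁻ y, τ' y ∂σ ≠ ∞ := ne_top_of_le_ne_top ENNReal.ofReal_ne_top hτ1p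
  have hσm : σ ≪ m := (Measure.absolutelyContinuous_of_le hσ).trans <|
    Measure.smul_absolutelyContinuous.trans <| Measure.smul_absolutelyContinuous.trans
      Measure.restrict_le_self.absolutelyContinuous
  have htower := towerMeasure_eq_smul hT hτ hν hνm hσm hF.measurePreserving hfin
  have hmean : ∫ y, (τ' y : ℝ) ∂σ ≤ P := by
    simpa only [Real.rpow_one] using integral_natCast_rpow_le hτ zero_le_one hP0
      (by simpa only [ENNReal.rpow_one] using hτ1p)
  obtain ⟨χ, hχ, hmart⟩ := hs'.exists_isReverseMartingaleDiff_correctedSum hb hF hT.measurable hτ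
    hη.le hη1 hC₀ hD1 hD htower hfin hmean hH hL hv0
  exact ⟨σ, τ', χ, hprob, hT.measurable, hτ, hτ1,
    integrable_natCast_rpow hτ hp0 (ne_top_of_le_ne_top ENNReal.ofReal_ne_top hτp),
    integral_natCast_rpow_le hτ hp0 hP0 hτp, htower,
    (LipschitzWith.of_dist_le' hL).continuous.measurable, hH, hχ, hmart⟩

end IsInducingScheme

/-- The maximal Birkhoff sums of length `N` of the `ν`-centred observables that are bounded by `H`
and `H`-Lipschitz have `q`-th moments at most `C N ^ b`. -/
def HasMaximalMomentBound (T : M → M) (ν : Measure M) (H q b C : ℝ) : Prop :=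
  ∀ v : M → ℝ, (∀ y, |v y| ≤ H) → (∀ y y', |v y - v y'| ≤ H * dist y y') → ∫ y, v y ∂ν = 0 →
    ∀ N : ℕ, 1 ≤ N → ∫⁻ y, ENNReal.ofReal (maxBirkhoff T v N y ^ q) ∂ν ≤ ENNReal.ofReal (C * N ^ b)

theorem IsUniformFamily.exists_hasMaximalMomentBound [StandardBorelSpace M] [BorelSpace M]
    [BoundedSpace M] {T : ℝ → M → M} {ε₀ : ℝ} (hT : IsUniformFamily m T ε₀ p) (hp : 1 < p) (H : ℝ) :
    ∃ C : ℝ, 0 ≤ C ∧ ∀ ε ∈ Ico 0 ε₀, ∀ ν : Measure M, IsProbabilityMeasure ν →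
      MeasurePreserving (T ε) ν ν → ν ≪ m →
      HasMaximalMomentBound (T ε) ν H (p - 1) (momentExponent p / p * (p - 1)) C := by
  obtain ⟨lam, η, C₀, C₁, K, hlam, hη, hη1, hC₀, hC₁, hfam⟩ := hT
  set D := max (Metric.diam (univ : Set M)) 1
  have hD : ∀ x y : M, dist x y ≤ D := fun x y =>
    (Metric.dist_le_diam_of_mem (BoundedSpace.bounded_univ) (mem_univ x) (mem_univ y)).trans
      (le_max_left _ _)
  set P := schemeDensityConst lam η C₁ D * K with hP
  obtain ⟨C, hC⟩ := exists_lintegral_maxBirkhoff_rpow_le hp P H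
    (schemeCoboundaryConst lam η C₀ C₁ D H P)
  refine ⟨max C 0, le_max_right _ _, fun ε hε ν _ hν hνm v hH hL hv0 N hN => ?_⟩
  obtain ⟨hTε, Y, α, τ, hs, hK⟩ := hfam ε hε
  obtain ⟨σ, τ', χ, _, htower⟩ := hs.exists_isMartingaleTower hTε hlam hη hη1 hC₀
    (zero_lt_one.trans_le hC₁) (le_max_right _ _) hD hp.le hK hP.symm hν hνm hH hL hv0
  refine (hC htower N hN).trans (ENNReal.ofReal_le_ofReal ?_)
  gcongr
  exact le_max_left C 0

end InducedSystem

section SupremumOverParameter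

variable {M X : Type*} [MeasurableSpace M] {d : ℕ} {B L q : ℝ} {x₀ : Fin d → ℝ}

lemma measurable_iSup_of_continuous [TopologicalSpace X] [TopologicalSpace.SeparableSpace X]
    {G : X → M → ℝ} (hcont : ∀ y, Continuous fun x => G x y) (hm : ∀ x, Measurable (G x)) :
    Measurable fun y => ⨆ x, G x y := by
  obtain ⟨S, hSc, hSd⟩ := TopologicalSpace.exists_countable_dense X
  have := hSc.to_subtype
  simp only [← fun y => hSd.ciSup' (hcont y)]
  exact Measurable.iSup fun x => hm x

/-- The coordinatewise retraction of `ℝ^d` onto a ball for the maximum norm. -/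
noncomputable def clampBall (x₀ : Fin d → ℝ) (L : ℝ) (x : Fin d → ℝ) : Fin d → ℝ :=
  fun i => max (min (x i) (x₀ i + L)) (x₀ i - L)

lemma clampBall_mem (hL : 0 ≤ L) (x : Fin d → ℝ) : clampBall x₀ L x ∈ Metric.closedBall x₀ L := by
  rw [Metric.mem_closedBall, dist_pi_le_iff hL]
  intro i
  have hle : max (min (x i) (x₀ i + L)) (x₀ i - L) ≤ x₀ i + L :=
    max_le (min_le_right _ _) (by linarith)
  have hge : x₀ i - L ≤ max (min (x i) (x₀ i + L)) (x₀ i - L) := le_max_right _ _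
  rw [Real.dist_eq, abs_le, clampBall]
  constructor <;> linarith

lemma clampBall_of_mem {x : Fin d → ℝ} (hx : x ∈ Metric.closedBall x₀ L) :
    clampBall x₀ L x = x := by
  funext i
  have hi := (dist_le_pi_dist x x₀ i).trans (Metric.mem_closedBall.1 hx)
  rw [Real.dist_eq, abs_le] at hi
  rw [clampBall, min_eq_left (by linarith), max_eq_left (by linarith)]

lemma dist_clampBall_le (x x' : Fin d → ℝ) :
    dist (clampBall x₀ L x) (clampBall x₀ L x') ≤ dist x x' := by
  rw [dist_pi_le_iff dist_nonneg]
  refine fun i => le_trans ?_ (dist_le_pi_dist x x' i)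
  simp only [Real.dist_eq, clampBall]
  refine (abs_max_sub_max_le_abs _ _ _).trans ((abs_min_sub_min_le_max _ _ _ _).trans ?_)
  rw [sub_self, abs_zero, max_eq_left (abs_nonneg _)]

lemma rpow_le_lintegral_closedBall {g : (Fin d → ℝ) → ℝ} (hB : 0 < B) (hq : 0 < q)
    (hLip : ∀ x x', |g x - g x'| ≤ B * dist x x') {x : Fin d → ℝ}
    (hx : x ∈ Metric.closedBall x₀ L) (h0 : 0 ≤ g x) (hgB : g x ≤ B) :
    ENNReal.ofReal (g x ^ (q + d)) ≤ ENNReal.ofReal (2 ^ q * B ^ d) *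
      ∫⁻ z in Metric.closedBall x₀ (L + 1), ENNReal.ofReal (g z ^ q) := by
  set s := g x
  set r := s / (2 * B) with hr
  have hBr : B * r = s / 2 := by rw [hr]; field_simp
  have hr2 : 2 * r = s / B := by rw [hr]; field_simp
  have hr1 : r ≤ 1 := by
    rw [hr, div_le_one (by positivity)]
    linarith
  have hsub : Metric.closedBall x r ⊆ Metric.closedBall x₀ (L + 1) :=
    Metric.closedBall_subset_closedBall' (by linarith [Metric.mem_closedBall.1 hx])
  -- `g ≥ s / 2` on the ball of radius `r` around `x`, whose volume is proportional to `s ^ d`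
  have hlow : ∀ z ∈ Metric.closedBall x r,
      ENNReal.ofReal ((s / 2) ^ q) ≤ ENNReal.ofReal (g z ^ q) := fun z hz => by
    have hz' : B * dist z x ≤ s / 2 := by
      rw [← hBr]
      exact mul_le_mul_of_nonneg_left (Metric.mem_closedBall.1 hz) hB.le
    gcongr
    linarith [(abs_le.1 (hLip z x)).1]
  calc ENNReal.ofReal (s ^ (q + d))
      = ENNReal.ofReal (2 ^ q * B ^ d) *
          ∫⁻ _ in Metric.closedBall x r, ENNReal.ofReal ((s / 2) ^ q) := by
        rw [setLIntegral_const, Real.volume_pi_closedBall _ (by positivity), Fintype.card_fin,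
          ← ENNReal.ofReal_mul (by positivity), ← ENNReal.ofReal_mul (by positivity),
          Real.div_rpow h0 zero_le_two, Real.rpow_add_natCast' h0 (by positivity), hr2, div_pow]
        congr 1
        field_simp
    _ ≤ ENNReal.ofReal (2 ^ q * B ^ d) *
          ∫⁻ z in Metric.closedBall x r, ENNReal.ofReal (g z ^ q) := by
        gcongr _ * ?_
        exact setLIntegral_mono' measurableSet_closedBall hlow
    _ ≤ _ := by gcongr

lemma exists_iSup_closedBall_eq {g : (Fin d → ℝ) → ℝ} (hL : 0 ≤ L) (hg : Continuous g) :
    ∃ x ∈ Metric.closedBall x₀ L, ⨆ z : Metric.closedBall x₀ L, g z = g x := by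
  have hne : (Metric.closedBall x₀ L).Nonempty := Metric.nonempty_closedBall.2 hL
  obtain ⟨x, hx, hmax⟩ :=
    (isCompact_closedBall x₀ L).exists_isMaxOn hne hg.continuousOn
  have := hne.to_subtype
  exact ⟨x, hx, le_antisymm (ciSup_le fun z => hmax z.2)
    (le_ciSup (f := fun z : Metric.closedBall x₀ L => g z)
      ⟨g x, forall_mem_range.2 fun z => hmax z.2⟩ ⟨x, hx⟩)⟩

/-- A maximal function over a `d`-dimensional parameter on which it depends in a Lipschitz manner
is controlled, at the price of `d` more powers, by its moments at fixed parameters. -/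
theorem lintegral_iSup_closedBall_rpow_le {G : (Fin d → ℝ) → M → ℝ} {ν : Measure M} [SFinite ν]
    (hB : 0 < B) (hL : 0 ≤ L) (hq : 0 < q) (h0 : ∀ x ∈ Metric.closedBall x₀ L, ∀ y, 0 ≤ G x y)
    (hGB : ∀ x ∈ Metric.closedBall x₀ L, ∀ y, G x y ≤ B)
    (hLip : ∀ x ∈ Metric.closedBall x₀ L, ∀ x' ∈ Metric.closedBall x₀ L, ∀ y,
      |G x y - G x' y| ≤ B * dist x x') (hm : ∀ x ∈ Metric.closedBall x₀ L, Measurable (G x))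
    {c : ℝ≥0∞} (hc : ∀ x ∈ Metric.closedBall x₀ L, ∫⁻ y, ENNReal.ofReal (G x y ^ q) ∂ν ≤ c) :
    ∫⁻ y, ENNReal.ofReal ((⨆ x : Metric.closedBall x₀ L, G x y) ^ (q + d)) ∂ν ≤
      ENNReal.ofReal (2 ^ q * B ^ d * (2 * (L + 1)) ^ d) * c := by
  set g : (Fin d → ℝ) → M → ℝ := fun x => G (clampBall x₀ L x) with hg
  have hgG : ∀ x ∈ Metric.closedBall x₀ L, g x = G x := fun x hx => by
    simp only [hg, clampBall_of_mem hx]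
  have hgLip : ∀ y x x', |g x y - g x' y| ≤ B * dist x x' := fun y x x' =>
    (hLip _ (clampBall_mem hL x) _ (clampBall_mem hL x') y).trans
      (mul_le_mul_of_nonneg_left (dist_clampBall_le x x') hB.le)
  have hcont : ∀ y, Continuous fun x => g x y := fun y =>
    (LipschitzWith.of_dist_le' (hgLip y)).continuous
  have hgm : Measurable (Function.uncurry fun y x => ENNReal.ofReal (g x y ^ q)) :=
    (((measurable_uncurry_of_continuous_of_measurable hcont fun x => hm _ (clampBall_mem hL x)).comp
      measurable_swap).pow_const q).ennreal_ofReal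
  have hpoint : ∀ y, ENNReal.ofReal ((⨆ x : Metric.closedBall x₀ L, G x y) ^ (q + d)) ≤
      ENNReal.ofReal (2 ^ q * B ^ d) *
        ∫⁻ x in Metric.closedBall x₀ (L + 1), ENNReal.ofReal (g x y ^ q) := fun y => by
    obtain ⟨x, hx, hsup⟩ := exists_iSup_closedBall_eq (x₀ := x₀) hL (hcont y)
    rw [← iSup_congr fun z : Metric.closedBall x₀ L => congrFun (hgG z z.2) y, hsup]
    exact rpow_le_lintegral_closedBall hB hq (hgLip y) hx (h0 _ (clampBall_mem hL x) y)
      (hGB _ (clampBall_mem hL x) y)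
  calc _ ≤ ∫⁻ y, (ENNReal.ofReal (2 ^ q * B ^ d) *
        ∫⁻ x in Metric.closedBall x₀ (L + 1), ENNReal.ofReal (g x y ^ q)) ∂ν :=
        lintegral_mono hpoint
    _ = ENNReal.ofReal (2 ^ q * B ^ d) *
        ∫⁻ x in Metric.closedBall x₀ (L + 1), ∫⁻ y, ENNReal.ofReal (g x y ^ q) ∂ν := by
        rw [lintegral_const_mul _ (Measurable.lintegral_prod_right hgm),
          lintegral_lintegral_swap hgm.aemeasurable]
    _ ≤ ENNReal.ofReal (2 ^ q * B ^ d) * ∫⁻ _ in Metric.closedBall x₀ (L + 1), c := by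
        gcongr with x
        exact hc _ (clampBall_mem hL x)
    _ = _ := by
        rw [setLIntegral_const, Real.volume_pi_closedBall _ (by linarith), Fintype.card_fin,
          mul_comm c, ← mul_assoc, ← ENNReal.ofReal_mul (by positivity)]

end SupremumOverParameter

section OrderFunction

variable {M X F : Type*} [NormedAddCommGroup F] {T : M → M} {w : X → M → F} {E : Set X}
  {u u' : M → F} {B ε q b C : ℝ}

/-- The common form of the two parts of the order function. -/
noncomputable def orderSup (T : M → M) (w : X → M → F) (E : Set X) (ε : ℝ) (y : M) : ℝ :=
  sSup {r : ℝ | ∃ x ∈ E, ∃ n : ℕ, 1 ≤ n ∧ ε * n ≤ 1 ∧ r = ε * ‖birkhoffSum T (w x) n y‖}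

/-- `ε max_{n ≤ 1/ε} ‖∑_{j < n} u (T^j y)‖`, the contribution of a single observable to the order
function. It vanishes for `ε = 0`. -/
noncomputable def scaledMax (T : M → M) (ε : ℝ) (u : M → F) (y : M) : ℝ :=
  ε * maxBirkhoff T u ⌊1 / ε⌋₊ y

lemma mul_natCast_le_one (hε : 0 ≤ ε) {n : ℕ} (hn : n ≤ ⌊1 / ε⌋₊) : ε * n ≤ 1 := by
  rcases hε.eq_or_lt with rfl | hε
  · simp
  · rw [mul_comm, ← le_div_iff₀ hε]
    exact (Nat.cast_le.2 hn).trans (Nat.floor_le (by positivity))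

lemma mul_norm_birkhoffSum_le (hu : ∀ y, ‖u y‖ ≤ B) (hε : 0 ≤ ε) {n : ℕ} (hn : ε * n ≤ 1) (y : M) :
    ε * ‖birkhoffSum T u n y‖ ≤ B := by
  have hB : 0 ≤ B := (norm_nonneg _).trans (hu y)
  calc ε * ‖birkhoffSum T u n y‖ ≤ ε * (B * n) := by gcongr; exact norm_birkhoffSum_le hu n y
    _ = ε * n * B := by ring
    _ ≤ B := mul_le_of_le_one_left hB hn

lemma exists_scaledMax_eq (T : M → M) (ε : ℝ) (u : M → F) (y : M) :
    ∃ n ≤ ⌊1 / ε⌋₊, scaledMax T ε u y = ε * ‖birkhoffSum T u n y‖ :=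
  (exists_maxBirkhoff_eq T u ⌊1 / ε⌋₊ y).imp fun _ h => ⟨h.1, congrArg (ε * ·) h.2⟩

lemma le_scaledMax (hε : 0 ≤ ε) (u : M → F) (y : M) {n : ℕ} (hn : n ≤ ⌊1 / ε⌋₊) :
    ε * ‖birkhoffSum T u n y‖ ≤ scaledMax T ε u y :=
  mul_le_mul_of_nonneg_left (norm_birkhoffSum_le_maxBirkhoff T u hn y) hε

lemma scaledMax_nonneg (hε : 0 ≤ ε) (u : M → F) (y : M) : 0 ≤ scaledMax T ε u y :=
  mul_nonneg hε (maxBirkhoff_nonneg T u _ y)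

lemma scaledMax_le (hu : ∀ y, ‖u y‖ ≤ B) (hε : 0 ≤ ε) (y : M) : scaledMax T ε u y ≤ B := by
  obtain ⟨n, hn, hmax⟩ := exists_scaledMax_eq T ε u y
  exact hmax.trans_le (mul_norm_birkhoffSum_le hu hε (mul_natCast_le_one hε hn) y)

lemma scaledMax_le_add (hu : ∀ y, ‖u y - u' y‖ ≤ B) (hε : 0 ≤ ε) (y : M) :
    scaledMax T ε u y ≤ scaledMax T ε u' y + B := by
  obtain ⟨n, hn, hmax⟩ := exists_scaledMax_eq T ε u y
  calc scaledMax T ε u y = ε * ‖birkhoffSum T u n y‖ := hmax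
    _ ≤ ε * (‖birkhoffSum T u' n y‖ + ‖birkhoffSum T (fun y => u y - u' y) n y‖) := by
        gcongr
        rw [birkhoffSum, birkhoffSum, birkhoffSum, Finset.sum_sub_distrib]
        exact norm_le_norm_add_norm_sub' _ _
    _ ≤ scaledMax T ε u' y + B := by
        rw [mul_add]
        exact add_le_add (le_scaledMax hε u' y hn)
          (mul_norm_birkhoffSum_le hu hε (mul_natCast_le_one hε hn) y)

lemma orderSup_nonneg (T : M → M) (w : X → M → F) (E : Set X) (hε : 0 ≤ ε) (y : M) :
    0 ≤ orderSup T w E ε y := by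
  refine Real.sSup_nonneg ?_
  rintro _ ⟨x, -, n, -, -, rfl⟩
  positivity

lemma orderSup_le_iSup_scaledMax (hw : ∀ x ∈ E, ∀ y, ‖w x y‖ ≤ B) (hε : 0 ≤ ε) (y : M) :
    orderSup T w E ε y ≤ ⨆ x : E, scaledMax T ε (w x) y := by
  have hsup0 : 0 ≤ ⨆ x : E, scaledMax T ε (w x) y :=
    Real.iSup_nonneg fun x => scaledMax_nonneg hε _ _
  refine Real.sSup_le ?_ hsup0
  rintro _ ⟨x, hx, n, -, hn, rfl⟩
  rcases hε.eq_or_lt with rfl | hε'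
  · rwa [zero_mul]
  · have hbdd : BddAbove (range fun x : E => scaledMax T ε (w x) y) :=
      ⟨B, forall_mem_range.2 fun x => scaledMax_le (hw x x.2) hε y⟩
    refine le_trans (le_scaledMax hε _ _ (Nat.le_floor ?_)) (le_ciSup hbdd ⟨x, hx⟩)
    rwa [le_div_iff₀ hε', mul_comm]

lemma iSup_scaledMax_le_orderSup (hw : ∀ x ∈ E, ∀ y, ‖w x y‖ ≤ B) (hε : 0 ≤ ε) (y : M) :
    ⨆ x : E, scaledMax T ε (w x) y ≤ orderSup T w E ε y := by
  refine Real.iSup_le (fun x => ?_) (orderSup_nonneg T w E hε y)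
  obtain ⟨n, hn, hmax⟩ := exists_scaledMax_eq T ε (w x) y
  rw [hmax]
  rcases Nat.eq_zero_or_pos n with rfl | hn0
  · rw [birkhoffSum_zero, norm_zero, mul_zero]
    exact orderSup_nonneg T w E hε y
  · refine le_csSup ⟨B, ?_⟩ ⟨x, x.2, n, hn0, mul_natCast_le_one hε hn, rfl⟩
    rintro _ ⟨x, hx, n, -, hn, rfl⟩
    exact mul_norm_birkhoffSum_le (hw x hx) hε hn y

lemma orderSup_eq_iSup_scaledMax (hw : ∀ x ∈ E, ∀ y, ‖w x y‖ ≤ B) (hε : 0 ≤ ε) (y : M) :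
    orderSup T w E ε y = ⨆ x : E, scaledMax T ε (w x) y :=
  le_antisymm (orderSup_le_iSup_scaledMax hw hε y) (iSup_scaledMax_le_orderSup hw hε y)

section Lipschitz

variable [PseudoMetricSpace X] [PseudoMetricSpace M]

/-- The observables `w x`, `x ∈ E`, are bounded by `B` and jointly `B`-Lipschitz in `(x, y)`, where
the product carries the sum of the two distances. -/
structure IsLipObservable (w : X → M → F) (E : Set X) (B : ℝ) : Prop where
  norm_le : ∀ x ∈ E, ∀ y, ‖w x y‖ ≤ B
  norm_sub_le : ∀ x ∈ E, ∀ x' ∈ E, ∀ y y', ‖w x y - w x' y'‖ ≤ B * (dist x x' + dist y y')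

namespace IsLipObservable

variable {x x' : X}

lemma mono (hw : IsLipObservable w E B) {E' : Set X} (hE : E' ⊆ E) : IsLipObservable w E' B :=
  ⟨fun x hx => hw.norm_le x (hE hx), fun x hx x' hx' => hw.norm_sub_le x (hE hx) x' (hE hx')⟩

lemma norm_sub_le_left (hw : IsLipObservable w E B) (hx : x ∈ E) (hx' : x' ∈ E) (y : M) :
    ‖w x y - w x' y‖ ≤ B * dist x x' := by
  simpa only [dist_self, add_zero] using hw.norm_sub_le x hx x' hx' y y

lemma norm_sub_le_right (hw : IsLipObservable w E B) (hx : x ∈ E) (y y' : M) :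
    ‖w x y - w x y'‖ ≤ B * dist y y' := by
  simpa only [dist_self, zero_add] using hw.norm_sub_le x hx x hx y y'

lemma abs_scaledMax_sub_le (hw : IsLipObservable w E B) (hε : 0 ≤ ε) (hx : x ∈ E) (hx' : x' ∈ E)
    (y : M) : |scaledMax T ε (w x) y - scaledMax T ε (w x') y| ≤ B * dist x x' := by
  have hle := scaledMax_le_add (T := T) (hw.norm_sub_le_left hx hx') hε y
  have hge := scaledMax_le_add (T := T) (hw.norm_sub_le_left hx' hx) hε y
  rw [dist_comm x' x] at hge
  rw [abs_sub_le_iff]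
  constructor <;> linarith

variable [MeasurableSpace M] [OpensMeasurableSpace M] [SecondCountableTopology M]

lemma stronglyMeasurable (hw : IsLipObservable w E B) (hx : x ∈ E) : StronglyMeasurable (w x) :=
  (LipschitzWith.of_dist_le' (K := B) fun y y' =>
    (dist_eq_norm _ _).trans_le (hw.norm_sub_le_right hx y y')).continuous.stronglyMeasurable

lemma integrable (hw : IsLipObservable w E B) {ν : Measure M} [IsFiniteMeasure ν] (hx : x ∈ E) :
    Integrable (w x) ν :=
  Integrable.of_bound (hw.stronglyMeasurable hx).aestronglyMeasurable B
    (ae_of_all _ (hw.norm_le x hx))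

lemma measurable_scaledMax (hw : IsLipObservable w E B) (hT : Measurable T) (hx : x ∈ E) :
    Measurable (scaledMax T ε (w x)) :=
  (measurable_maxBirkhoff hT (hw.stronglyMeasurable hx) _).const_mul ε

lemma measurable_orderSup [SecondCountableTopology X] (hw : IsLipObservable w E B) (hε : 0 ≤ ε)
    (hT : Measurable T) : Measurable (orderSup T w E ε) := by
  rw [funext (orderSup_eq_iSup_scaledMax (T := T) hw.norm_le hε)]
  exact measurable_iSup_of_continuous
    (fun y => (LipschitzWith.of_dist_le' fun x x' : E =>
      hw.abs_scaledMax_sub_le hε x.2 x'.2 y).continuous)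
    fun x => hw.measurable_scaledMax hT x.2

end IsLipObservable

end Lipschitz

section Moments

variable {ι : Type*} [Fintype ι]

lemma norm_rpow_le_sum_abs_rpow (hq : 0 < q) (z : ι → ℝ) : ‖z‖ ^ q ≤ ∑ i, |z i| ^ q := by
  have hsum : ∀ i, 0 ≤ |z i| ^ q := fun i => Real.rpow_nonneg (abs_nonneg _) q
  have hsum0 : 0 ≤ ∑ i, |z i| ^ q := Finset.sum_nonneg fun i _ => hsum i
  rw [← Real.le_rpow_inv_iff_of_pos (norm_nonneg z) hsum0 hq,
    pi_norm_le_iff_of_nonneg (Real.rpow_nonneg hsum0 _)]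
  intro i
  rw [Real.norm_eq_abs, Real.le_rpow_inv_iff_of_pos (abs_nonneg _) hsum0 hq]
  exact Finset.single_le_sum (f := fun i => |z i| ^ q) (fun i _ => hsum i) (Finset.mem_univ i)

variable [NormedSpace ℝ F]

lemma maxBirkhoff_rpow_le_sum (e : F →ₗᵢ[ℝ] (ι → ℝ)) (hq : 0 < q) (u : M → F) (N : ℕ) (y : M) :
    maxBirkhoff T u N y ^ q ≤ ∑ i, maxBirkhoff T (fun y => e (u y) i) N y ^ q := by
  obtain ⟨n, hn, hmax⟩ := exists_maxBirkhoff_eq T u N y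
  rw [hmax, ← e.norm_map]
  refine (norm_rpow_le_sum_abs_rpow hq _).trans (Finset.sum_le_sum fun i _ => ?_)
  have hcoord : e (birkhoffSum T u n y) i = birkhoffSum T (fun y => e (u y) i) n y := by
    simp only [birkhoffSum, map_sum, Finset.sum_apply]
  rw [hcoord]
  gcongr
  exact norm_birkhoffSum_le_maxBirkhoff T (fun y => e (u y) i) hn y

lemma rpow_mul_floor_rpow_le (hε : 0 < ε) (hb : 0 ≤ b) :
    ε ^ q * (⌊1 / ε⌋₊ : ℝ) ^ b ≤ ε ^ (q - b) := by
  calc ε ^ q * (⌊1 / ε⌋₊ : ℝ) ^ b = ε ^ (q - b) * (ε * (⌊1 / ε⌋₊ : ℝ)) ^ b := by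
        rw [Real.mul_rpow hε.le (Nat.cast_nonneg _), ← mul_assoc, ← Real.rpow_add hε,
          sub_add_cancel]
    _ ≤ ε ^ (q - b) := mul_le_of_le_one_right (by positivity)
        (Real.rpow_le_one (by positivity) (mul_natCast_le_one hε.le le_rfl) hb)

variable [CompleteSpace F] [PseudoMetricSpace X] [MetricSpace M] [MeasurableSpace M]
  [OpensMeasurableSpace M] [SecondCountableTopology M] {ν : Measure M} [IsFiniteMeasure ν] {x : X}

namespace HasMaximalMomentBound

lemma lintegral_maxBirkhoff_rpow_le (h : HasMaximalMomentBound T ν B q b C)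
    (e : F →ₗᵢ[ℝ] (ι → ℝ)) (hq : 0 < q) (hT : Measurable T) (hw : IsLipObservable w E B)
    (hx : x ∈ E) (hmean : ∫ y, w x y ∂ν = 0) {N : ℕ} (hN : 1 ≤ N) :
    ∫⁻ y, ENNReal.ofReal (maxBirkhoff T (w x) N y ^ q) ∂ν ≤
      Fintype.card ι * ENNReal.ofReal (C * N ^ b) := by
  set v : ι → M → ℝ := fun i y => e (w x y) i
  have hcoord : ∀ i z, |e z i| ≤ ‖z‖ := fun i z => (norm_le_pi_norm (e z) i).trans_eq (e.norm_map z)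
  have hv : ∀ i, StronglyMeasurable (v i) := fun i =>
    ((continuous_apply i).comp e.continuous).comp_stronglyMeasurable (hw.stronglyMeasurable hx)
  have hvLip : ∀ i y y', |v i y - v i y'| ≤ B * dist y y' := fun i y y' => by
    simp only [v, ← Pi.sub_apply, ← map_sub]
    exact (hcoord i _).trans (hw.norm_sub_le_right hx y y')
  have hv0 : ∀ i, ∫ y, v i y ∂ν = 0 := fun i => by
    have hcomm := ((ContinuousLinearMap.proj (R := ℝ) i).comp
      e.toContinuousLinearMap).integral_comp_comm (hw.integrable (ν := ν) hx)
    rwa [hmean, map_zero] at hcomm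
  have hmax0 : ∀ y i, 0 ≤ maxBirkhoff T (v i) N y ^ q := fun y i =>
    Real.rpow_nonneg (maxBirkhoff_nonneg T _ N y) q
  calc ∫⁻ y, ENNReal.ofReal (maxBirkhoff T (w x) N y ^ q) ∂ν
      ≤ ∫⁻ y, ∑ i, ENNReal.ofReal (maxBirkhoff T (v i) N y ^ q) ∂ν := lintegral_mono fun y =>
        (ENNReal.ofReal_le_ofReal (maxBirkhoff_rpow_le_sum e hq (w x) N y)).trans_eq
          (ENNReal.ofReal_sum_of_nonneg fun i _ => hmax0 y i)
    _ = ∑ i, ∫⁻ y, ENNReal.ofReal (maxBirkhoff T (v i) N y ^ q) ∂ν :=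
        lintegral_finsetSum _ fun i _ =>
          ((measurable_maxBirkhoff hT (hv i) N).pow_const q).ennreal_ofReal
    _ ≤ ∑ _i : ι, ENNReal.ofReal (C * N ^ b) := Finset.sum_le_sum fun i _ =>
        h (v i) (fun y => (hcoord i _).trans (hw.norm_le x hx y)) (hvLip i) (hv0 i) N hN
    _ = Fintype.card ι * ENNReal.ofReal (C * N ^ b) := by
        rw [Finset.sum_const, Finset.card_univ, nsmul_eq_mul]

lemma lintegral_scaledMax_rpow_le (h : HasMaximalMomentBound T ν B q b C)
    (e : F →ₗᵢ[ℝ] (ι → ℝ)) (hq : 0 < q) (hb : 0 ≤ b) (hC : 0 ≤ C) (hε : 0 ≤ ε)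
    (hT : Measurable T) (hw : IsLipObservable w E B) (hx : x ∈ E) (hmean : ∫ y, w x y ∂ν = 0) :
    ∫⁻ y, ENNReal.ofReal (scaledMax T ε (w x) y ^ q) ∂ν ≤
      ENNReal.ofReal (Fintype.card ι * C * ε ^ (q - b)) := by
  rcases Nat.eq_zero_or_pos ⌊1 / ε⌋₊ with hN | hN
  · have hzero : ∀ y, scaledMax T ε (w x) y = 0 := fun y => by
      obtain ⟨n, hn, hmax⟩ := exists_scaledMax_eq T ε (w x) y
      obtain rfl := Nat.le_zero.1 (hn.trans_eq hN)
      rw [hmax, birkhoffSum_zero, norm_zero, mul_zero]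
    simp only [hzero, Real.zero_rpow hq.ne', ENNReal.ofReal_zero, lintegral_zero, zero_le]
  have hε' : 0 < ε := hε.lt_of_ne fun h0 => by simp [← h0] at hN
  calc ∫⁻ y, ENNReal.ofReal (scaledMax T ε (w x) y ^ q) ∂ν
      = ENNReal.ofReal (ε ^ q) *
          ∫⁻ y, ENNReal.ofReal (maxBirkhoff T (w x) ⌊1 / ε⌋₊ y ^ q) ∂ν := by
        rw [← lintegral_const_mul' _ _ ENNReal.ofReal_ne_top]
        refine lintegral_congr fun y => ?_
        rw [scaledMax, Real.mul_rpow hε (maxBirkhoff_nonneg _ _ _ _),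
          ENNReal.ofReal_mul (by positivity)]
    _ ≤ ENNReal.ofReal (ε ^ q) * (Fintype.card ι * ENNReal.ofReal (C * ⌊1 / ε⌋₊ ^ b)) := by
        gcongr
        exact h.lintegral_maxBirkhoff_rpow_le e hq hT hw hx hmean hN
    _ = ENNReal.ofReal (Fintype.card ι * C * (ε ^ q * ⌊1 / ε⌋₊ ^ b)) := by
        rw [← ENNReal.ofReal_natCast, ← ENNReal.ofReal_mul (Nat.cast_nonneg _),
          ← ENNReal.ofReal_mul (by positivity)]
        congr 1
        ring
    _ ≤ ENNReal.ofReal (Fintype.card ι * C * ε ^ (q - b)) := by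
        gcongr
        exact rpow_mul_floor_rpow_le hε' hb

theorem lintegral_orderSup_rpow_le {d : ℕ} {w : (Fin d → ℝ) → M → F} {x₀ : Fin d → ℝ} {R : ℝ}
    (h : HasMaximalMomentBound T ν B q b C) (e : F →ₗᵢ[ℝ] (ι → ℝ)) (hq : 0 < q) (hb : 0 ≤ b)
    (hC : 0 ≤ C) (hB : 0 < B) (hR : 0 ≤ R) (hε : 0 ≤ ε) (hT : Measurable T)
    (hw : IsLipObservable w (Metric.closedBall x₀ R) B)
    (hmean : ∀ x ∈ Metric.closedBall x₀ R, ∫ y, w x y ∂ν = 0) :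
    ∫⁻ y, ENNReal.ofReal (orderSup T w (Metric.closedBall x₀ R) ε y ^ (q + d)) ∂ν ≤
      ENNReal.ofReal (2 ^ q * B ^ d * (2 * (R + 1)) ^ d * (Fintype.card ι * C) * ε ^ (q - b)) := by
  simp only [orderSup_eq_iSup_scaledMax (T := T) hw.norm_le hε]
  rw [mul_assoc, ENNReal.ofReal_mul (by positivity)]
  exact lintegral_iSup_closedBall_rpow_le hB hR hq (fun x _ => scaledMax_nonneg hε (w x))
    (fun x hx => scaledMax_le (hw.norm_le x hx) hε)
    (fun x hx x' hx' => hw.abs_scaledMax_sub_le hε hx hx')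
    (fun x hx => hw.measurable_scaledMax hT hx)
    fun x hx => h.lintegral_scaledMax_rpow_le e hq hb hC hε hT hw hx (hmean x hx)

end HasMaximalMomentBound

end Moments

end OrderFunction

section CentredObservable

variable {M X F : Type*} [MetricSpace M] [MeasurableSpace M] [PseudoMetricSpace X]
  [NormedAddCommGroup F] [NormedSpace ℝ F] {w : X → M → F} {E : Set X} {x x' : X} {L : ℝ}
  {ν : Measure M} [IsProbabilityMeasure ν]

namespace IsLipObservable

lemma norm_integral_le (hw : IsLipObservable w E L) (hx : x ∈ E) : ‖∫ z, w x z ∂ν‖ ≤ L := by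
  simpa only [probReal_univ, mul_one] using
    norm_integral_le_of_norm_le_const (μ := ν) (ae_of_all _ (hw.norm_le x hx))

variable [OpensMeasurableSpace M] [SecondCountableTopology M]

lemma norm_integral_sub_le (hw : IsLipObservable w E L) (hx : x ∈ E) (hx' : x' ∈ E) :
    ‖∫ z, w x z ∂ν - ∫ z, w x' z ∂ν‖ ≤ L * dist x x' := by
  rw [← integral_sub (hw.integrable hx) (hw.integrable hx')]
  simpa only [probReal_univ, mul_one] using
    norm_integral_le_of_norm_le_const (μ := ν) (ae_of_all _ (hw.norm_sub_le_left hx hx'))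

lemma sub_integral (hw : IsLipObservable w E L) :
    IsLipObservable (fun x y => w x y - ∫ z, w x z ∂ν) E (2 * L) where
  norm_le x hx y := by
    have hmean := hw.norm_integral_le (ν := ν) hx
    linarith [_root_.norm_sub_le (w x y) (∫ z, w x z ∂ν), hw.norm_le x hx y]
  norm_sub_le x hx x' hx' y y' := by
    have hL : 0 ≤ L := (norm_nonneg _).trans (hw.norm_le x hx y)
    calc ‖w x y - ∫ z, w x z ∂ν - (w x' y' - ∫ z, w x' z ∂ν)‖
        ≤ ‖w x y - w x' y'‖ + ‖∫ z, w x z ∂ν - ∫ z, w x' z ∂ν‖ := by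
          rw [sub_sub_sub_comm]
          exact _root_.norm_sub_le _ _
      _ ≤ L * (dist x x' + dist y y') + L * (dist x x' + dist y y') := by
          refine add_le_add (hw.norm_sub_le x hx x' hx' y y')
            ((hw.norm_integral_sub_le hx hx').trans ?_)
          gcongr
          exact le_add_of_nonneg_right dist_nonneg
      _ = 2 * L * (dist x x' + dist y y') := by ring

lemma integral_sub_integral [CompleteSpace F] (hw : IsLipObservable w E L) (hx : x ∈ E) :
    ∫ y, (w x y - ∫ z, w x z ∂ν) ∂ν = 0 := by
  rw [integral_sub (hw.integrable hx) (integrable_const _), integral_const, probReal_univ, one_smul,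
    sub_self]

end IsLipObservable

end CentredObservable

section LipNorm

variable {M F : Type*} [MetricSpace M] [NormedAddCommGroup F] {d : ℕ} {ε₀ ε L : ℝ}
  {E : Set (Fin d → ℝ)} {x x' : Fin d → ℝ} {g : (Fin d → ℝ) → M → ℝ → F}

lemma enorm_le_lipNorm (g : (Fin d → ℝ) → M → ℝ → F) (hε : ε ∈ Ico 0 ε₀) (hx : x ∈ E) (y : M) :
    ‖g x y ε‖ₑ ≤ lipNorm E ε₀ g := by
  refine le_trans ?_ le_self_add
  refine le_iSup₂_of_le ε hε <| le_iSup₂_of_le x hx ?_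
  exact le_iSup (fun y => ‖g x y ε‖ₑ) y

lemma enorm_sub_div_edist_le_lipNorm (g : (Fin d → ℝ) → M → ℝ → F) (hε : ε ∈ Ico 0 ε₀)
    (hx : x ∈ E) (hx' : x' ∈ E) (y y' : M) :
    ‖g x y ε - g x' y' ε‖ₑ / (edist x x' + edist y y') ≤ lipNorm E ε₀ g := by
  refine le_trans ?_ le_add_self
  refine le_iSup₂_of_le ε hε <| le_iSup₂_of_le x hx <| le_iSup₂_of_le x' hx' ?_
  exact le_iSup₂ (f := fun y y' => ‖g x y ε - g x' y' ε‖ₑ / (edist x x' + edist y y')) y y'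

lemma isLipObservable_of_lipNorm_le (hg : lipNorm E ε₀ g ≤ ENNReal.ofReal L) (hL : 0 ≤ L)
    (hε : ε ∈ Ico 0 ε₀) : IsLipObservable (fun x y => g x y ε) E L where
  norm_le x hx y := by
    have hle := (enorm_le_lipNorm g hε hx y).trans hg
    rwa [← ofReal_norm, ENNReal.ofReal_le_ofReal_iff hL] at hle
  norm_sub_le x hx x' hx' y y' := by
    rcases eq_or_ne (edist x x' + edist y y') 0 with h0 | h0
    · obtain ⟨hxx', hyy'⟩ := add_eq_zero.1 h0
      obtain rfl := edist_eq_zero.1 hxx'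
      obtain rfl := edist_eq_zero.1 hyy'
      simp only [sub_self, norm_zero, dist_self, add_zero, mul_zero, le_refl]
    · have hle := (enorm_sub_div_edist_le_lipNorm g hε hx hx' y y').trans hg
      rwa [ENNReal.div_le_iff h0 (ENNReal.add_ne_top.2 ⟨edist_ne_top _ _, edist_ne_top _ _⟩),
        edist_dist, edist_dist, ← ENNReal.ofReal_add dist_nonneg dist_nonneg,
        ← ENNReal.ofReal_mul hL, ← ofReal_norm, ENNReal.ofReal_le_ofReal_iff (by positivity)] at hle

lemma exists_isLipObservable (hg : lipNorm E ε₀ g ≠ ∞) :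
    ∃ L, 0 < L ∧ ∀ ε ∈ Ico 0 ε₀, IsLipObservable (fun x y => g x y ε) E L := by
  have hL : 0 < (lipNorm E ε₀ g).toReal + 1 := by positivity
  refine ⟨_, hL, fun ε hε => isLipObservable_of_lipNorm_le ?_ hL.le hε⟩
  exact (ENNReal.le_ofReal_iff_toReal_le hg hL.le).2 (le_add_of_nonneg_right zero_le_one)

end LipNorm

section DerivativeOfMean

variable {M V G : Type*} [MetricSpace M] [NormedAddCommGroup V] [NormedAddCommGroup G]
  {f : V → M → G} {x : V} {L : ℝ}

lemma IsLipObservable.continuous_uncurry (hf : IsLipObservable f univ L) :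
    Continuous (Function.uncurry fun y x => f x y) :=
  (LipschitzWith.uncurry
    (fun x => LipschitzWith.of_dist_le' fun y y' =>
      (dist_eq_norm _ _).trans_le (hf.norm_sub_le_right (mem_univ x) y y'))
    fun y => LipschitzWith.of_dist_le' fun x x' =>
      (dist_eq_norm _ _).trans_le (hf.norm_sub_le_left (mem_univ x) (mem_univ x') y)).continuous

variable [MeasurableSpace M] [OpensMeasurableSpace M] [SecondCountableTopology M]
  [NormedSpace ℝ V] [FiniteDimensional ℝ V] [MeasurableSpace V] [BorelSpace V]
  [NormedSpace ℝ G] [FiniteDimensional ℝ G] {ν : Measure M} [IsFiniteMeasure ν]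

lemma IsLipObservable.hasFDerivAt_integral (hf : IsLipObservable f univ L)
    (hd : ∀ y, DifferentiableAt ℝ (fun x' => f x' y) x) :
    Integrable (fun z => fderiv ℝ (fun x' => f x' z) x) ν ∧
      HasFDerivAt (fun x' => ∫ z, f x' z ∂ν) (∫ z, fderiv ℝ (fun x' => f x' z) x ∂ν) x := by
  have : ProperSpace V := FiniteDimensional.proper ℝ V
  have : CompleteSpace G := FiniteDimensional.complete ℝ G
  have hmeas : Measurable fun z => fderiv ℝ (fun x' => f x' z) x :=
    (measurable_fderiv_with_param ℝ hf.continuous_uncurry).comp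
      (measurable_id.prodMk measurable_const)
  refine hasFDerivAt_integral_of_dominated_loc_of_lip (bound := fun _ => L) univ_mem
    (Eventually.of_forall fun x => (hf.integrable (mem_univ x)).aestronglyMeasurable)
    (hf.integrable (mem_univ x)) hmeas.aestronglyMeasurable (ae_of_all _ fun z => ?_)
    (integrable_const L) (ae_of_all _ fun z => (hd z).hasFDerivAt)
  have hL : 0 ≤ L := (norm_nonneg _).trans (hf.norm_le x (mem_univ x) z)
  refine LipschitzWith.lipschitzOnWith (LipschitzWith.of_dist_le_mul fun x x' => ?_)
  rw [dist_eq_norm, Real.coe_nnabs, abs_of_nonneg hL]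
  exact hf.norm_sub_le_left (mem_univ x) (mem_univ x') z

end DerivativeOfMean

section Jacobian

variable {M : Type*} [MetricSpace M] [MeasurableSpace M] [OpensMeasurableSpace M]
  [SecondCountableTopology M] {d : ℕ} {f : (Fin d → ℝ) → M → (Fin d → ℝ)} {E : Set (Fin d → ℝ)}
  {x : Fin d → ℝ} {L L' : ℝ} {ν : Measure M}

/-- The matrix of a linear map `ℝ^d → ℝ^d`, as a continuous linear function of that map, so that
forming the Jacobian matrix of a derivative commutes with integrals. -/
noncomputable def entriesCLM (d : ℕ) :
    ((Fin d → ℝ) →L[ℝ] (Fin d → ℝ)) →L[ℝ] (Fin d → Fin d → ℝ) :=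
  .pi fun i => .pi fun j => (ContinuousLinearMap.proj i).comp
    (ContinuousLinearMap.apply ℝ (Fin d → ℝ) (Pi.single j 1 : Fin d → ℝ))

lemma jac_eq_entriesCLM (g : (Fin d → ℝ) → (Fin d → ℝ)) (x : Fin d → ℝ) :
    jac g x = entriesCLM d (fderiv ℝ g x) :=
  rfl

namespace IsLipObservable

lemma jac_sub_integral [IsFiniteMeasure ν] (hf : IsLipObservable f univ L)
    (hd : ∀ y, DifferentiableAt ℝ (fun x' => f x' y) x) (y : M) :
    jac (fun x' => f x' y - ∫ z, f x' z ∂ν) x =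
      jac (fun x' => f x' y) x - ∫ z, jac (fun x' => f x' z) x ∂ν := by
  obtain ⟨hint, hderiv⟩ := hf.hasFDerivAt_integral (ν := ν) hd
  simp only [jac_eq_entriesCLM]
  rw [(entriesCLM d).integral_comp_comm hint, ← map_sub]
  exact congrArg (entriesCLM d) ((hd y).hasFDerivAt.sub hderiv).fderiv

variable [IsProbabilityMeasure ν]

lemma jac_centred (hf : IsLipObservable f univ L)
    (hd : ∀ y, ∀ x ∈ E, DifferentiableAt ℝ (fun x' => f x' y) x)
    (hJ : IsLipObservable (fun x y => jac (fun x' => f x' y) x) E L') :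
    IsLipObservable (fun x y => jac (fun x' => f x' y - ∫ z, f x' z ∂ν) x) E (2 * L') := by
  have hcentred := hJ.sub_integral (ν := ν)
  constructor
  · intro x hx y
    rw [hf.jac_sub_integral fun y => hd y x hx]
    exact hcentred.norm_le x hx y
  · intro x hx x' hx' y y'
    rw [hf.jac_sub_integral fun y => hd y x hx, hf.jac_sub_integral fun y => hd y x' hx']
    exact hcentred.norm_sub_le x hx x' hx' y y'

lemma integral_jac_centred (hf : IsLipObservable f univ L)
    (hd : ∀ y, ∀ x ∈ E, DifferentiableAt ℝ (fun x' => f x' y) x)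
    (hJ : IsLipObservable (fun x y => jac (fun x' => f x' y) x) E L') (hx : x ∈ E) :
    ∫ y, jac (fun x' => f x' y - ∫ z, f x' z ∂ν) x ∂ν = 0 := by
  simp only [hf.jac_sub_integral fun y => hd y x hx]
  exact hJ.integral_sub_integral hx

end IsLipObservable

end Jacobian

section Rate

lemma rate_exponent {p : ℝ} (hp : 1 < p) : p - 1 - momentExponent p / p * (p - 1) =
    if 2 < p then (p - 1) / 2 else (p - 1) ^ 2 / p := by
  have hp0 : p ≠ 0 := by linarith
  split_ifs with hp2
  · rw [momentExponent, max_eq_left (by linarith)]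
    field_simp
    ring
  · rw [momentExponent, max_eq_right (by linarith)]
    field_simp

variable {M F ι : Type*} [MetricSpace M] [SecondCountableTopology M] [BoundedSpace M]
  [MeasurableSpace M] [StandardBorelSpace M] [BorelSpace M] [NormedAddCommGroup F]
  [NormedSpace ℝ F] [CompleteSpace F] [Fintype ι] {m : Measure M} {T : ℝ → M → M} {d : ℕ}
  {ε₀ p R B : ℝ}

theorem IsUniformFamily.exists_lintegral_orderSup_rpow_le (hT : IsUniformFamily m T ε₀ p)
    (hp : 1 < p) (e : F →ₗᵢ[ℝ] (ι → ℝ)) (x₀ : Fin d → ℝ) (hR : 0 ≤ R) (hB : 0 < B) :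
    ∃ A, 0 < A ∧ ∀ ε ∈ Ico 0 ε₀, ∀ ν, IsProbabilityMeasure ν → MeasurePreserving (T ε) ν ν →
      ν ≪ m → ∀ w : (Fin d → ℝ) → M → F, IsLipObservable w (Metric.closedBall x₀ R) B →
      (∀ x ∈ Metric.closedBall x₀ R, ∫ y, w x y ∂ν = 0) →
      ∫⁻ y, ENNReal.ofReal (orderSup (T ε) w (Metric.closedBall x₀ R) ε y ^ (p + d - 1)) ∂ν ≤
        ENNReal.ofReal (A * ε ^ if 2 < p then (p - 1) / 2 else (p - 1) ^ 2 / p) := by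
  obtain ⟨C, hC, hmoment⟩ := hT.exists_hasMaximalMomentBound hp B
  have hb : 0 ≤ momentExponent p / p * (p - 1) :=
    mul_nonneg (div_nonneg (le_max_of_le_right zero_le_one) (by linarith)) (by linarith)
  set A := 2 ^ (p - 1) * B ^ d * (2 * (R + 1)) ^ d * (Fintype.card ι * C)
  refine ⟨A + 1, by positivity, fun ε hε ν hprob hmp hac w hw hmean => ?_⟩
  rw [← rate_exponent hp, add_sub_right_comm]
  refine ((hmoment ε hε ν hprob hmp hac).lintegral_orderSup_rpow_le e (by linarith) hb hC hB hR
    hε.1 hmp.measurable hw hmean).trans (ENNReal.ofReal_le_ofReal ?_)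
  exact mul_le_mul_of_nonneg_right (le_add_of_nonneg_right zero_le_one) (Real.rpow_nonneg hε.1 _)

end Rate

section SumOfTwo

variable {M : Type*} [MeasurableSpace M] {ν : Measure M} {S₁ S₂ : M → ℝ} {r c c₁ c₂ : ℝ}

lemma integrable_and_integral_le_of_lintegral_le {f : M → ℝ} (hf : AEStronglyMeasurable f ν)
    (hf0 : ∀ y, 0 ≤ f y) (hc : 0 ≤ c)
    (hle : ∫⁻ y, ENNReal.ofReal (f y) ∂ν ≤ ENNReal.ofReal c) :
    Integrable f ν ∧ ∫ y, f y ∂ν ≤ c := by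
  have hint : Integrable f ν :=
    ⟨hf, (hasFiniteIntegral_iff_ofReal (ae_of_all _ hf0)).2 (hle.trans_lt ENNReal.ofReal_lt_top)⟩
  refine ⟨hint, ?_⟩
  rwa [← ENNReal.ofReal_le_ofReal_iff hc,
    ofReal_integral_eq_lintegral_ofReal hint (ae_of_all _ hf0)]

lemma lintegral_add_rpow_le (hS₁ : Measurable S₁) (hS₁0 : ∀ y, 0 ≤ S₁ y) (hS₂0 : ∀ y, 0 ≤ S₂ y)
    (hr : 0 ≤ r) :
    ∫⁻ y, ENNReal.ofReal ((S₁ y + S₂ y) ^ r) ∂ν ≤ ENNReal.ofReal (2 ^ r) *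
      (∫⁻ y, ENNReal.ofReal (S₁ y ^ r) ∂ν + ∫⁻ y, ENNReal.ofReal (S₂ y ^ r) ∂ν) := by
  rw [← lintegral_add_left (hS₁.pow_const r).ennreal_ofReal,
    ← lintegral_const_mul' _ _ ENNReal.ofReal_ne_top]
  refine lintegral_mono fun y => ?_
  rw [← ENNReal.ofReal_add (Real.rpow_nonneg (hS₁0 y) r) (Real.rpow_nonneg (hS₂0 y) r),
    ← ENNReal.ofReal_mul (by positivity)]
  simpa only [abs_of_nonneg (hS₁0 y), abs_of_nonneg (hS₂0 y),
    abs_of_nonneg (add_nonneg (hS₁0 y) (hS₂0 y))] using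
      ENNReal.ofReal_le_ofReal (abs_add_rpow_le_two_rpow_mul hr (S₁ y) (S₂ y))

lemma integrable_add_rpow_of_lintegral_le (hS₁ : Measurable S₁) (hS₂ : Measurable S₂)
    (hS₁0 : ∀ y, 0 ≤ S₁ y) (hS₂0 : ∀ y, 0 ≤ S₂ y) (hr : 0 ≤ r) (hc₁ : 0 ≤ c₁) (hc₂ : 0 ≤ c₂)
    (h₁ : ∫⁻ y, ENNReal.ofReal (S₁ y ^ r) ∂ν ≤ ENNReal.ofReal c₁)
    (h₂ : ∫⁻ y, ENNReal.ofReal (S₂ y ^ r) ∂ν ≤ ENNReal.ofReal c₂) :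
    Integrable (fun y => (S₁ y + S₂ y) ^ r) ν ∧
      ∫ y, (S₁ y + S₂ y) ^ r ∂ν ≤ 2 ^ r * (c₁ + c₂) := by
  refine integrable_and_integral_le_of_lintegral_le
    ((hS₁.add hS₂).pow_const r).aestronglyMeasurable
    (fun y => Real.rpow_nonneg (add_nonneg (hS₁0 y) (hS₂0 y)) r) (by positivity) ?_
  refine (lintegral_add_rpow_le hS₁ hS₁0 hS₂0 hr).trans ?_
  rw [ENNReal.ofReal_mul (by positivity), ENNReal.ofReal_add hc₁ hc₂]
  gcongr

end SumOfTwo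

/-- Matrices with the maximum norm are functions of two indices with the maximum norm. -/
noncomputable def uncurryₗᵢ (d : ℕ) : (Fin d → Fin d → ℝ) →ₗᵢ[ℝ] (Fin d × Fin d → ℝ) where
  toLinearMap := (LinearEquiv.curry ℝ ℝ (Fin d) (Fin d)).symm
  norm_map' z := by
    refine le_antisymm ((pi_norm_le_iff_of_nonneg (norm_nonneg z)).2 fun ij =>
      (norm_le_pi_norm (z ij.1) ij.2).trans (norm_le_pi_norm z ij.1)) ?_
    refine (pi_norm_le_iff_of_nonneg (norm_nonneg _)).2 fun i =>
      (pi_norm_le_iff_of_nonneg (norm_nonneg _)).2 fun j => ?_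
    exact norm_le_pi_norm (Function.uncurry z) (i, j)

end FastSlow

theorem theorem4p2_general {M : Type*} [MetricSpace M] [SecondCountableTopology M] [BoundedSpace M]
    [MeasurableSpace M] [StandardBorelSpace M] [BorelSpace M] (m : Measure M) (d : ℕ) (ε₀ p R : ℝ)
    (hp : 1 < p) (hR : 0 ≤ R) (T : ℝ → M → M) (hT : FastSlow.IsUniformFamily m T ε₀ p)
    (ν : ℝ → Measure M) (hν : ∀ ε ∈ Ico 0 ε₀,
      IsProbabilityMeasure (ν ε) ∧ MeasurePreserving (T ε) (ν ε) (ν ε) ∧ ν ε ≪ m)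
    (x₀ : Fin d → ℝ) (a : (Fin d → ℝ) → M → ℝ → (Fin d → ℝ))
    (ha : FastSlow.lipNorm univ ε₀ a ≠ ∞)
    (ha' : ∀ ε ∈ Ico 0 ε₀, ∀ y, ∀ x ∈ Metric.closedBall x₀ R,
      DifferentiableAt ℝ (fun x' => a x' y ε) x)
    (hDa : FastSlow.lipNorm (Metric.closedBall x₀ R) ε₀
      (fun x y ε => FastSlow.jac (fun x' => a x' y ε) x) ≠ ∞) :
    ∃ C : ℝ, 0 < C ∧ ∀ ε ∈ Ico 0 ε₀,
      Integrable (fun y => FastSlow.orderFunction a T ν (Metric.closedBall x₀ R) ε y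
        ^ (p + d - 1)) (ν ε) ∧
      ∫ y, FastSlow.orderFunction a T ν (Metric.closedBall x₀ R) ε y ^ (p + d - 1) ∂(ν ε) ≤
        if 2 < p then C * ε ^ ((p - 1) / 2) else C * ε ^ ((p - 1) ^ 2 / p) := by
  obtain ⟨L₁, hL₁, hLip⟩ := FastSlow.exists_isLipObservable ha
  obtain ⟨L₂, hL₂, hLipD⟩ := FastSlow.exists_isLipObservable hDa
  obtain ⟨A₁, hA₁, hδ₁⟩ := hT.exists_lintegral_orderSup_rpow_le (B := 2 * L₁) hp
    (LinearIsometry.id : (Fin d → ℝ) →ₗᵢ[ℝ] Fin d → ℝ) x₀ hR (by positivity)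
  obtain ⟨A₂, hA₂, hδ₂⟩ := hT.exists_lintegral_orderSup_rpow_le (B := 2 * L₂) hp
    (FastSlow.uncurryₗᵢ d) x₀ hR (by positivity)
  refine ⟨2 ^ (p + d - 1) * (A₁ + A₂), by positivity, fun ε hε => ?_⟩
  obtain ⟨hprob, hmp, hac⟩ := hν ε hε
  have hv := ((hLip ε hε).sub_integral (ν := ν ε)).mono (subset_univ (Metric.closedBall x₀ R))
  have hDv := (hLip ε hε).jac_centred (ν := ν ε) (ha' ε hε) (hLipD ε hε)
  obtain ⟨hint, hle⟩ := FastSlow.integrable_add_rpow_of_lintegral_le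
    (hv.measurable_orderSup hε.1 hmp.measurable) (hDv.measurable_orderSup hε.1 hmp.measurable)
    (FastSlow.orderSup_nonneg _ _ _ hε.1) (FastSlow.orderSup_nonneg _ _ _ hε.1)
    (by linarith [Nat.cast_nonneg (α := ℝ) d])
    (mul_nonneg hA₁.le (Real.rpow_nonneg hε.1 _)) (mul_nonneg hA₂.le (Real.rpow_nonneg hε.1 _))
    (hδ₁ ε hε (ν ε) hprob hmp hac _ hv fun x _ =>
      (hLip ε hε).integral_sub_integral (mem_univ x))
    (hδ₂ ε hε (ν ε) hprob hmp hac _ hDv fun x hx =>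
      (hLip ε hε).integral_jac_centred (ha' ε hε) (hLipD ε hε) hx)
  refine ⟨hint, hle.trans_eq ?_⟩
  split_ifs <;> ring

theorem theorem4p2 {M : Type*} [MetricSpace M] [LocallyCompactSpace M]
    [TopologicalSpace.SeparableSpace M] [BoundedSpace M] [MeasurableSpace M] [BorelSpace M]
    (m : Measure M) [IsFiniteMeasure m]
    (d : ℕ) (ε₀ p L₁ L₂ L₃ : ℝ) (hε₀ : 0 < ε₀) (hp : 1 < p)
    (hL₁ : 1 ≤ L₁) (hL₂ : 1 ≤ L₂) (hL₃ : 1 ≤ L₃)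
    (T : ℝ → M → M) (hT : FastSlow.IsUniformFamily m T ε₀ p)
    (ν : ℝ → Measure M)
    (hν : ∀ ε ∈ Ico 0 ε₀, IsProbabilityMeasure (ν ε) ∧ Ergodic (T ε) (ν ε) ∧ ν ε ≪ m)
    (x₀ : Fin d → ℝ) (a : (Fin d → ℝ) → M → ℝ → (Fin d → ℝ))
    (ha : FastSlow.IsRegular a x₀ ε₀ L₁ L₂ L₃) :
    ∃ C : ℝ, 0 < C ∧ ∀ ε ∈ Ico 0 ε₀,
      Integrable (fun y => FastSlow.orderFunction a T ν (Metric.closedBall x₀ L₁) ε y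
        ^ (p + d - 1)) (ν ε) ∧
      ∫ y, FastSlow.orderFunction a T ν (Metric.closedBall x₀ L₁) ε y ^ (p + d - 1) ∂(ν ε) ≤
        if 2 < p then C * ε ^ ((p - 1) / 2) else C * ε ^ ((p - 1) ^ 2 / p) := by
  have := UniformSpace.secondCountable_of_separable M
  have := FastSlow.standardBorelSpace_of_sigmaCompact M
  exact theorem4p2_general m d ε₀ p L₁ hp (zero_le_one.trans hL₁) T hT ν
    (fun ε hε => ⟨(hν ε hε).1, (hν ε hε).2.1.toMeasurePreserving, (hν ε hε).2.2⟩) x₀ a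
    (ne_top_of_le_ne_top ENNReal.ofReal_ne_top ha.lip) ha.differentiableAt
    (ne_top_of_le_ne_top ENNReal.ofReal_ne_top ha.lip_deriv)
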